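/- **Hypergraph Painting.** An instance consists of positive integers $k,b,d,q$, a finite multihypergraph $H$ with hyperedges of size at most $d$, a partial colouring $\mathrm{col}_0 : V(H)\rightharpoonup\{\mathbf B,\mathbf W\}$, and for each hyperedge $F\in E(H)$ a function $f_F:\{\mathbf B,\mathbf W\}^F\times\{0,\dots,b\}\to\{0,1,\dots,k,\infty\}$. The solution consists of the values, for $0\le\mu\le b$, $$w_\mu=\min_{\mathrm{col}\supseteq \mathrm{col}_0,\ (a_F)_{F\in E(H)}}\ \sum_{F\in E(H)} f_F(\mathrm{col}|_F,a_F),$$ where the minimum is over colourings $\mathrm{col}:V(H)\to\{\mathbf B,\mathbf W\}$ extending $\mathrm{col}_0$ and families of non-negative integers with $\sum_{F}a_F=\mu$; the sum counts as $\infty$ if it exceeds $k$, and the minimum over no choices is $\infty$. Let $n=|V(H)|$ and $m=|E(H)|$. The instance is *proper* if - (local unbreakability) $f_F(c,\mu)=\infty$ for all $F\in E(H)$, all $0\le\mu\le b$, and all $c:F\to\{\mathbf B,\mathbf W\}$ with $|c^{-1}(\mathbf B)|>3k$ and $|c^{-1}(\mathbf W)|>3k$; - (connectivity) $f_F(c,\mu)\neq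 0$ for all $F\in E(H)$, all $0\le\mu\le b$, and all $c:F\to\{\mathbf B,\mathbf W\}$ using both colours; - (global unbreakability) for each $0\le\mu\le b$ with $w_\mu<\infty$, there is a colouring $\mathrm{col}\supseteq\mathrm{col}_0$ which, together with some $(a_F)_F$ with $\sum_F a_F=\mu$, attains $w_\mu$, and which satisfies $\min(|\mathrm{col}^{-1}(\mathbf B)|,|\mathrm{col}^{-1}(\mathbf W)|)\le q$. **Lemma.** There is an $O^*\big(q^{O(k)}\cdot d^{O(k^2)}\big)$ time algorithm solving Hypergraph Painting for proper instances. That is, there are a single deterministic algorithm and a constant $C$ such that on every proper instance the algorithm outputs all the values $w_0,\dots,w_b$ after at most $$C\cdot q^{Ck}\cdot d^{Ck^2}\cdot (n+m+b)^{C}$$ steps. Here each $f_F$ is given as a list, in any order, of its finite values together with their arguments. Time is counted on a machine with memory cells (pairs of pointers) and natural numbers, on which building or reading a cell, adding or (truncated) subtracting two numbers, and testing for zero take one step each; there is no unit-cost multiplication. -/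

import Mathlib

/-! ## Machine model

Programs work on binary trees of cells whose leaves hold natural numbers, like a pure LISP machine.
Every primitive operation (copying a pointer, building or reading one cell, adding or subtracting
two numbers, testing against zero) costs one time unit, and there is no unit-cost
multiplication. As for the unit-cost RAM with addition and subtraction, the running times are
polynomially related to those of Turing machines: a step allocates at most one cell (subtrees are
shared, never copied), and a number grows by at most one bit per addition. -/

/-- Memory contents: a number, or a cell with two pointers. -/
inductive Data : Type
  | num (a : ℕ) : Data
  | pair (x y : Data) : Data

namespace Data

/-- First component of a cell (`num 0` on a number). -/
def fst : Data → Data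
  | pair x _ => x
  | num _ => num 0

/-- Second component of a cell (`num 0` on a number). -/
def snd : Data → Data
  | pair _ y => y
  | num _ => num 0

/-- Sum of the two numbers in a cell (`num 0` on any other argument). -/
def add : Data → Data
  | pair (num a) (num b) => num (a + b)
  | _ => num 0

/-- Truncated difference of the two numbers in a cell (`num 0` on any other argument). -/
def sub : Data → Data
  | pair (num a) (num b) => num (a - b)
  | _ => num 0

/-- A list is a chain of cells that ends in `num 0`. -/
def ofList : List Data → Data
  | [] => num 0
  | x :: l => pair x (ofList l)

end Data

/-- Programs of the machine; each of them describes a partial function from data to data. -/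
inductive Program : Type
  | id : Program
  | const (a : ℕ) : Program
  | fst : Program
  | snd : Program
  | add : Program
  | sub : Program
  /-- Run both programs on the input and put the two results into a new cell. -/
  | pair (p r : Program) : Program
  /-- First run `p`, then run `r` on its result. -/
  | seq (p r : Program) : Program
  /-- If the result of `c` on the input is not `num 0` then run `p`, otherwise run `r`. -/
  | ite (c p r : Program) : Program
  /-- As long as the result of `c` on the current data is not `num 0`, apply `p` to the data. -/
  | loop (c p : Program) : Program

/-- `Runs p x y t`: on input `x`, the program `p` halts with output `y` after exactly `t` steps. -/
inductive Program.Runs : Program → Data → Data → ℕ → Prop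
  | id (x : Data) : Runs .id x x 1
  | const (a : ℕ) (x : Data) : Runs (.const a) x (.num a) 1
  | fst (x : Data) : Runs .fst x x.fst 1
  | snd (x : Data) : Runs .snd x x.snd 1
  | add (x : Data) : Runs .add x x.add 1
  | sub (x : Data) : Runs .sub x x.sub 1
  | pair {p r : Program} {x y z : Data} {s t : ℕ} :
      Runs p x y s → Runs r x z t → Runs (.pair p r) x (.pair y z) (s + t + 1)
  | seq {p r : Program} {x y z : Data} {s t : ℕ} :
      Runs p x y s → Runs r y z t → Runs (.seq p r) x z (s + t + 1)
  | ite_pos {c p r : Program} {x y z : Data} {s t : ℕ} :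
      Runs c x y s → y ≠ .num 0 → Runs p x z t → Runs (.ite c p r) x z (s + t + 1)
  | ite_neg {c p r : Program} {x z : Data} {s t : ℕ} :
      Runs c x (.num 0) s → Runs r x z t → Runs (.ite c p r) x z (s + t + 1)
  | loop_done {c p : Program} {x : Data} {s : ℕ} :
      Runs c x (.num 0) s → Runs (.loop c p) x x (s + 1)
  | loop_step {c p : Program} {x y x' z : Data} {s t u : ℕ} :
      Runs c x y s → y ≠ .num 0 → Runs p x x' t → Runs (.loop c p) x' z u →
      Runs (.loop c p) x z (s + t + u + 1)

/-! ## The hypergraph painting problem -/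

/-- The two colours. -/
inductive Colour : Type
  | black : Colour
  | white : Colour
  deriving DecidableEq

instance : Fintype Colour :=
  ⟨{.black, .white}, fun x => by cases x <;> simp⟩

/-- An instance of hypergraph painting. The vertices are `0, …, n - 1`; the multihypergraph is a
family of `m` vertex sets, in which sets may repeat. -/
structure HPInstance where
  k : ℕ
  b : ℕ
  d : ℕ
  q : ℕ
  k_pos : 0 < k
  b_pos : 0 < b
  d_pos : 0 < d
  q_pos : 0 < q
  n : ℕ
  m : ℕ
  edge : Fin m → Finset (Fin n)
  edge_card_le : ∀ e, (edge e).card ≤ d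
  /-- The partial colouring; `none` means uncoloured. -/
  col₀ : Fin n → Option Colour
  /-- The functions `f_F`, with values in `{0, 1, …, k, ∞}`. -/
  cost : (e : Fin m) → ({v // v ∈ edge e} → Colour) → Fin (b + 1) → ℕ∞
  cost_range : ∀ e c μ, cost e c μ ≤ (k : ℕ∞) ∨ cost e c μ = ⊤

namespace HPInstance

/-- `col` extends the given partial colouring. -/
def Extends (I : HPInstance) (col : Fin I.n → Colour) : Prop :=
  ∀ v c, I.col₀ v = some c → col v = c

/-- The sum of the costs of all hyperedges, replaced by `∞` if it exceeds `k`. -/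
noncomputable def totalCost (I : HPInstance) (col : Fin I.n → Colour)
    (a : Fin I.m → Fin (I.b + 1)) : ℕ∞ :=
  if ∑ e, I.cost e (fun v => col v) (a e) ≤ (I.k : ℕ∞)
  then ∑ e, I.cost e (fun v => col v) (a e) else ⊤

/-- The value `w_μ`, for `0 ≤ μ ≤ b`; it is `∞` if there is no admissible pair. (The parts of a
partition of `μ` into non-negative integers are automatically at most `b`.) -/
noncomputable def w (I : HPInstance) (μ : Fin (I.b + 1)) : ℕ∞ :=
  ⨅ (col : Fin I.n → Colour) (_ : I.Extends col)
    (a : Fin I.m → Fin (I.b + 1)) (_ : ∑ e, (a e : ℕ) = (μ : ℕ)), I.totalCost col a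

/-- The colouring `col` witnesses the value `w_μ`. -/
def Witnesses (I : HPInstance) (col : Fin I.n → Colour) (μ : Fin (I.b + 1)) : Prop :=
  I.Extends col ∧ ∃ a : Fin I.m → Fin (I.b + 1),
    ∑ e, (a e : ℕ) = (μ : ℕ) ∧ I.totalCost col a = I.w μ

/-- The number of elements of colour `x` in a colouring. -/
def colourCount {V : Type} [Fintype V] (c : V → Colour) (x : Colour) : ℕ :=
  (Finset.univ.filter fun v => c v = x).card

def LocallyUnbreakable (I : HPInstance) : Prop :=
  ∀ e (c : {v // v ∈ I.edge e} → Colour),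
    3 * I.k < colourCount c .black → 3 * I.k < colourCount c .white → ∀ μ, I.cost e c μ = ⊤

def ConnectedCosts (I : HPInstance) : Prop :=
  ∀ e (c : {v // v ∈ I.edge e} → Colour),
    0 < colourCount c .black → 0 < colourCount c .white → ∀ μ, I.cost e c μ ≠ 0

def GloballyUnbreakable (I : HPInstance) : Prop :=
  ∀ μ, I.w μ < ⊤ → ∃ col, I.Witnesses col μ ∧
    min (colourCount col .black) (colourCount col .white) ≤ I.q

/-- Proper instances. -/
def IsProper (I : HPInstance) : Prop :=
  I.LocallyUnbreakable ∧ I.ConnectedCosts ∧ I.GloballyUnbreakable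

/-! ## Input and output format -/

/-- A way of writing down an instance: an ordering of the vertices of each hyperedge, and for each
hyperedge a repetition-free list, in any order, of exactly the triples `(c, μ, f_F(c, μ))` with
`f_F(c, μ) < ∞`. -/
structure Presentation (I : HPInstance) where
  order : ∀ e, Fin (I.edge e).card ≃ {v // v ∈ I.edge e}
  table : ∀ e, List (({v // v ∈ I.edge e} → Colour) × Fin (I.b + 1) × ℕ)
  table_nodup : ∀ e, (table e).Nodup
  mem_table : ∀ e c μ (a : ℕ), (c, μ, a) ∈ table e ↔ I.cost e c μ = (a : ℕ∞)

/-- Colours are written as 1 and 2. -/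
def codeColour : Colour → Data
  | .black => .num 1
  | .white => .num 2

/-- A missing colour is written as 0. -/
def codeOptColour : Option Colour → Data
  | none => .num 0
  | some c => codeColour c

/-- A table entry: the list of the colours of the vertices of the hyperedge, in the chosen order,
then `μ`, then the value. -/
def codeEntry {I : HPInstance} (P : I.Presentation) (e : Fin I.m)
    (r : ({v // v ∈ I.edge e} → Colour) × Fin (I.b + 1) × ℕ) : Data :=
  .ofList [.ofList (List.ofFn fun i => codeColour (r.1 (P.order e i))), .num r.2.1, .num r.2.2]

/-- A hyperedge: the list of its vertices in the chosen order, and the table of its function. -/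
def codeEdge {I : HPInstance} (P : I.Presentation) (e : Fin I.m) : Data :=
  .ofList [.ofList (List.ofFn fun i => .num (P.order e i).1),
    .ofList ((P.table e).map (codeEntry P e))]

/-- The input of the algorithm. -/
def input (I : HPInstance) (P : I.Presentation) : Data :=
  .ofList [.num I.k, .num I.b, .num I.d, .num I.q, .num I.n, .num I.m,
    .ofList (List.ofFn fun v => codeOptColour (I.col₀ v)),
    .ofList (List.ofFn fun e => codeEdge P e)]

/-- In the output, `∞` is written as 0 and an integer `a` as `a + 1`. -/
noncomputable def codeValue (a : ℕ∞) : Data :=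
  if a = ⊤ then .num 0 else .num (a.toNat + 1)

/-- The required output: the list of `w_0, …, w_b`. -/
noncomputable def solution (I : HPInstance) : Data :=
  .ofList (List.ofFn fun μ => codeValue (I.w μ))

end HPInstance

/-! ## Programs with polynomial running time -/

/-! Consider an optimal colouring of finite cost in which one colour `s` occurs at most `q` times,
and let `t` be the other colour. By connectivity each bichromatic hyperedge costs at least 1, so the
set `A` of these has at most `k` members. Suppose that a labelling of the hyperedges writes the true
colours on each member of `A`, and leaves blank a family `S` of hyperedges of colour `s` that
connects the same vertices as all hyperedges of colour `s` together. The other hyperedges may carry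
any labels.

The blank hyperedges are monochromatic, hence so are the components they span. Call a labelled
hyperedge hard if it is not inside one component. A hard hyperedge carries its true colours or has
colour `t` throughout: if it had colour `s` throughout, `S` would connect its vertices. This is
`Describes`, obtained in `exists_describes`. In either case the vertices that its label marks `s`
share a colour, and its other vertices have colour `t`. Unite the components along these `s`-parts,
and give colour `t` to all clusters containing a vertex outside the `s`-part of some hard hyperedge.
Every hyperedge meets at most one of the remaining clusters (`separated_freeSets`), so these can be
coloured independently, by min-plus convolutions (`agree_dp`); the given colouring is one of the
choices (`Describes.exists_sublist`). Separation holds for arbitrary labels, so a bad labelling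
still yields values of genuine colourings and does no harm.

It remains to list few labellings, one of which is good. A rank argument gives `S` of size at most
`q` (`exists_spanning_subset`). For `a` in `A` some modulus of order `(k + q) log (n + m)` divides
no difference between `a` and another position in `A ∪ S` (`exists_modulus`). Labelling the whole
residue class of `a` with candidate number `j` is then right at `a` and blank on the rest of `A ∪
S`. Overlaying at most `k` such masks gives a good labelling (`exists_mem_masks`).

By local unbreakability a hyperedge has at most `2 * d ^ (6 * k)` candidates, so the number of
labellings is a power with exponent `k` of a polynomial in `k`, `q`, `log (n + m)` and `d ^ k`. The
power of the logarithm is at most `k ^ O(k)` times a polynomial in `n + m`, and `k ^ k ≤ d ^ (k ^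
2)` once `d ≥ 2` (`masks_count_le`). If `d = 1` there are no bichromatic candidates, and only the
blank labelling is tried. -/

namespace Data

/-- Number of nodes of the tree. -/
def size : Data → ℕ
  | num _ => 1
  | pair x y => size x + size y + 1

end Data

/-- Types whose elements can be stored in the memory of the machine. -/
class Coded (α : Type) where
  code : α → Data

open Coded

instance : Coded ℕ := ⟨.num⟩
instance : Coded Unit := ⟨fun _ => .num 0⟩
instance : Coded Bool := ⟨fun b => .num (if b then 1 else 0)⟩
instance {α β : Type} [Coded α] [Coded β] : Coded (α × β) := ⟨fun x => .pair (code x.1) (code x.2)⟩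
instance {α : Type} [Coded α] : Coded (List α) := ⟨fun l => .ofList (l.map code)⟩
instance : Coded Colour := ⟨HPInstance.codeColour⟩
instance : Coded (Option Colour) := ⟨HPInstance.codeOptColour⟩
noncomputable instance : Coded ℕ∞ := ⟨HPInstance.codeValue⟩

/-- Size of the memory representation; numbers have size one. -/
def sz {α : Type} [Coded α] (x : α) : ℕ := (code x).size

section
variable {α β γ δ : Type} [Coded α] [Coded β] [Coded γ] [Coded δ]

theorem sz_pair (x : α × β) : sz x = sz x.1 + sz x.2 + 1 := rfl

theorem sz_nil : sz ([] : List α) = 1 := rfl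

theorem sz_cons (a : α) (l : List α) : sz (a :: l) = sz a + sz l + 1 := rfl

theorem sz_nat (a : ℕ) : sz a = 1 := rfl

theorem sz_unit (a : Unit) : sz a = 1 := rfl

theorem sz_bool (a : Bool) : sz a = 1 := rfl

theorem sz_colour (a : Colour) : sz a = 1 := by cases a <;> rfl

theorem sz_optColour (a : Option Colour) : sz a = 1 := by
  rcases a with _ | a
  · rfl
  · cases a <;> rfl

theorem sz_enat (a : ℕ∞) : sz a = 1 := by
  simp only [sz, code, HPInstance.codeValue]
  split <;> rfl

theorem sz_pos (x : α) : 1 ≤ sz x := by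
  unfold sz
  cases code x <;> simp [Data.size]

theorem sz_append (l l' : List α) : sz (l ++ l') + 1 = sz l + sz l' := by
  induction l with
  | nil => simp [sz_nil]; omega
  | cons a l ih => simp only [List.cons_append, sz_cons]; omega

theorem length_lt_sz (l : List α) : l.length < sz l := by
  induction l with
  | nil => simp [sz_nil]
  | cons a l ih => simp only [List.length_cons, sz_cons]; omega

theorem sz_lt_of_mem {a : α} {l : List α} (h : a ∈ l) : sz a < sz l := by
  induction l with
  | nil => simp at h
  | cons b l ih =>
    simp only [List.mem_cons] at h
    rw [sz_cons]
    rcases h with rfl | h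
    · omega
    · have := ih h; omega

theorem sz_list_le {l : List α} {c : ℕ} (h : ∀ a ∈ l, sz a ≤ c) :
    sz l ≤ l.length * (c + 1) + 1 := by
  induction l with
  | nil => simp [sz_nil]
  | cons b l ih =>
    have h1 := h b (by simp)
    have h2 := ih fun a ha => h a (by simp [ha])
    rw [sz_cons, List.length_cons, add_mul]
    omega

theorem eval_mono (P : Polynomial ℕ) {a b : ℕ} (h : a ≤ b) : P.eval a ≤ P.eval b := by
  induction P using Polynomial.induction_on' with
  | add p q hp hq => simp only [Polynomial.eval_add]; omega
  | monomial n c => simp only [Polynomial.eval_monomial]; gcongr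

/-- `f` is computed by a program whose running time and output size on input `x` are bounded by a
polynomial in `M x`. -/
def Within (M : α → ℕ) (f : α → β) : Prop :=
  ∃ (p : Program) (P : Polynomial ℕ), ∀ x, ∃ t, p.Runs (code x) (code (f x)) t ∧
    t ≤ P.eval (M x) ∧ sz (f x) ≤ P.eval (M x)

/-- Polynomial time computability. -/
abbrev PolyTime (f : α → β) : Prop := Within sz f

namespace Within

theorem of_eq {M : α → ℕ} {f g : α → β} (h : Within M f) (e : ∀ x, f x = g x) : Within M g := by
  rwa [← funext e]

theorem mono {M M' : α → ℕ} {f : α → β} (h : Within M f) (hM : ∀ x, M x ≤ M' x) :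
    Within M' f := by
  obtain ⟨p, P, h⟩ := h
  refine ⟨p, P, fun x => ?_⟩
  obtain ⟨t, h1, h2, h3⟩ := h x
  exact ⟨t, h1, h2.trans (eval_mono _ (hM x)), h3.trans (eval_mono _ (hM x))⟩

/-- This is why `Within` bounds the output size along with the time: the outer program is polynomial
in the size of the intermediate result. -/
theorem comp {M : α → ℕ} {g : β → γ} {f : α → β} (hg : PolyTime g) (hf : Within M f) :
    Within M (fun x => g (f x)) := by
  obtain ⟨p, P, hf⟩ := hf
  obtain ⟨r, Q, hg⟩ := hg
  refine ⟨.seq p r, P + Q.comp P + 1, fun x => ?_⟩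
  obtain ⟨t, h1, h2, h3⟩ := hf x
  obtain ⟨u, k1, k2, k3⟩ := hg (f x)
  have := eval_mono Q h3
  refine ⟨_, .seq h1 k1, ?_, ?_⟩ <;>
  simp only [Polynomial.eval_add, Polynomial.eval_comp, Polynomial.eval_one] <;> omega

theorem prodMk {M : α → ℕ} {f : α → β} {g : α → γ} (hf : Within M f) (hg : Within M g) :
    Within M (fun x => (f x, g x)) := by
  obtain ⟨p, P, hf⟩ := hf
  obtain ⟨r, Q, hg⟩ := hg
  refine ⟨.pair p r, P + Q + 1, fun x => ?_⟩
  obtain ⟨t, h1, h2, h3⟩ := hf x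
  obtain ⟨u, k1, k2, k3⟩ := hg x
  refine ⟨_, .pair h1 k1, ?_, ?_⟩ <;>
  simp only [sz_pair, Polynomial.eval_add, Polynomial.eval_one] <;> omega

theorem ite {M : α → ℕ} {c : α → Prop} [DecidablePred c] {f g : α → β}
    (hc : Within M fun x => decide (c x)) (hf : Within M f) (hg : Within M g) :
    Within M (fun x => if c x then f x else g x) := by
  obtain ⟨o, O, hc⟩ := hc
  obtain ⟨p, P, hf⟩ := hf
  obtain ⟨r, Q, hg⟩ := hg
  refine ⟨.ite o p r, O + P + Q + 1, fun x => ?_⟩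
  obtain ⟨s, l1, l2, l3⟩ := hc x
  by_cases h : c x
  · obtain ⟨t, h1, h2, h3⟩ := hf x
    refine ⟨_, .ite_pos (y := .num 1) (by simpa [code, h] using l1) (by simp)
      (by simpa [h] using h1), ?_, ?_⟩ <;>
    simp only [Polynomial.eval_add, Polynomial.eval_one, h, if_true] <;> omega
  · obtain ⟨u, k1, k2, k3⟩ := hg x
    refine ⟨_, .ite_neg (by simpa [code, h] using l1) (by simpa [h] using k1), ?_, ?_⟩ <;>
    simp only [Polynomial.eval_add, Polynomial.eval_one, h, if_false] <;> omega

end Within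

theorem PolyTime.of_runs {f : α → β} (p : Program) (c : ℕ)
    (h : ∀ x, ∃ t ≤ c, p.Runs (code x) (code (f x)) t) (hs : ∀ x, sz (f x) ≤ sz x + c) :
    PolyTime f := by
  refine ⟨p, Polynomial.X + Polynomial.C c, fun x => ?_⟩
  obtain ⟨t, h1, h2⟩ := h x
  have := hs x
  refine ⟨t, h2, ?_, ?_⟩ <;> simp only [Polynomial.eval_add, Polynomial.eval_X, Polynomial.eval_C] <;>
  omega

theorem polyTime_id : PolyTime (fun x : α => x) :=
  .of_runs .id 1 (fun _ => ⟨1, le_rfl, .id _⟩) fun _ => by omega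

/-- A change of type that does not change the representation. -/
theorem PolyTime.of_code_eq {f : α → β} (h : ∀ x, code (f x) = code x) : PolyTime f :=
  .of_runs .id 1 (fun x => ⟨1, le_rfl, by rw [h]; exact .id _⟩) fun x => by
    simp [sz, h]

theorem polyTime_fst : PolyTime (fun x : α × β => x.1) :=
  .of_runs .fst 1 (fun _ => ⟨1, le_rfl, .fst _⟩) fun _ => by rw [sz_pair]; omega

theorem polyTime_snd : PolyTime (fun x : α × β => x.2) :=
  .of_runs .snd 1 (fun _ => ⟨1, le_rfl, .snd _⟩) fun _ => by rw [sz_pair]; omega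

theorem Program.exists_const (d : Data) : ∃ (p : Program) (t : ℕ), ∀ x, p.Runs x d t := by
  induction d with
  | num a => exact ⟨_, _, .const a⟩
  | pair x y hx hy =>
    obtain ⟨p, s, hp⟩ := hx
    obtain ⟨r, t, hr⟩ := hy
    exact ⟨_, _, fun x => .pair (hp x) (hr x)⟩

theorem polyTime_natAdd : PolyTime (fun x : ℕ × ℕ => x.1 + x.2) :=
  .of_runs .add 1 (fun _ => ⟨1, le_rfl, .add _⟩) fun _ => by rw [sz_nat]; omega

theorem polyTime_natSub : PolyTime (fun x : ℕ × ℕ => x.1 - x.2) :=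
  .of_runs .sub 1 (fun _ => ⟨1, le_rfl, .sub _⟩) fun _ => by rw [sz_nat]; omega

theorem polyTime_cons : PolyTime (fun x : α × List α => x.1 :: x.2) := .of_code_eq fun _ => rfl

theorem Within.fst {M : α → ℕ} {f : α → β × γ} (h : Within M f) : Within M fun x => (f x).1 :=
  .comp polyTime_fst h

theorem Within.snd {M : α → ℕ} {f : α → β × γ} (h : Within M f) : Within M fun x => (f x).2 :=
  .comp polyTime_snd h

theorem Within.const {M : α → ℕ} (b : β) : Within M (fun _ : α => b) := by
  obtain ⟨p, t, h⟩ := Program.exists_const (code b)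
  refine ⟨p, Polynomial.C (t + sz b), fun x => ⟨t, h _, ?_⟩⟩
  simp

theorem Within.comp₂ {M : α → ℕ} {f : β → γ → δ} {g : α → β} {h : α → γ}
    (hf : PolyTime fun x : β × γ => f x.1 x.2) (hg : Within M g) (hh : Within M h) :
    Within M fun x => f (g x) (h x) :=
  .comp hf (hg.prodMk hh)

theorem Within.comp₃ {ε : Type} [Coded ε] {M : α → ℕ} {f : β → γ → δ → ε} {g : α → β} {h : α → γ}
    {i : α → δ} (hf : PolyTime fun x : β × γ × δ => f x.1 x.2.1 x.2.2) (hg : Within M g)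
    (hh : Within M h) (hi : Within M i) : Within M fun x => f (g x) (h x) (i x) :=
  .comp hf (hg.prodMk (hh.prodMk hi))

theorem Within.cons {M : α → ℕ} {f : α → β} {l : α → List β} (hf : Within M f) (hl : Within M l) :
    Within M (fun x => f x :: l x) :=
  (polyTime_cons.comp (hf.prodMk hl) :)

theorem Within.add {M : α → ℕ} {f g : α → ℕ} (hf : Within M f) (hg : Within M g) :
    Within M (fun x => f x + g x) :=
  (polyTime_natAdd.comp (hf.prodMk hg) :)

theorem Within.sub {M : α → ℕ} {f g : α → ℕ} (hf : Within M f) (hg : Within M g) :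
    Within M (fun x => f x - g x) :=
  (polyTime_natSub.comp (hf.prodMk hg) :)

theorem polyTime_eq_zero : PolyTime (fun x : ℕ => decide (x = 0)) := by
  refine .of_runs (.ite .id (.const 0) (.const 1)) 3 (fun x => ?_) fun x => by
    rw [sz_bool]; omega
  by_cases h : x = 0
  · subst h
    exact ⟨3, by omega, .ite_neg (.id _) (.const _ _)⟩
  · have e : code (decide (x = 0)) = .num 0 := by simp [code, h]
    rw [e]
    exact ⟨3, by omega, .ite_pos (y := code x) (.id _) (fun e => h (Data.num.inj e)) (.const _ _)⟩

theorem Within.natLe {M : α → ℕ} {f g : α → ℕ} (hf : Within M f) (hg : Within M g) :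
    Within M (fun x => decide (f x ≤ g x)) :=
  (polyTime_eq_zero.comp (hf.sub hg)).of_eq fun x => by simp [Nat.sub_eq_zero_iff_le]

theorem Within.natEq {M : α → ℕ} {f g : α → ℕ} (hf : Within M f) (hg : Within M g) :
    Within M (fun x => decide (f x = g x)) :=
  (polyTime_eq_zero.comp ((hf.sub hg).add (hg.sub hf))).of_eq fun x => by
    simp only [decide_eq_decide]; omega

theorem Within.not {M : α → ℕ} {f : α → Bool} (hf : Within M f) : Within M (fun x => !f x) :=
  (Within.ite (c := fun x => f x = true) (by simpa using hf) (.const false) (.const true)).of_eq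
    fun x => by cases f x <;> rfl

theorem Within.and {M : α → ℕ} {f g : α → Bool} (hf : Within M f) (hg : Within M g) :
    Within M (fun x => f x && g x) :=
  (Within.ite (c := fun x => f x = true) (by simpa using hf) hg (.const false)).of_eq
    fun x => by cases f x <;> rfl

/-- Case distinction on a list. -/
theorem Within.listCases {M : α → ℕ} {l : α → List β} {f : α → γ} {g : α → β × List β → γ}
    (hM : Within M fun x => x) (hl : Within M l) (hf : Within M f)
    (hg : PolyTime fun x : α × (β × List β) => g x.1 x.2) :
    Within M (fun x => match l x with | [] => f x | b :: l' => g x (b, l')) := by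
  obtain ⟨o, O, hl'⟩ := hl
  obtain ⟨p, P, hf⟩ := hf
  obtain ⟨i, I, hM'⟩ := hM
  obtain ⟨r, Q, hg⟩ := hg
  -- The empty list is stored as `num 0` and any other list as a cell, so the list itself serves as
  -- the test.
  refine ⟨.ite o (.seq (.pair i o) r) p, O + P + (Q.comp (O + I + 1)) + I + O + 5, fun x => ?_⟩
  obtain ⟨s, l1, l2, l3⟩ := hl' x
  obtain ⟨v, i1, i2, i3⟩ := hM' x
  rcases h : l x with _ | ⟨b, l'⟩
  · obtain ⟨t, h1, h2, h3⟩ := hf x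
    rw [h] at l1
    simp only [h]
    refine ⟨_, .ite_neg l1 h1, ?_, ?_⟩ <;>
    simp only [Polynomial.eval_add, Polynomial.eval_ofNat] <;> omega
  · obtain ⟨u, k1, k2, k3⟩ := hg (x, (b, l'))
    rw [h] at l1 l3
    have : sz (x, b, l') ≤ (O + I + 1).eval (M x) := by
      simp only [Polynomial.eval_add, Polynomial.eval_one, sz_pair, sz_cons] at l3 i3 ⊢
      omega
    have := eval_mono Q this
    replace k3 : sz (g x (b, l')) ≤ _ := k3
    simp only [h]
    refine ⟨_, .ite_pos l1 (by simp [code, Data.ofList]) (.seq (.pair i1 l1) k1), ?_, ?_⟩ <;>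
    simp only [Polynomial.eval_add, Polynomial.eval_comp, Polynomial.eval_ofNat] at this ⊢ <;> omega

/-- A loop that folds a list; the state is `(list, environment, accumulator)`. -/
def Program.foldLoop (p : Program) : Program :=
  .loop .fst (.pair (.seq .fst .snd) (.pair (.seq .snd .fst)
    (.seq (.pair (.seq .snd .fst) (.pair (.seq .snd .snd) (.seq .fst .fst))) p)))

/-- The step is run only on accumulators that arise from prefixes of `l`, so a time bound for these
is enough. The constant 30 covers the bookkeeping of one round. -/
theorem Program.foldLoop_runs {p : Program} {s : γ → β → γ} {e : α} {T : ℕ} (l : List β) (i : γ)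
    (h : ∀ l' b, l' ++ [b] <+: l → ∃ t ≤ T, p.Runs (code (e, l'.foldl s i, b))
      (code (s (l'.foldl s i) b)) t) :
    ∃ t ≤ (l.length + 1) * (T + 30), p.foldLoop.Runs (code (l, e, i))
      (code (([] : List β), e, l.foldl s i)) t := by
  induction l generalizing i with
  | nil => exact ⟨1 + 1, by simp, .loop_done (.fst _)⟩
  | cons b l ih =>
    obtain ⟨t, ht, h1⟩ := h [] b ⟨l, by simp⟩
    obtain ⟨u, hu, h2⟩ := ih (s i b) fun l' b' ⟨r, hr⟩ => h (b :: l') b' ⟨r, by simp [← hr]⟩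
    refine ⟨_, ?_, .loop_step (y := code (b :: l)) (.fst _) (by simp [code, Data.ofList])
      (.pair (.seq (.fst _) (.snd _)) (.pair (.seq (.snd _) (.fst _))
      (.seq (.pair (.seq (.snd _) (.fst _)) (.pair (.seq (.snd _) (.snd _))
        (.seq (.fst _) (.fst _)))) h1))) h2⟩
    simp only [List.length_cons]
    have : (l.length + 1 + 1) * (T + 30) = (l.length + 1) * (T + 30) + (T + 30) := by ring
    omega

/-- Polynomial steps alone would let the accumulator grow without a polynomial bound, so the bound
`Q` on all intermediate accumulators is an extra hypothesis. -/
theorem Within.foldl_of_bounded {M : α → ℕ} {e : α → δ} {l : α → List β} {i : α → γ}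
    {s : δ → γ → β → γ} (he : Within M e) (hl : Within M l) (hi : Within M i)
    (hs : PolyTime fun x : δ × γ × β => s x.1 x.2.1 x.2.2) (Q : Polynomial ℕ)
    (hQ : ∀ x l', l' <+: l x → sz (l'.foldl (s (e x)) (i x)) ≤ Q.eval (M x)) :
    Within M (fun x => (l x).foldl (s (e x)) (i x)) := by
  obtain ⟨pe, E, he⟩ := he
  obtain ⟨pl, L, hl⟩ := hl
  obtain ⟨pi, I, hi⟩ := hi
  obtain ⟨p, P, hs⟩ := hs
  refine ⟨.seq (.pair pl (.pair pe pi)) (.seq p.foldLoop (.seq .snd .snd)),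
    E + L + I + (L + 1) * (P.comp (E + Q + L + 2) + 30) + 20 + Q, fun x => ?_⟩
  obtain ⟨t1, h1, h2, h3⟩ := he x
  obtain ⟨t2, k1, k2, k3⟩ := hl x
  obtain ⟨t3, l1, l2, l3⟩ := hi x
  obtain ⟨t, ht, h⟩ := Program.foldLoop_runs (p := p) (e := e x) (s := s (e x))
    (T := (P.comp (E + Q + L + 2)).eval (M x)) (l x) (i x) (by
      rintro l' b ⟨r, hr⟩
      obtain ⟨t, m1, m2, m3⟩ := hs (e x, l'.foldl (s (e x)) (i x), b)
      refine ⟨t, m2.trans ?_, m1⟩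
      rw [Polynomial.eval_comp]
      apply eval_mono
      have h4 := hQ x l' ((List.prefix_append l' [b]).trans ⟨r, hr⟩)
      have h5 : sz b < sz (l x) := sz_lt_of_mem (by rw [← hr]; simp)
      simp only [sz_pair, Polynomial.eval_add, Polynomial.eval_ofNat]
      omega)
  refine ⟨_, .seq (.pair k1 (.pair h1 l1)) (.seq h (.seq (.snd _) (.snd _))), ?_, ?_⟩
  · have h6 : (l x).length + 1 ≤ L.eval (M x) + 1 := by have := length_lt_sz (l x); omega
    have h7 := ht.trans (Nat.mul_le_mul_right _ h6)
    simp only [Polynomial.eval_add, Polynomial.eval_ofNat, Polynomial.eval_mul,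
      Polynomial.eval_one] at h7 ⊢
    omega
  · have := hQ x (l x) List.prefix_rfl
    simp only [Polynomial.eval_add]
    omega

theorem Within.sz_le {M : α → ℕ} {f : α → β} (h : Within M f) :
    ∃ P : Polynomial ℕ, ∀ x, sz (f x) ≤ P.eval (M x) := by
  obtain ⟨p, P, h⟩ := h
  exact ⟨P, fun x => (h x).choose_spec.2.2⟩

/-- A fold each of whose steps increases the size of the accumulator by a bounded amount. -/
theorem Within.foldl {l : α → List β} {i : α → γ} {s : α → γ → β → γ} (hl : PolyTime l)
    (hi : PolyTime i) (hs : PolyTime fun x : α × γ × β => s x.1 x.2.1 x.2.2) (Q : Polynomial ℕ)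
    (hQ : ∀ x c b, sz (s x c b) ≤ sz c + Q.eval (sz x + sz b)) :
    PolyTime (fun x => (l x).foldl (s x) (i x)) := by
  obtain ⟨L, hL⟩ := hl.sz_le
  obtain ⟨I, hI⟩ := hi.sz_le
  refine Within.foldl_of_bounded polyTime_id hl hi hs (I + L * Q.comp (.X + L)) fun x l' hl' => ?_
  have h : sz (l'.foldl (s x) (i x)) ≤ sz (i x) +
      l'.length * Q.eval (sz x + L.eval (sz x)) := by
    clear hI
    have h2 : ∀ b ∈ l', sz b ≤ L.eval (sz x) := fun b hb =>
      (sz_lt_of_mem (hl'.subset hb)).le.trans (hL x)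
    generalize i x = c
    clear hl'
    induction l' generalizing c with
    | nil => simp
    | cons b l' ih =>
      have h3 := ih (fun a ha => h2 a (by simp [ha])) (s x c b)
      have h4 := hQ x c b
      have h5 := eval_mono Q (Nat.add_le_add_left (h2 b (by simp)) (sz x))
      simp only [List.foldl_cons, List.length_cons, add_mul, one_mul]
      omega
  have h1 : l'.length ≤ L.eval (sz x) :=
    hl'.length_le.trans ((length_lt_sz _).le.trans (hL x))
  have h2 := Nat.mul_le_mul_right (Q.eval (sz x + L.eval (sz x))) h1
  have h3 := hI x
  simp only [Polynomial.eval_add, Polynomial.eval_mul, Polynomial.eval_comp, Polynomial.eval_X]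
  omega

end

/-! ### Lists, colours and extended natural numbers in polynomial time. -/

section
variable {α β γ δ : Type} [Coded α] [Coded β] [Coded γ] [Coded δ]

namespace Within

theorem reverse {l : α → List β} (hl : PolyTime l) : PolyTime fun x => (l x).reverse := by
  refine (Within.foldl (i := fun _ => ([] : List β)) (s := fun _ c b => b :: c) hl
    (Within.const _) ?_ (.X + 1) fun x c b => ?_).of_eq fun x => by simp
  · exact (polyTime_id.snd.snd.cons polyTime_id.snd.fst)
  · simp only [sz_cons, Polynomial.eval_add, Polynomial.eval_X, Polynomial.eval_one]; omega

theorem append {l l' : α → List β} (hl : PolyTime l) (hl' : PolyTime l') :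
    PolyTime fun x => l x ++ l' x := by
  refine (Within.foldl (s := fun _ c b => b :: c) hl.reverse hl' ?_ (.X + 1)
    fun x c b => ?_).of_eq fun x => by simp
  · exact (polyTime_id.snd.snd.cons polyTime_id.snd.fst)
  · simp only [sz_cons, Polynomial.eval_add, Polynomial.eval_X, Polynomial.eval_one]; omega

theorem map {l : α → List β} {f : α → β → γ} (hl : PolyTime l)
    (hf : PolyTime fun x : α × β => f x.1 x.2) : PolyTime fun x => (l x).map (f x) := by
  obtain ⟨P, hP⟩ := hf.sz_le
  refine (Within.reverse (Within.foldl (i := fun _ => ([] : List γ))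
    (s := fun x c b => f x b :: c) hl (Within.const _) ?_
    (P.comp (.X + 1) + 1) fun x c b => ?_)).of_eq fun x => ?_
  · exact ((hf.comp (polyTime_id.fst.prodMk polyTime_id.snd.snd)).cons polyTime_id.snd.fst)
  · have : sz (f x b) ≤ P.eval _ := hP (x, b)
    simp only [sz_cons, sz_pair, Polynomial.eval_add, Polynomial.eval_X, Polynomial.eval_one,
      Polynomial.eval_comp] at this ⊢
    omega
  · simp

theorem filter {l : α → List β} {p : α → β → Bool} (hl : PolyTime l)
    (hp : PolyTime fun x : α × β => p x.1 x.2) : PolyTime fun x => (l x).filter (p x) := by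
  refine (Within.reverse (Within.foldl (i := fun _ => ([] : List β))
    (s := fun x c b => if p x b then b :: c else c) hl (Within.const _) ?_
    (.X + 1) fun x c b => ?_)).of_eq fun x => ?_
  · refine Within.ite (c := fun y : α × List β × β => p y.1 y.2.2 = true) ?_ ?_
      polyTime_id.snd.fst
    swap
    · exact Within.cons polyTime_id.snd.snd polyTime_id.snd.fst
    simpa using Within.comp₂ (M := fun y : α × List β × β => sz y) hp polyTime_id.fst
      polyTime_id.snd.snd
  · split <;> simp only [sz_cons, Polynomial.eval_add, Polynomial.eval_X, Polynomial.eval_one] <;>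
    omega
  · have : ∀ (l : List β) c, (l.foldl (fun c b => if p x b then b :: c else c) c).reverse
        = c.reverse ++ l.filter (p x) := by
      intro l
      induction l with
      | nil => simp
      | cons b l ih =>
        intro c
        rw [List.foldl_cons, ih]
        cases h : p x b <;> simp [h]
    simpa using this (l x) []

theorem flatten {l : α → List (List β)} (hl : PolyTime l) : PolyTime fun x => (l x).flatten := by
  refine (Within.foldl (i := fun _ => ([] : List β)) (s := fun _ c b => b ++ c) hl.reverse
    (Within.const _) ?_ .X fun x c b => ?_).of_eq fun x => ?_
  · exact Within.append polyTime_id.snd.snd polyTime_id.snd.fst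
  · have := sz_append b c
    simp only [Polynomial.eval_X]; omega
  · rw [List.foldl_reverse]
    induction l x with
    | nil => rfl
    | cons a l ih => simp [ih]

theorem flatMap {l : α → List β} {f : α → β → List γ} (hl : PolyTime l)
    (hf : PolyTime fun x : α × β => f x.1 x.2) : PolyTime fun x => (l x).flatMap (f x) :=
  (hl.map hf).flatten.of_eq fun x => by rw [List.flatMap_def]

theorem any {l : α → List β} {p : α → β → Bool} (hl : PolyTime l)
    (hp : PolyTime fun x : α × β => p x.1 x.2) : PolyTime fun x => (l x).any (p x) := by
  refine (Within.foldl (i := fun _ => false) (s := fun x c b => !(!c && !p x b)) hl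
    (Within.const _) ?_ 1 fun x c b => ?_).of_eq fun x => ?_
  · exact (polyTime_id.snd.fst.not.and
      (hp.comp (polyTime_id.fst.prodMk polyTime_id.snd.snd)).not).not
  · simp [sz_bool]
  · have : ∀ (l : List β) c, (l.foldl (fun c b => !(!c && !p x b)) c) = (c || l.any (p x)) := by
      intro l
      induction l with
      | nil => simp
      | cons b l ih => intro c; rw [List.foldl_cons, ih]; simp [Bool.or_assoc]
    simpa using this (l x) false

theorem all {l : α → List β} {p : α → β → Bool} (hl : PolyTime l)
    (hp : PolyTime fun x : α × β => p x.1 x.2) : PolyTime fun x => (l x).all (p x) :=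
  (hl.any (p := fun x b => !p x b) hp.not).not.of_eq fun x => by
    rw [List.not_any_eq_all_not]; simp

theorem length {l : α → List β} (hl : PolyTime l) : PolyTime fun x => (l x).length := by
  refine (Within.foldl (i := fun _ => 0) (s := fun _ c _ => c + 1) hl
    (Within.const _) ?_ 1 fun x c b => ?_).of_eq fun x => ?_
  · exact polyTime_id.snd.fst.add (Within.const 1)
  · simp [sz_nat]
  · simp

theorem range_length {l : α → List β} (hl : PolyTime l) :
    PolyTime fun x => List.range (l x).length := by
  refine (Within.reverse (Within.foldl (i := fun _ => (0, ([] : List ℕ)))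
    (s := fun _ c _ => (c.1 + 1, c.1 :: c.2)) hl (Within.const _) ?_ 2
    fun x c b => ?_).snd).of_eq fun x => ?_
  · exact (polyTime_id.snd.fst.fst.add (Within.const 1)).prodMk
      (polyTime_id.snd.fst.fst.cons polyTime_id.snd.fst.snd)
  · simp only [sz_pair, sz_nat, sz_cons, Polynomial.eval_ofNat]; omega
  · have : ∀ (l : List β), l.foldl (fun (c : ℕ × List ℕ) _ => (c.1 + 1, c.1 :: c.2)) (0, [])
        = (l.length, (List.range l.length).reverse) := by
      intro l
      induction l using List.reverseRecOn with
      | nil => simp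
      | append_singleton l b ih =>
        simp [ih, List.range_succ]
    simp [this]

theorem isNil {l : α → List β} (hl : PolyTime l) : PolyTime fun x => decide (l x = []) :=
  (hl.any (p := fun _ _ => true) (Within.const true)).not.of_eq fun x => by
    cases l x <;> simp

theorem zip {l : α → List β} {l' : α → List γ} (hl : PolyTime l) (hl' : PolyTime l') :
    PolyTime fun x => (l x).zip (l' x) := by
  let s : List γ × List (β × γ) → β → List γ × List (β × γ) := fun c b =>
    match c.1 with
    | [] => c
    | a :: t => (t, (b, a) :: c.2)
  refine (Within.reverse (Within.foldl (i := fun x => (l' x, ([] : List (β × γ))))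
    (s := fun _ => s) hl (hl'.prodMk (Within.const _)) ?_ (.X + 1)
    fun x c b => ?_).snd).of_eq fun x => ?_
  · refine Within.listCases (l := fun y : α × (List γ × List (β × γ)) × β => y.2.1.1)
      (f := fun y => y.2.1)
      (g := fun y d => (d.2, (y.2.2, d.1) :: y.2.1.2)) polyTime_id polyTime_id.snd.fst.fst
      polyTime_id.snd.fst ?_
    exact polyTime_id.snd.snd.prodMk ((polyTime_id.fst.snd.snd.prodMk polyTime_id.snd.fst).cons
      polyTime_id.fst.snd.fst.snd)
  · obtain ⟨_ | ⟨a, t⟩, c⟩ := c <;>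
    simp only [s, sz_pair, sz_cons, Polynomial.eval_add, Polynomial.eval_X, Polynomial.eval_one] <;>
    have := sz_pos x <;> omega
  · have : ∀ (l : List β) r c, (l.foldl s (r, c)).2.reverse = c.reverse ++ l.zip r := by
      intro l
      induction l with
      | nil => simp
      | cons b l ih =>
        intro r c
        rcases r with _ | ⟨a, r⟩
        · rw [List.foldl_cons, show s ([], c) b = ([], c) from rfl, ih]; simp
        · rw [List.foldl_cons, show s (a :: r, c) b = (r, (b, a) :: c) from rfl, ih]; simp
    simpa using this (l x) (l' x) []

theorem colourEq {f g : α → Colour} (hf : PolyTime f) (hg : PolyTime g) :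
    PolyTime fun x => decide (f x = g x) := by
  have h : PolyTime (fun c : Colour => if c = .black then 1 else 2) :=
    .of_code_eq fun c => by cases c <;> rfl
  refine ((h.comp hf).natEq (h.comp hg)).of_eq fun x => ?_
  cases f x <;> cases g x <;> rfl

theorem listEq [DecidableEq β] {f g : α → List β} (hf : PolyTime f) (hg : PolyTime g)
    (h : PolyTime fun x : β × β => decide (x.1 = x.2)) :
    PolyTime fun x => decide (f x = g x) := by
  refine ((hf.length.natEq hg.length).and ((hf.zip hg).all (p := fun _ y => decide (y.1 = y.2))
    (h.comp polyTime_id.snd))).of_eq fun x => ?_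
  generalize f x = l
  generalize g x = r
  induction l generalizing r with
  | nil => cases r <;> simp
  | cons a l ih =>
    rcases r with _ | ⟨b, r⟩
    · simp
    · have := ih r
      rw [Bool.eq_iff_iff] at this ⊢
      simp only [Bool.and_eq_true, decide_eq_true_eq, List.length_cons, List.zip_cons_cons,
        List.all_cons, List.cons.injEq, Nat.add_right_cancel_iff] at this ⊢
      tauto

theorem mem [DecidableEq β] {f : α → β} {l : α → List β} (hf : PolyTime f) (hl : PolyTime l)
    (h : PolyTime fun x : β × β => decide (x.1 = x.2)) :
    PolyTime fun x => decide (f x ∈ l x) :=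
  (hl.any (p := fun x b => decide (f x = b))
    (h.comp ((hf.comp polyTime_id.fst).prodMk polyTime_id.snd))).of_eq fun x => by
      rw [Bool.eq_iff_iff]; simp

theorem natMem {f : α → ℕ} {l : α → List ℕ} (hf : PolyTime f) (hl : PolyTime l) :
    PolyTime fun x => decide (f x ∈ l x) :=
  hf.mem hl (polyTime_id.fst.natEq polyTime_id.snd)

theorem colourListEq {f g : α → List Colour} (hf : PolyTime f) (hg : PolyTime g) :
    PolyTime fun x => decide (f x = g x) :=
  hf.listEq hg (polyTime_id.fst.colourEq polyTime_id.snd)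

/-- The number that represents an extended natural number. -/
noncomputable def enatCode (a : ℕ∞) : ℕ := if a = ⊤ then 0 else a.toNat + 1

noncomputable def enatDecode (a : ℕ) : ℕ∞ := if a = 0 then ⊤ else ((a - 1 : ℕ) : ℕ∞)

theorem _root_.code_enatCode (a : ℕ∞) : code (enatCode a) = code a := by
  simp only [enatCode, code, HPInstance.codeValue]
  split <;> rfl

theorem enatCode_natCast (a : ℕ) : enatCode (a : ℕ∞) = a + 1 := by simp [enatCode]

theorem enatCode_top : enatCode ⊤ = 0 := by simp [enatCode]

theorem enatDecode_succ (a : ℕ) : enatDecode (a + 1) = a := by simp [enatDecode]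

theorem enatDecode_zero : enatDecode 0 = ⊤ := by simp [enatDecode]

theorem enatCode_decode (a : ℕ) : enatCode (enatDecode a) = a := by
  cases a <;> simp [enatDecode_succ, enatDecode_zero, enatCode_natCast, enatCode_top]

/-- An extended natural number and its code are stored identically, so arithmetic on `ℕ∞` reduces to
arithmetic on numbers shifted by one. -/
theorem polyTime_enatCode : PolyTime enatCode := .of_code_eq code_enatCode

theorem polyTime_enatDecode : PolyTime enatDecode := .of_code_eq fun a => by
  rw [← code_enatCode, enatCode_decode]

theorem natCast {f : α → ℕ} (hf : PolyTime f) : PolyTime fun x => (f x : ℕ∞) :=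
  (polyTime_enatDecode.comp (hf.add (Within.const 1))).of_eq fun x => by simp [enatDecode_succ]

theorem enatAdd {f g : α → ℕ∞} (hf : PolyTime f) (hg : PolyTime g) :
    PolyTime fun x => f x + g x := by
  have hf' := polyTime_enatCode.comp hf
  have hg' := polyTime_enatCode.comp hg
  refine (Within.ite (hf'.natEq (Within.const 0)) (Within.const ⊤)
    (Within.ite (hg'.natEq (Within.const 0)) (Within.const ⊤)
      (polyTime_enatDecode.comp ((hf'.add hg').sub (Within.const 1))))).of_eq fun x => ?_
  induction f x with
  | top => simp [enatCode_top]
  | coe a =>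
    induction g x with
    | top => simp [enatCode_top, enatCode_natCast]
    | coe b =>
      simp only [enatCode_natCast, Nat.add_one_ne_zero, if_false]
      rw [show a + 1 + (b + 1) - 1 = (a + b) + 1 by omega, enatDecode_succ]
      simp

theorem enatMin {f g : α → ℕ∞} (hf : PolyTime f) (hg : PolyTime g) :
    PolyTime fun x => min (f x) (g x) := by
  have hf' := polyTime_enatCode.comp hf
  have hg' := polyTime_enatCode.comp hg
  refine (Within.ite (hf'.natEq (Within.const 0)) hg (Within.ite (hg'.natEq (Within.const 0)) hf
    (Within.ite (hf'.natLe hg') hf hg))).of_eq fun x => ?_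
  induction f x with
  | top => simp [enatCode_top]
  | coe a =>
    induction g x with
    | top => simp [enatCode_top, enatCode_natCast]
    | coe b =>
      simp only [enatCode_natCast, Nat.add_one_ne_zero, if_false, add_le_add_iff_right]
      rcases le_total a b with h | h
      · simp [h]
      · rcases h.eq_or_lt with rfl | h'
        · simp
        · simp [h, h'.not_ge]

/-- Replacing all values above `k` by `∞`. -/
theorem enatCap {f : α → ℕ∞} {k : α → ℕ} (hf : PolyTime f) (hk : PolyTime k) :
    PolyTime fun x => if f x ≤ k x then f x else ⊤ := by
  refine (Within.ite ((polyTime_enatCode.comp hf).natLe (hk.add (Within.const 1))) hf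
    (Within.const ⊤)).of_eq fun x => ?_
  induction f x with
  | top => simp
  | coe a => simp [enatCode_natCast]

end Within

/-- Conversion of a number to unary. -/
theorem Within.range {M : α → ℕ} {f : α → ℕ} (hf : Within M f) (h : ∀ x, f x ≤ M x) :
    Within M fun x => List.range (f x) := by
  obtain ⟨p, P, hp⟩ := hf
  -- The state is a number `n` with a list; a round puts `n - 1` in front of the list, which
  -- therefore ends up ascending. There are as many rounds as the value of the number, hence the
  -- hypothesis `h`.
  let dec : Program := .seq (.pair .fst (.const 1)) .sub
  have hdec (n : ℕ) (d : Data) : dec.Runs (.pair (.num n) d) (.num (n - 1)) 5 :=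
    .seq (.pair (.fst _) (.const _ _)) (.sub _)
  have hloop (n : ℕ) (l : List ℕ) : (Program.loop .fst (.pair dec (.pair dec .snd))).Runs
      (.pair (.num n) (code l)) (.pair (.num 0) (code (List.range n ++ l))) (n * 15 + 2) := by
    induction n generalizing l with
    | zero => exact .loop_done (.fst _)
    | succ n ih =>
      have h2 := Program.Runs.loop_step (.fst _) (by simp [Data.fst])
        (.pair (hdec (n + 1) (code l)) (.pair (hdec (n + 1) (code l)) (.snd _))) (ih (n :: l))
      rw [List.range_succ, List.append_assoc, List.singleton_append]
      convert h2 using 1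
      ring
  refine ⟨.seq (.pair p (.const 0)) (.seq (.loop .fst (.pair dec (.pair dec .snd))) .snd),
    P + 15 * .X + 20, fun x => ?_⟩
  obtain ⟨t, h1, h2, h3⟩ := hp x
  have h4 := h x
  refine ⟨_, .seq (.pair h1 (.const _ _)) (.seq (List.append_nil (List.range (f x)) ▸ hloop (f x) []) (.snd _)), ?_, ?_⟩
  · simp only [Polynomial.eval_add, Polynomial.eval_mul, Polynomial.eval_ofNat, Polynomial.eval_X]
    omega
  · have := sz_list_le (l := List.range (f x)) (c := 1) fun a _ => le_rfl
    simp only [Polynomial.eval_add, Polynomial.eval_mul, Polynomial.eval_ofNat, Polynomial.eval_X,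
      List.length_range] at this ⊢
    omega

end

section
variable {α β γ : Type} [Coded α] [Coded β] [Coded γ]

theorem sz_filter_add (p : α → Bool) (l : List α) :
    sz (l.filter p) + sz (l.filter fun a => !p a) = sz l + 1 := by
  induction l with
  | nil => simp [sz_nil]
  | cons a l ih => cases h : p a <;> simp [h, sz_cons] <;> omega

theorem sz_filter_le (p : α → Bool) (l : List α) : sz (l.filter p) ≤ sz l := by
  have := sz_filter_add p l
  have := sz_pos (l.filter fun a => !p a)
  omega

theorem sz_flatten_le (l : List (List α)) : sz l.flatten ≤ sz l := by
  induction l with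
  | nil => simp [sz_nil]
  | cons a l ih =>
    have := sz_append a l.flatten
    simp only [List.flatten_cons, sz_cons]; omega

end

/-! ## The algorithm -/

namespace Painting

/-- A row of a table: the colours, the argument and the value. -/
abbrev Row := List Colour × ℕ × ℕ × Unit

/-- A hyperedge: its vertices and its table. -/
abbrev HEdge := List ℕ × List Row × Unit

/-- A function `ℕ → ℕ∞`, represented by finitely many upper bounds for its values. -/
abbrev Vec := List (ℕ × ℕ∞)

noncomputable section

/-- Entries with the same argument compete and a missing argument means `∞`, so appending two lists
takes the pointwise minimum. -/
def val (u : Vec) (μ : ℕ) : ℕ∞ := u.foldl (fun a x => if x.1 = μ then min a x.2 else a) ⊤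

/-- Applied after every convolution, this keeps the length of vectors fixed. -/
def normalize (R : List ℕ) (u : Vec) : Vec := R.map fun μ => (μ, val u μ)

/-- Min-plus convolution, at the arguments in `R`. -/
def conv (R : List ℕ) (u v : Vec) : Vec :=
  normalize R (u.flatMap fun x => v.map fun y => (x.1 + y.1, x.2 + y.2))

def prodVec (R : List ℕ) (us : List Vec) : Vec := us.foldl (conv R) [(0, 0)]

/-- The values of a table at a given colouring. -/
def edgeVec (tab : List Row) (c : List Colour) : Vec :=
  (tab.filter fun r => decide (r.1 = c)).map fun r => (r.2.1, (r.2.2.1 : ℕ∞))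

/-- The colours of `vs` when the vertices in `X` get colour `s` and the others get colour `t`. -/
def pattern (s t : Colour) (X vs : List ℕ) : List Colour :=
  vs.map fun v => if v ∈ X then s else t

/-- The total costs of `es` when the vertices in `X` get colour `s` and the others colour `t`. -/
def setVec (R : List ℕ) (s t : Colour) (es : List HEdge) (X : List ℕ) : Vec :=
  prodVec R (es.map fun e => edgeVec e.2.1 (pattern s t X e.1))

def meets (X Y : List ℕ) : Bool := X.any fun v => decide (v ∈ Y)

/-- Unite all clusters that meet `S`. -/
def merge (cl : List (List ℕ)) (S : List ℕ) : List (List ℕ) :=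
  (cl.filter fun X => meets S X).flatten :: cl.filter fun X => !meets S X

/-- The state holds the hyperedges met by no treated set so far, and the vector of best costs of all
others. A hyperedge is charged at the first set that it meets; the two alternatives are colour `s`
or colour `t` on `X`. -/
def dpStep (R : List ℕ) (s t : Colour) (st : List HEdge × Vec) (X : List ℕ) : List HEdge × Vec :=
  (st.1.filter fun e => !meets X e.1,
    conv R st.2 (setVec R s t (st.1.filter fun e => meets X e.1) X ++
      setVec R s t (st.1.filter fun e => meets X e.1) []))

/-- The best total costs if each of the sets `Xs` may get colour `s` independently, and all other
vertices get colour `t`. -/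
def dp (R : List ℕ) (s t : Colour) (Xs : List (List ℕ)) (es : List HEdge) : Vec :=
  conv R (Xs.foldl (dpStep R s t) (es, [(0, 0)])).2
    (setVec R s t (Xs.foldl (dpStep R s t) (es, [(0, 0)])).1 [])

/-- The vertices of a hyperedge whose label says `s`. -/
def inPart (s : Colour) (x : HEdge × List Colour) : List ℕ :=
  ((x.1.1.zip x.2).filter fun y => decide (y.2 = s)).map fun y => y.1

def outPart (s : Colour) (x : HEdge × List Colour) : List ℕ :=
  x.1.1.filter fun v => !decide (v ∈ inPart s x)

/-- The connected components with respect to the unlabelled hyperedges. -/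
def components (verts : List ℕ) (le : List (HEdge × List Colour)) : List (List ℕ) :=
  ((le.filter fun x => decide (x.2 = [])).map fun x => x.1.1).foldl merge (verts.map fun v => [v])

/-- The labelled hyperedges that are not contained in a single component. -/
def hardEdges (cl : List (List ℕ)) (le : List (HEdge × List Colour)) :
    List (HEdge × List Colour) :=
  le.filter fun x => !decide (x.2 = []) && !cl.any fun X => x.1.1.all fun v => decide (v ∈ X)

/-- The coarser partition obtained by uniting the `s`-parts of the labelled hyperedges. -/
def clusters (s : Colour) (cl : List (List ℕ)) (hard : List (HEdge × List Colour)) :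
    List (List ℕ) :=
  (hard.map fun x => inPart s x).foldl merge cl

/-- The clusters that are free to be coloured. -/
def freeClusters (s : Colour) (cl : List (List ℕ)) (hard : List (HEdge × List Colour)) :
    List (List ℕ) :=
  (clusters s cl hard).filter fun X => !meets (hard.flatMap fun x => outPart s x) X

def freeSets (s : Colour) (verts : List ℕ) (le : List (HEdge × List Colour)) : List (List ℕ) :=
  freeClusters s (components verts le) (hardEdges (components verts le) le)

/-- Best total costs over the colourings suggested by the labels `lab`, when `s` is rare. -/
def solve (R : List ℕ) (s t : Colour) (verts : List ℕ) (es : List HEdge)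
    (lab : List (List Colour)) : Vec :=
  dp R s t (freeSets s verts (es.zip lab)) es

def bichromatic (c : List Colour) : Bool :=
  (c.any fun x => decide (x = .black)) && c.any fun x => decide (x = .white)

/-- The bichromatic colourings that occur in the table of a hyperedge, without repetitions. -/
def candidates (e : HEdge) : List (List Colour) :=
  e.2.1.foldl (fun acc r => if (bichromatic r.1 && !decide (r.1 ∈ acc)) = true then r.1 :: acc
    else acc) []

def longest (ls : List (List (List Colour))) : List (List Colour) :=
  ls.foldl (fun acc l => if acc.length ≤ l.length then l else acc) []

/-- The element of `l` in position `j`, or the empty list. -/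
def nthLabel (l : List (List Colour)) (j : ℕ) : List Colour :=
  (((l.zip (List.range l.length)).filter fun x => decide (x.2 = j)).map fun x => x.1).flatten

/-- Arithmetic progression, of the same length as `l`. -/
def progression (p r : ℕ) (l : List (List (List Colour))) : List ℕ :=
  (l.foldl (fun (c : ℕ × List ℕ) _ => (c.1 + p, c.1 :: c.2)) (r, [])).2

/-- The labelling that gives all hyperedges in a residue class their candidate number `j`. -/
def residueMask (cands : List (List (List Colour))) (p r j : ℕ) : List (List Colour) :=
  (cands.zip (List.range cands.length)).map fun x =>
    if x.2 ∈ progression p r cands then nthLabel x.1 j else []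

/-- A blank label is transparent. -/
def overlay (a b : List (List Colour)) : List (List Colour) :=
  (a.zip b).map fun x => if x.1 = [] then x.2 else x.1

def residueMasks (cands : List (List (List Colour))) (U : List ℕ) : List (List (List Colour)) :=
  (List.range U.length).flatMap fun p => (List.range U.length).flatMap fun r =>
    (List.range (longest cands).length).map fun j => residueMask cands p r j

/-- A list whose length is about the logarithm of the length of `l`. -/
def logList (l : List (List (List Colour))) : List ℕ :=
  (l.foldl (fun (c : ℕ × List ℕ) _ => if l.length ≤ c.1 then c else (c.1 + c.1, 0 :: c.2))
    (1, [])).2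

/-- A list whose length bounds the moduli to be tried. -/
def modulusList (K Q : List ℕ) (cands : List (List (List Colour))) : List ℕ :=
  0 :: (((0 :: (K ++ Q)).flatMap fun _ => 0 :: logList cands) ++
    ((0 :: (K ++ Q)).flatMap fun _ => 0 :: logList cands))

/-- Keeping the old masks allows fewer overlays than rounds. The last argument only counts rounds of
a fold. -/
def extendMasks (O : List (List (List Colour))) (ms : List (List (List Colour))) (_ : ℕ) :
    List (List (List Colour)) :=
  ms ++ O.flatMap fun o => ms.map fun a => overlay o a

/-- Either colour may be the rare one. -/
def bestVec (R verts : List ℕ) (es : List HEdge) (ms : List (List (List Colour))) : Vec :=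
  ms.flatMap fun lab => solve R .black .white verts es lab ++ solve R .white .black verts es lab

def finish (R : List ℕ) (k : ℕ) (verts : List ℕ) (es : List HEdge)
    (ms : List (List (List Colour))) : List ℕ∞ :=
  R.map fun μ => if val (bestVec R verts es ms) μ ≤ k then val (bestVec R verts es ms) μ else ⊤

/-- The type of inputs; see `HPInstance.input`. -/
abbrev Input := ℕ × ℕ × ℕ × ℕ × ℕ × ℕ × List (Option Colour) × List HEdge × Unit

/-- A precoloured vertex is represented by an additional hyperedge. -/
def precolourEdges (col₀ : List (Option Colour)) : List HEdge :=
  (col₀.zip (List.range col₀.length)).flatMap fun x =>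
    if x.1 = none then [] else [([x.2], [([x.1.getD .black], 0, 0, ())], ())]

def allEdges (x : Input) : List HEdge :=
  x.2.2.2.2.2.2.2.1 ++ precolourEdges x.2.2.2.2.2.2.1

def cands (x : Input) : List (List (List Colour)) := (allEdges x).map candidates

/-- The number of hyperedges to be labelled. -/
def depth (x : Input) : ℕ := if longest (cands x) = [] then 0 else x.1

def basicMasks (x : Input) : List (List (List Colour)) :=
  residueMasks (cands x) (modulusList (List.range (depth x)) (List.range x.2.2.2.1) (cands x))

def masks (x : Input) : List (List (List Colour)) :=
  (List.range (depth x)).foldl (extendMasks (basicMasks x)) [(cands x).map fun _ => []]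

def algorithm (x : Input) : List ℕ∞ :=
  finish (List.range (x.2.1 + 1)) x.1 (List.range x.2.2.2.2.2.2.1.length) (allEdges x) (masks x)

end

end Painting

/-! ### Running time of the dynamic program for given labels. -/

namespace Painting

theorem polyTime_val : PolyTime fun x : Vec × ℕ => val x.1 x.2 := by
  refine Within.foldl (s := fun (x : Vec × ℕ) a y => if y.1 = x.2 then min a y.2 else a)
    polyTime_fst (Within.const _) ?_ 1 fun x c b => ?_
  · exact Within.ite (Within.natEq polyTime_id.snd.snd.fst polyTime_id.fst.snd)
      (Within.enatMin polyTime_id.snd.fst polyTime_id.snd.snd.snd) polyTime_id.snd.fst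
  · simp only [sz_enat]; omega

theorem polyTime_normalize : PolyTime fun x : List ℕ × Vec => normalize x.1 x.2 :=
  Within.map (f := fun (x : List ℕ × Vec) μ => (μ, val x.2 μ)) polyTime_fst
    (polyTime_id.snd.prodMk (polyTime_val.comp₂ polyTime_id.fst.snd polyTime_id.snd))

theorem polyTime_conv : PolyTime fun x : List ℕ × Vec × Vec => conv x.1 x.2.1 x.2.2 := by
  refine polyTime_normalize.comp₂ polyTime_fst (Within.flatMap
    (f := fun (x : List ℕ × Vec × Vec) (y : ℕ × ℕ∞) =>
      x.2.2.map fun z => (y.1 + z.1, y.2 + z.2)) polyTime_id.snd.fst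
    (Within.map (f := fun (x : (List ℕ × Vec × Vec) × (ℕ × ℕ∞)) (z : ℕ × ℕ∞) =>
      (x.2.1 + z.1, x.2.2 + z.2)) polyTime_id.fst.snd.snd ?_))
  exact (Within.add polyTime_id.fst.snd.fst polyTime_id.snd.fst).prodMk
    (Within.enatAdd polyTime_id.fst.snd.snd polyTime_id.snd.snd)

/-- Normalization makes the bound independent of `u` and `v`, so iterated convolutions stay small.
-/
theorem sz_conv_le (R : List ℕ) (u v : Vec) : sz (conv R u v) ≤ 4 * sz R := by
  have h := sz_list_le (l := conv R u v) (c := 3) fun x _ => by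
    rw [sz_pair, sz_nat, sz_enat]
  have h2 := length_lt_sz R
  have h3 : (conv R u v).length = R.length := by simp [conv, normalize]
  omega

theorem polyTime_prodVec : PolyTime fun x : List ℕ × List Vec => prodVec x.1 x.2 := by
  refine Within.foldl (s := fun (x : List ℕ × List Vec) => conv x.1)
    polyTime_snd (Within.const _) ?_ (4 * .X) fun x c b => ?_
  · exact polyTime_conv.comp₃ polyTime_id.fst.fst polyTime_id.snd.fst polyTime_id.snd.snd
  · have := sz_conv_le x.1 c b
    simp only [sz_pair, Polynomial.eval_mul, Polynomial.eval_ofNat, Polynomial.eval_X]; omega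

theorem polyTime_edgeVec : PolyTime fun x : List Row × List Colour => edgeVec x.1 x.2 := by
  refine Within.map (f := fun (x : List Row × List Colour) (r : Row) => (r.2.1, (r.2.2.1 : ℕ∞)))
    (Within.filter (p := fun (x : List Row × List Colour) (r : Row) => decide (r.1 = x.2))
      polyTime_fst ?_) ?_
  · exact Within.colourListEq polyTime_id.snd.fst polyTime_id.fst.snd
  · exact polyTime_id.snd.snd.fst.prodMk (Within.natCast polyTime_id.snd.snd.snd.fst)

theorem polyTime_pattern :
    PolyTime fun x : (Colour × Colour) × List ℕ × List ℕ => pattern x.1.1 x.1.2 x.2.1 x.2.2 := by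
  refine Within.map (f := fun (x : (Colour × Colour) × List ℕ × List ℕ) v =>
    if v ∈ x.2.1 then x.1.1 else x.1.2) polyTime_id.snd.snd ?_
  exact Within.ite (Within.natMem polyTime_id.snd polyTime_id.fst.snd.fst) polyTime_id.fst.fst.fst
    polyTime_id.fst.fst.snd

theorem polyTime_setVec : PolyTime fun x : (List ℕ × Colour × Colour) × List HEdge × List ℕ =>
    setVec x.1.1 x.1.2.1 x.1.2.2 x.2.1 x.2.2 := by
  refine polyTime_prodVec.comp₂ polyTime_id.fst.fst (Within.map
    (f := fun (x : (List ℕ × Colour × Colour) × List HEdge × List ℕ) (e : HEdge) =>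
      edgeVec e.2.1 (pattern x.1.2.1 x.1.2.2 x.2.2 e.1)) polyTime_id.snd.fst ?_)
  exact polyTime_edgeVec.comp₂ polyTime_id.snd.snd.fst (polyTime_pattern.comp
    (polyTime_id.fst.fst.snd.prodMk (polyTime_id.fst.snd.snd.prodMk polyTime_id.snd.fst)))

theorem polyTime_meets : PolyTime fun x : List ℕ × List ℕ => meets x.1 x.2 :=
  Within.any (p := fun (x : List ℕ × List ℕ) v => decide (v ∈ x.2)) polyTime_fst
    (Within.natMem polyTime_id.snd polyTime_id.fst.snd)

theorem polyTime_merge : PolyTime fun x : List (List ℕ) × List ℕ => merge x.1 x.2 := by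
  have h : PolyTime fun x : (List (List ℕ) × List ℕ) × List ℕ => meets x.1.2 x.2 :=
    polyTime_meets.comp₂ polyTime_id.fst.snd polyTime_id.snd
  exact Within.cons (Within.flatten (Within.filter polyTime_fst h))
    (Within.filter (p := fun (x : List (List ℕ) × List ℕ) X => !meets x.2 X) polyTime_fst h.not)

/-- Uniting clusters only rearranges what is already stored, and `S` itself is not copied; so
repeated merging adds a constant each time. -/
theorem sz_merge_le (cl : List (List ℕ)) (S : List ℕ) : sz (merge cl S) ≤ sz cl + 2 := by
  have h := sz_filter_add (fun X => meets S X) cl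
  have h2 := sz_flatten_le (cl.filter fun X => meets S X)
  rw [merge, sz_cons]
  omega

theorem polyTime_foldMerge :
    PolyTime fun x : List (List ℕ) × List (List ℕ) => x.1.foldl merge x.2 := by
  refine Within.foldl (s := fun _ => merge) polyTime_fst polyTime_snd
    (polyTime_merge.comp₂ polyTime_id.snd.fst polyTime_id.snd.snd) 2 fun x c b => ?_
  simpa using sz_merge_le c b

theorem polyTime_dp : PolyTime fun x : (List ℕ × Colour × Colour) × List (List ℕ) × List HEdge =>
    dp x.1.1 x.1.2.1 x.1.2.2 x.2.1 x.2.2 := by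
  have h : PolyTime fun x : (((List ℕ × Colour × Colour) × List (List ℕ) × List HEdge) ×
      (List HEdge × Vec) × List ℕ) × HEdge => meets x.1.2.2 x.2.1 :=
    polyTime_meets.comp₂ polyTime_id.fst.snd.snd polyTime_id.snd.fst
  have h1 : PolyTime fun x : ((List ℕ × Colour × Colour) × List (List ℕ) × List HEdge) ×
      (List HEdge × Vec) × List ℕ => dpStep x.1.1.1 x.1.1.2.1 x.1.1.2.2 x.2.1 x.2.2 := by
    have h2 : PolyTime fun x : ((List ℕ × Colour × Colour) × List (List ℕ) × List HEdge) ×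
      (List HEdge × Vec) × List ℕ => x.2.1.1.filter fun e => meets x.2.2 e.1 :=
        Within.filter (p := fun (x : ((List ℕ × Colour × Colour) × List (List ℕ) × List HEdge) ×
          (List HEdge × Vec) × List ℕ) e => meets x.2.2 e.1) polyTime_id.snd.fst.fst h
    refine (Within.filter (p := fun (x : ((List ℕ × Colour × Colour) × List (List ℕ) ×
      List HEdge) × (List HEdge × Vec) × List ℕ) e => !meets x.2.2 e.1) polyTime_id.snd.fst.fst
      h.not).prodMk (polyTime_conv.comp₃ polyTime_id.fst.fst.fst polyTime_id.snd.fst.snd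
        (Within.append ?_ ?_))
    · exact polyTime_setVec.comp (polyTime_id.fst.fst.prodMk (h2.prodMk polyTime_id.snd.snd))
    · exact polyTime_setVec.comp (polyTime_id.fst.fst.prodMk (h2.prodMk (Within.const [])))
  have h3 : PolyTime fun x : (List ℕ × Colour × Colour) × List (List ℕ) × List HEdge =>
      x.2.1.foldl (dpStep x.1.1 x.1.2.1 x.1.2.2) (x.2.2, [(0, 0)]) := by
    refine Within.foldl (s := fun (x : (List ℕ × Colour × Colour) × List (List ℕ) × List HEdge) =>
      dpStep x.1.1 x.1.2.1 x.1.2.2) polyTime_id.snd.fst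
      (polyTime_id.snd.snd.prodMk (Within.const _)) h1 (4 * .X) fun x c b => ?_
    rw [dpStep, sz_pair, sz_pair]
    have k1 := sz_filter_le (fun e : HEdge => !meets b e.1) c.1
    have k2 := sz_conv_le x.1.1 c.2 (setVec x.1.1 x.1.2.1 x.1.2.2
      (c.1.filter fun e => meets b e.1) b ++ setVec x.1.1 x.1.2.1 x.1.2.2
      (c.1.filter fun e => meets b e.1) [])
    have k3 : sz x = (sz x.1.1 + (sz x.1.2) + 1) + sz x.2 + 1 := rfl
    simp only [Polynomial.eval_mul, Polynomial.eval_ofNat, Polynomial.eval_X]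
    omega
  exact polyTime_conv.comp₃ polyTime_id.fst.fst h3.snd (polyTime_setVec.comp
    (polyTime_id.fst.prodMk (h3.fst.prodMk (Within.const []))))

theorem polyTime_inPart : PolyTime fun x : Colour × (HEdge × List Colour) => inPart x.1 x.2 := by
  refine Within.map (f := fun (x : Colour × (HEdge × List Colour)) (y : ℕ × Colour) => y.1)
    (Within.filter (p := fun (x : Colour × (HEdge × List Colour)) (y : ℕ × Colour) =>
      decide (y.2 = x.1)) (Within.zip polyTime_id.snd.fst.fst polyTime_id.snd.snd) ?_)
    polyTime_id.snd.fst
  exact Within.colourEq polyTime_id.snd.snd polyTime_id.fst.fst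

theorem polyTime_outPart : PolyTime fun x : Colour × (HEdge × List Colour) => outPart x.1 x.2 := by
  refine Within.filter (p := fun (x : Colour × (HEdge × List Colour)) v =>
    !decide (v ∈ inPart x.1 x.2)) polyTime_id.snd.fst.fst (Within.not ?_)
  exact Within.natMem polyTime_id.snd (polyTime_inPart.comp₂ polyTime_id.fst.fst polyTime_id.fst.snd)

theorem polyTime_components : PolyTime fun x : List ℕ × List (HEdge × List Colour) =>
    components x.1 x.2 := by
  refine polyTime_foldMerge.comp (Within.prodMk (Within.map (f := fun (x : List ℕ × List (HEdge × List Colour))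
      (y : HEdge × List Colour) => y.1.1)
    (Within.filter (p := fun (x : List ℕ × List (HEdge × List Colour)) (y : HEdge × List Colour) =>
      decide (y.2 = [])) polyTime_snd ?_) polyTime_id.snd.fst.fst)
    (Within.map (f := fun (x : List ℕ × List (HEdge × List Colour)) v => [v]) polyTime_fst
      (Within.cons polyTime_id.snd (Within.const []))))
  exact Within.isNil polyTime_id.snd.snd

theorem polyTime_hardEdges : PolyTime fun x : List (List ℕ) × List (HEdge × List Colour) =>
    hardEdges x.1 x.2 := by
  refine Within.filter (p := fun (x : List (List ℕ) × List (HEdge × List Colour))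
    (y : HEdge × List Colour) => !decide (y.2 = []) && !x.1.any fun X => y.1.1.all fun v =>
      decide (v ∈ X)) polyTime_snd (Within.and (Within.not (Within.isNil polyTime_id.snd.snd))
        (Within.not (Within.any (p := fun (x : (List (List ℕ) × List (HEdge × List Colour)) ×
          (HEdge × List Colour)) X => x.2.1.1.all fun v => decide (v ∈ X)) polyTime_id.fst.fst
          (Within.all (p := fun (x : ((List (List ℕ) × List (HEdge × List Colour)) ×
          (HEdge × List Colour)) × List ℕ) v => decide (v ∈ x.2)) polyTime_id.fst.snd.fst.fst
          (Within.natMem polyTime_id.snd polyTime_id.fst.snd)))))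

theorem polyTime_freeClusters :
    PolyTime fun x : Colour × List (List ℕ) × List (HEdge × List Colour) =>
      freeClusters x.1 x.2.1 x.2.2 := by
  have h1 : PolyTime fun x : Colour × List (List ℕ) × List (HEdge × List Colour) =>
      clusters x.1 x.2.1 x.2.2 :=
    polyTime_foldMerge.comp (Within.prodMk (Within.map (f := fun (x : Colour × List (List ℕ) ×
      List (HEdge × List Colour)) y => inPart x.1 y) polyTime_id.snd.snd
      (polyTime_inPart.comp₂ polyTime_id.fst.fst polyTime_id.snd)) polyTime_id.snd.fst)
  have h2 : PolyTime fun x : Colour × List (List ℕ) × List (HEdge × List Colour) =>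
      x.2.2.flatMap fun y => outPart x.1 y :=
    Within.flatMap (f := fun (x : Colour × List (List ℕ) × List (HEdge × List Colour)) y =>
      outPart x.1 y) polyTime_id.snd.snd
      (polyTime_outPart.comp₂ polyTime_id.fst.fst polyTime_id.snd)
  exact Within.filter (p := fun (x : Colour × List (List ℕ) × List (HEdge × List Colour)) X =>
    !meets (x.2.2.flatMap fun y => outPart x.1 y) X) h1
    (Within.not (polyTime_meets.comp₂ (h2.comp polyTime_fst) polyTime_snd))

theorem polyTime_freeSets : PolyTime fun x : Colour × List ℕ × List (HEdge × List Colour) =>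
    freeSets x.1 x.2.1 x.2.2 := by
  have h : PolyTime fun x : Colour × List ℕ × List (HEdge × List Colour) =>
    components x.2.1 x.2.2 := polyTime_components.comp₂ polyTime_id.snd.fst polyTime_id.snd.snd
  exact polyTime_freeClusters.comp₃ polyTime_fst h
    (polyTime_hardEdges.comp₂ h polyTime_id.snd.snd)

theorem polyTime_solve : PolyTime fun x : (List ℕ × Colour × Colour) × List ℕ × List HEdge ×
    List (List Colour) => solve x.1.1 x.1.2.1 x.1.2.2 x.2.1 x.2.2.1 x.2.2.2 :=
  polyTime_dp.comp (polyTime_id.fst.prodMk ((polyTime_freeSets.comp₃ polyTime_id.fst.snd.fst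
    polyTime_id.snd.fst (Within.zip polyTime_id.snd.snd.fst polyTime_id.snd.snd.snd)).prodMk
    polyTime_id.snd.snd.fst))

theorem polyTime_bestVec : PolyTime fun x : List ℕ × List ℕ × List HEdge ×
    List (List (List Colour)) => bestVec x.1 x.2.1 x.2.2.1 x.2.2.2 := by
  have h (s t : Colour) : PolyTime fun x : (List ℕ × List ℕ × List HEdge ×
      List (List (List Colour))) × List (List Colour) =>
      solve x.1.1 s t x.1.2.1 x.1.2.2.1 x.2 :=
    Within.comp (f := fun x : (List ℕ × List ℕ × List HEdge × List (List (List Colour))) ×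
      List (List Colour) => ((x.1.1, s, t), x.1.2.1, x.1.2.2.1, x.2)) polyTime_solve ((polyTime_id.fst.fst.prodMk ((Within.const s).prodMk
      (Within.const t))).prodMk (polyTime_id.fst.snd.fst.prodMk
        (polyTime_id.fst.snd.snd.fst.prodMk polyTime_id.snd)))
  exact Within.flatMap (f := fun (x : List ℕ × List ℕ × List HEdge × List (List (List Colour)))
    lab => solve x.1 .black .white x.2.1 x.2.2.1 lab ++ solve x.1 .white .black x.2.1 x.2.2.1 lab)
    polyTime_id.snd.snd.snd (Within.append (h _ _) (h _ _))

theorem polyTime_finish : PolyTime fun x : (ℕ × List ℕ) × List ℕ × List HEdge ×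
    List (List (List Colour)) => finish x.1.2 x.1.1 x.2.1 x.2.2.1 x.2.2.2 := by
  have h : PolyTime fun x : ((ℕ × List ℕ) × List ℕ × List HEdge × List (List (List Colour))) × ℕ =>
      val (bestVec x.1.1.2 x.1.2.1 x.1.2.2.1 x.1.2.2.2) x.2 :=
    polyTime_val.comp₂ (Within.comp (f := fun x : ((ℕ × List ℕ) × List ℕ × List HEdge ×
      List (List (List Colour))) × ℕ => (x.1.1.2, x.1.2)) polyTime_bestVec (polyTime_id.fst.fst.snd.prodMk polyTime_id.fst.snd))
      polyTime_snd
  exact Within.map (f := fun (x : (ℕ × List ℕ) × List ℕ × List HEdge × List (List (List Colour)))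
    μ => if val (bestVec x.1.2 x.2.1 x.2.2.1 x.2.2.2) μ ≤ x.1.1 then
      val (bestVec x.1.2 x.2.1 x.2.2.1 x.2.2.2) μ else ⊤) polyTime_id.fst.snd
    (Within.enatCap h polyTime_id.fst.fst.fst)

end Painting

/-! ### Running time of the enumeration of labellings. -/

namespace Painting

theorem polyTime_bichromatic : PolyTime bichromatic := by
  have h (c : Colour) : PolyTime fun x : List Colour => x.any fun y => decide (y = c) :=
    Within.any (p := fun _ y => decide (y = c)) polyTime_id
      (Within.colourEq polyTime_id.snd (Within.const c))
  exact Within.and (h _) (h _)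

theorem polyTime_candidates : PolyTime candidates := by
  refine Within.foldl (s := fun (_ : HEdge) acc (r : Row) =>
    if (bichromatic r.1 && !decide (r.1 ∈ acc)) = true then r.1 :: acc else acc) polyTime_id.snd.fst
    (Within.const _) (Within.ite ?_ ?_ polyTime_id.snd.fst) (.X + 1) fun x c b => ?_
  · simp only [Bool.decide_eq_true]
    refine Within.and (Within.comp (f := fun x : HEdge × List (List Colour) × Row => x.2.2.1)
      polyTime_bichromatic polyTime_id.snd.snd.fst) (Within.not ?_)
    have h : PolyTime fun x : HEdge × List (List Colour) × Row => x.2.2.1 :=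
      polyTime_id.snd.snd.fst
    exact (Within.mem h polyTime_id.snd.fst (Within.colourListEq polyTime_fst polyTime_snd)).of_eq
      fun _ => decide_eq_decide.2 Iff.rfl
  · exact Within.cons polyTime_id.snd.snd.fst polyTime_id.snd.fst
  · split <;> simp only [sz_cons, sz_pair, Polynomial.eval_add, Polynomial.eval_X,
      Polynomial.eval_one] <;> omega

theorem polyTime_longest : PolyTime longest := by
  refine Within.foldl (s := fun (_ : List (List (List Colour))) acc l =>
    if acc.length ≤ l.length then l else acc) polyTime_id (Within.const _)
    (Within.ite (Within.natLe (Within.length polyTime_id.snd.fst) (Within.length polyTime_id.snd.snd))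
    polyTime_id.snd.snd polyTime_id.snd.fst) .X fun x c b => ?_
  split <;> simp only [Polynomial.eval_X] <;> omega

theorem polyTime_nthLabel : PolyTime fun x : List (List Colour) × ℕ => nthLabel x.1 x.2 :=
  Within.flatten (Within.map (f := fun _ (y : List Colour × ℕ) => y.1)
    (Within.filter (p := fun (x : List (List Colour) × ℕ) (y : List Colour × ℕ) =>
      decide (y.2 = x.2)) (Within.zip polyTime_fst (Within.range_length polyTime_fst))
      (Within.natEq polyTime_id.snd.snd polyTime_id.fst.snd)) polyTime_id.snd.fst)

theorem polyTime_progression : PolyTime fun x : (ℕ × ℕ) × List (List (List Colour)) =>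
    progression x.1.1 x.1.2 x.2 := by
  refine Within.snd (Within.foldl (s := fun (x : (ℕ × ℕ) × List (List (List Colour)))
    (c : ℕ × List ℕ) _ => (c.1 + x.1.1, c.1 :: c.2)) polyTime_snd
    (polyTime_id.fst.snd.prodMk (Within.const _)) ?_ 2 fun x c b => ?_)
  · exact (Within.add polyTime_id.snd.fst.fst polyTime_id.fst.fst.fst).prodMk
      (Within.cons polyTime_id.snd.fst.fst polyTime_id.snd.fst.snd)
  · simp only [sz_pair, sz_cons, sz_nat, Polynomial.eval_ofNat]; omega

theorem polyTime_residueMask : PolyTime fun x : List (List (List Colour)) × ℕ × ℕ × ℕ =>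
    residueMask x.1 x.2.1 x.2.2.1 x.2.2.2 := by
  refine Within.map (f := fun (x : List (List (List Colour)) × ℕ × ℕ × ℕ)
    (y : List (List Colour) × ℕ) =>
      if y.2 ∈ progression x.2.1 x.2.2.1 x.1 then nthLabel y.1 x.2.2.2 else [])
    (Within.zip polyTime_fst (Within.range_length polyTime_fst)) (Within.ite (Within.natMem
      polyTime_id.snd.snd ?_) (polyTime_nthLabel.comp₂ polyTime_id.snd.fst
        polyTime_id.fst.snd.snd.snd) (Within.const []))
  exact Within.comp (f := fun x : (List (List (List Colour)) × ℕ × ℕ × ℕ) ×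
    (List (List Colour) × ℕ) => ((x.1.2.1, x.1.2.2.1), x.1.1)) polyTime_progression
    ((polyTime_id.fst.snd.fst.prodMk polyTime_id.fst.snd.snd.fst).prodMk polyTime_id.fst.fst)

theorem polyTime_overlay : PolyTime fun x : List (List Colour) × List (List Colour) =>
    overlay x.1 x.2 :=
  Within.map (f := fun _ (y : List Colour × List Colour) => if y.1 = [] then y.2 else y.1)
    (Within.zip polyTime_fst polyTime_snd) (Within.ite (Within.isNil polyTime_id.snd.fst)
      polyTime_id.snd.snd polyTime_id.snd.fst)

theorem polyTime_residueMasks : PolyTime fun x : List (List (List Colour)) × List ℕ =>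
    residueMasks x.1 x.2 := by
  have h {α : Type} [Coded α] {f : α → List (List (List Colour)) × List ℕ} (hf : PolyTime f) :
      PolyTime fun x => List.range (f x).2.length := Within.range_length hf.snd
  refine Within.flatMap (f := fun (x : List (List (List Colour)) × List ℕ) p =>
    (List.range x.2.length).flatMap fun r =>
      (List.range (longest x.1).length).map fun j => residueMask x.1 p r j) (h polyTime_id)
    (Within.flatMap (f := fun (x : (List (List (List Colour)) × List ℕ) × ℕ) r =>
      (List.range (longest x.1.1).length).map fun j => residueMask x.1.1 x.2 r j)
      (h polyTime_id.fst) (Within.map (f := fun (x : ((List (List (List Colour)) × List ℕ) × ℕ)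
        × ℕ) j => residueMask x.1.1.1 x.1.2 x.2 j) (Within.range_length (polyTime_longest.comp
          polyTime_id.fst.fst.fst)) ?_))
  exact Within.comp (f := fun x : (((List (List (List Colour)) × List ℕ) × ℕ) × ℕ) × ℕ =>
    (x.1.1.1.1, x.1.1.2, x.1.2, x.2)) polyTime_residueMask (polyTime_id.fst.fst.fst.fst.prodMk
    (polyTime_id.fst.fst.snd.prodMk (polyTime_id.fst.snd.prodMk polyTime_id.snd)))

theorem polyTime_logList : PolyTime logList := by
  refine Within.snd (Within.foldl (s := fun (l : List (List (List Colour))) (c : ℕ × List ℕ) _ =>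
    if l.length ≤ c.1 then c else (c.1 + c.1, 0 :: c.2)) polyTime_id (Within.const _)
    (Within.ite (Within.natLe (Within.length polyTime_id.fst) polyTime_id.snd.fst.fst)
      polyTime_id.snd.fst ?_) 2 fun x c b => ?_)
  · exact (Within.add polyTime_id.snd.fst.fst polyTime_id.snd.fst.fst).prodMk
      (Within.cons (Within.const 0) polyTime_id.snd.fst.snd)
  · split <;> simp only [sz_pair, sz_cons, sz_nat, Polynomial.eval_ofNat] <;> omega

theorem polyTime_modulusList : PolyTime fun x : (List ℕ × List ℕ) × List (List (List Colour)) =>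
    modulusList x.1.1 x.1.2 x.2 := by
  have h : PolyTime fun x : (List ℕ × List ℕ) × List (List (List Colour)) =>
      (0 :: (x.1.1 ++ x.1.2)).flatMap fun _ => 0 :: logList x.2 :=
    Within.flatMap (f := fun (x : (List ℕ × List ℕ) × List (List (List Colour))) (_ : ℕ) =>
      0 :: logList x.2) (Within.cons (Within.const 0)
        (Within.append polyTime_id.fst.fst polyTime_id.fst.snd))
      (Within.cons (Within.const 0) (polyTime_logList.comp polyTime_id.fst.snd))
  exact Within.cons (Within.const 0) (Within.append h h)

theorem polyTime_extendMasks : PolyTime fun x : List (List (List Colour)) ×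
    List (List (List Colour)) × ℕ => extendMasks x.1 x.2.1 x.2.2 :=
  Within.append polyTime_id.snd.fst (Within.flatMap (f := fun (x : List (List (List Colour)) ×
    List (List (List Colour)) × ℕ) o => x.2.1.map fun a => overlay o a) polyTime_fst
    (Within.map (f := fun (x : (List (List (List Colour)) × List (List (List Colour)) × ℕ) ×
      List (List Colour)) a => overlay x.2 a) polyTime_id.fst.snd.fst
      (polyTime_overlay.comp₂ polyTime_id.fst.snd polyTime_id.snd)))

theorem polyTime_precolourEdges : PolyTime precolourEdges := by
  let n : Option Colour → ℕ
    | none => 0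
    | some .black => 1
    | some .white => 2
  have hn : PolyTime n := PolyTime.of_code_eq fun c => by rcases c with _ | _ | _ <;> rfl
  have h1 : PolyTime fun c : Option Colour => decide (c = none) :=
    (polyTime_eq_zero.comp hn).of_eq fun c => by rcases c with _ | _ | _ <;> rfl
  have h2 : PolyTime fun c : Option Colour => c.getD .black :=
    (Within.ite (hn.natLe (Within.const 1)) (Within.const .black) (Within.const .white)).of_eq
      fun c => by rcases c with _ | _ | _ <;> rfl
  refine Within.flatMap (f := fun (_ : List (Option Colour)) (x : Option Colour × ℕ) =>
    if x.1 = none then [] else [([x.2], [([x.1.getD Colour.black], 0, 0, ())], ())])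
    (Within.zip polyTime_id (Within.range_length polyTime_id))
    (Within.ite (h1.comp polyTime_id.snd.fst) (Within.const []) (Within.cons ((Within.cons
      polyTime_id.snd.snd (Within.const [])).prodMk ((Within.cons ((Within.cons
        (h2.comp polyTime_id.snd.fst) (Within.const [])).prodMk (Within.const _))
        (Within.const [])).prodMk (Within.const _))) (Within.const [])))

theorem polyTime_allEdges : PolyTime allEdges :=
  Within.append polyTime_id.snd.snd.snd.snd.snd.snd.snd.fst
    (polyTime_precolourEdges.comp polyTime_id.snd.snd.snd.snd.snd.snd.fst)

theorem polyTime_cands : PolyTime cands :=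
  Within.map (f := fun _ => candidates) polyTime_allEdges
    (polyTime_candidates.comp polyTime_id.snd)

theorem polyTime_depth : PolyTime depth :=
  Within.ite (Within.isNil (polyTime_longest.comp polyTime_cands)) (Within.const 0) polyTime_fst

/-- A bound for the running time of the algorithm, up to a polynomial. -/
noncomputable def cost (x : Input) : ℕ :=
  sz x + (x.2.1 + 1) + depth x + x.2.2.2.1 + sz (masks x)

/-- The numbers converted to unary are `b + 1`, the depth and `q`. These, the input size and the
size of the list of masks make up `cost`; all else is polynomial in them. -/
theorem within_algorithm : Within cost algorithm := by
  have hx {α : Type} [Coded α] {f : Input → α} (hf : PolyTime f) : Within cost f :=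
    hf.mono fun x => by unfold cost; omega
  have hR : Within cost fun x : Input => List.range (x.2.1 + 1) :=
    Within.range (hx (Within.add polyTime_id.snd.fst (Within.const 1))) fun x => by
      unfold cost; omega
  have hK : Within cost fun x : Input => List.range (depth x) :=
    Within.range (hx polyTime_depth) fun x => by unfold cost; omega
  have hQ : Within cost fun x : Input => List.range x.2.2.2.1 :=
    Within.range (hx polyTime_id.snd.snd.snd.fst) fun x => by unfold cost; omega
  have hB : Within cost basicMasks := polyTime_residueMasks.comp₂ (hx polyTime_cands)
    (Within.comp (f := fun x : Input => ((List.range (depth x), List.range x.2.2.2.1), cands x))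
      polyTime_modulusList ((hK.prodMk hQ).prodMk (hx polyTime_cands)))
  have hM : Within cost masks := by
    refine Within.foldl_of_bounded (s := extendMasks) hB hK (hx (Within.cons (Within.map
      (f := fun _ _ => []) polyTime_cands (Within.const [])) (Within.const [])))
      polyTime_extendMasks .X fun x l hl => ?_
    obtain ⟨r, hr⟩ := hl
    -- Each round keeps the old masks, so all intermediate lists are bounded by the final one, whose
    -- size is part of `cost`.
    have : ∀ (r : List ℕ) ms, sz ms ≤ sz (r.foldl (extendMasks (basicMasks x)) ms) := by
      intro r
      induction r with
      | nil => exact fun _ => le_rfl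
      | cons a r ih =>
        intro ms
        refine le_trans ?_ (ih _)
        have h1 := sz_append ms ((basicMasks x).flatMap fun o => ms.map fun a => overlay o a)
        have h2 := sz_pos ((basicMasks x).flatMap fun o => ms.map fun a => overlay o a)
        rw [extendMasks]
        omega
    have h := this r (l.foldl (extendMasks (basicMasks x)) [(cands x).map fun _ => []])
    rw [← List.foldl_append, hr] at h
    rw [Polynomial.eval_X, cost, masks]
    omega
  exact Within.comp (f := fun x : Input => ((x.1, List.range (x.2.1 + 1)),
    List.range x.2.2.2.2.2.2.1.length, allEdges x, masks x)) polyTime_finish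
    (((hx polyTime_fst).prodMk hR).prodMk ((hx (Within.range_length
      polyTime_id.snd.snd.snd.snd.snd.snd.fst)).prodMk ((hx polyTime_allEdges).prodMk hM)))

end Painting

/-! ### Correctness of the dynamic program, in terms of min-plus power series. -/

open Tropical

namespace Painting

noncomputable section

/-- Formal power series over the min-plus semiring; multiplication is min-plus convolution. -/
abbrev Series := PowerSeries (Tropical ℕ∞)

def series (u : Vec) : Series := (u.map fun x => PowerSeries.monomial x.1 (trop x.2)).sum

/-- Equality of the coefficients up to `b`. -/
def Agree (b : ℕ) (f g : Series) : Prop := ∀ μ ≤ b, f.coeff μ = g.coeff μ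

theorem Agree.trans {b : ℕ} {f g h : Series} (h1 : Agree b f g) (h2 : Agree b g h) : Agree b f h :=
  fun μ hμ => (h1 μ hμ).trans (h2 μ hμ)

/-- A coefficient of a product involves only coefficients of the factors with at most the same
index. -/
theorem Agree.mul {b : ℕ} {f g f' g' : Series} (h : Agree b f f') (h' : Agree b g g') :
    Agree b (f * g) (f' * g') := fun μ hμ => by
  rw [PowerSeries.coeff_mul, PowerSeries.coeff_mul]
  refine Finset.sum_congr rfl fun x hx => ?_
  rw [Finset.HasAntidiagonal.mem_antidiagonal] at hx
  rw [h _ (by omega), h' _ (by omega)]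

theorem Agree.add {b : ℕ} {f g f' g' : Series} (h : Agree b f f') (h' : Agree b g g') :
    Agree b (f + g) (f' + g') := fun μ hμ => by
  rw [map_add, map_add, h μ hμ, h' μ hμ]

theorem Agree.of_eq {b : ℕ} {f g : Series} (h : f = g) : Agree b f g := fun _ _ => by rw [h]

theorem Agree.refl (b : ℕ) (f : Series) : Agree b f f := .of_eq rfl

theorem foldl_val (u : Vec) (μ : ℕ) (a : ℕ∞) :
    u.foldl (fun a x => if x.1 = μ then min a x.2 else a) a = min a (val u μ) := by
  unfold val
  induction u generalizing a with
  | nil => simp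
  | cons x u ih =>
    rw [List.foldl_cons, List.foldl_cons, ih, ih (if x.1 = μ then min ⊤ x.2 else ⊤)]
    split <;> simp [min_assoc]

theorem val_cons (x : ℕ × ℕ∞) (u : Vec) (μ : ℕ) :
    val (x :: u) μ = min (if x.1 = μ then x.2 else ⊤) (val u μ) := by
  rw [val, List.foldl_cons, foldl_val]
  split <;> simp

theorem coeff_series (u : Vec) (μ : ℕ) : (series u).coeff μ = trop (val u μ) := by
  induction u with
  | nil => simp [series, val]
  | cons x u ih =>
    rw [val_cons]
    simp only [series, List.map_cons, List.sum_cons, map_add, PowerSeries.coeff_monomial] at ih ⊢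
    rw [ih, trop_min]
    congr 1
    by_cases h : x.1 = μ
    · simp [h]
    · simp [h, Ne.symm h]

theorem val_eq (u : Vec) (μ : ℕ) : val u μ = untrop ((series u).coeff μ) := by
  rw [coeff_series, untrop_trop]

theorem series_append (u v : Vec) : series (u ++ v) = series u + series v := by simp [series]

theorem val_append (u v : Vec) (μ : ℕ) : val (u ++ v) μ = min (val u μ) (val v μ) := by
  rw [val_eq, series_append, map_add, val_eq, val_eq, untrop_add]

theorem series_convolution (u v : Vec) :
    series (u.flatMap fun x => v.map fun y => (x.1 + y.1, x.2 + y.2)) = series u * series v := by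
  induction u with
  | nil => simp [series]
  | cons x u ih =>
    rw [List.flatMap_cons, series_append, ih]
    have : series (x :: u) = PowerSeries.monomial x.1 (trop x.2) + series u := rfl
    rw [this, add_mul]
    congr 1
    clear ih this
    induction v with
    | nil => simp [series]
    | cons y v ih =>
      simp only [series, List.map_cons, List.sum_cons, mul_add] at ih ⊢
      rw [ih]
      congr 1
      rw [PowerSeries.monomial_mul_monomial, trop_add]

theorem agree_normalize (b : ℕ) (u : Vec) :
    Agree b (series (normalize (List.range (b + 1)) u)) (series u) := fun μ hμ => by
  rw [coeff_series, coeff_series]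
  have : ∀ l : List ℕ, val (normalize l u) μ = if μ ∈ l then val u μ else ⊤ := by
    intro l
    induction l with
    | nil => rfl
    | cons a l ih =>
      rw [show normalize (a :: l) u = (a, val u a) :: normalize l u from rfl, val_cons, ih]
      by_cases h1 : a = μ
      · by_cases h2 : μ ∈ l <;> simp [h1, h2]
      · by_cases h2 : μ ∈ l <;> simp [h1, h2, Ne.symm h1]
  rw [this, if_pos (by rw [List.mem_range]; omega)]

theorem agree_conv (b : ℕ) (u v : Vec) :
    Agree b (series (conv (List.range (b + 1)) u v)) (series u * series v) :=
  (agree_normalize b _).trans (.of_eq (series_convolution u v))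

theorem series_unit : series [(0, 0)] = 1 := by
  simp only [series, List.map_cons, List.map_nil, List.sum_cons, List.sum_nil, add_zero,
    PowerSeries.monomial_zero_eq_C_apply]
  rw [show trop (0 : ℕ∞) = 1 from rfl, map_one]

theorem agree_prodVec (b : ℕ) (us : List Vec) :
    Agree b (series (prodVec (List.range (b + 1)) us)) (us.map series).prod := by
  have : ∀ (us : List Vec) a, Agree b (series (us.foldl (conv (List.range (b + 1))) a))
      (series a * (us.map series).prod) := by
    intro us
    induction us with
    | nil => intro a; simpa using Agree.refl b _
    | cons u us ih =>
      intro a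
      rw [List.foldl_cons, List.map_cons, List.prod_cons, ← mul_assoc]
      exact (ih _).trans ((agree_conv b a u).mul (.refl b _))
  refine (this us _).trans (.of_eq ?_)
  rw [series_unit, one_mul]

/-- The cost of a hyperedge at given colours. -/
def edgeSeries (e : HEdge) (c : List Colour) : Series := series (edgeVec e.2.1 c)

/-- The total cost of a colouring. -/
def totalSeries (es : List HEdge) (col : ℕ → Colour) : Series :=
  (es.map fun e => edgeSeries e (e.1.map col)).prod

/-- The colouring with colour `s` on `X` and `t` elsewhere. -/
def twoColouring (s t : Colour) (X : List ℕ) (v : ℕ) : Colour := if v ∈ X then s else t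

theorem agree_setVec (b : ℕ) (s t : Colour) (es : List HEdge) (X : List ℕ) :
    Agree b (series (setVec (List.range (b + 1)) s t es X))
      (totalSeries es (twoColouring s t X)) := by
  refine (agree_prodVec b _).trans (.of_eq ?_)
  rw [List.map_map]
  rfl

theorem totalSeries_filter (p : HEdge → Bool) (es : List HEdge) (col : ℕ → Colour) :
    totalSeries (es.filter p) col * totalSeries (es.filter fun e => !p e) col =
      totalSeries es col := by
  induction es with
  | nil => simp [totalSeries]
  | cons e es ih =>
    have h : totalSeries (e :: es) col = edgeSeries e (e.1.map col) * totalSeries es col := by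
      simp [totalSeries]
    have h' (l) : totalSeries (e :: l) col = edgeSeries e (e.1.map col) * totalSeries l col := by
      simp [totalSeries]
    rw [h, ← ih]
    cases hp : p e
    · simp only [List.filter_cons, hp]
      simp only [Bool.not_false, if_true, Bool.false_eq_true, if_false, h']
      ring
    · simp only [List.filter_cons, hp]
      simp only [Bool.not_true, if_true, Bool.false_eq_true, if_false, h']
      ring

theorem totalSeries_congr {es : List HEdge} {col col' : ℕ → Colour}
    (h : ∀ e ∈ es, ∀ v ∈ e.1, col v = col' v) : totalSeries es col = totalSeries es col' := by
  unfold totalSeries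
  congr 1
  refine List.map_congr_left fun e he => ?_
  rw [List.map_congr_left (h e he)]

theorem meets_iff {X Y : List ℕ} : meets X Y = true ↔ ∃ v ∈ X, v ∈ Y := by simp [meets]

/-- No hyperedge meets two different sets of the family. -/
def Separated (Xs : List (List ℕ)) (es : List HEdge) : Prop :=
  Xs.Pairwise fun X Y => ∀ e ∈ es, ¬(meets X e.1 = true ∧ meets Y e.1 = true)

/-- The tropical sum over sublists is the minimum over all choices, and it factors at each set `X`
by distributivity. By separation, hyperedges meeting `X` avoid all later sets, so their cost depends
only on the choice at `X`; the other hyperedges do not see `X`. -/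
theorem agree_dp (b : ℕ) (s t : Colour) (Xs : List (List ℕ)) (es : List HEdge)
    (h : Separated Xs es) : Agree b (series (dp (List.range (b + 1)) s t Xs es))
      (Xs.sublists'.map fun T => totalSeries es (twoColouring s t T.flatten)).sum := by
  have key : ∀ (Xs : List (List ℕ)) (es : List HEdge) (u : Vec), Separated Xs es →
      Agree b (series (conv (List.range (b + 1))
        (Xs.foldl (dpStep (List.range (b + 1)) s t) (es, u)).2
        (setVec (List.range (b + 1)) s t (Xs.foldl (dpStep (List.range (b + 1)) s t) (es, u)).1 [])))
        (series u * (Xs.sublists'.map fun T =>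
          totalSeries es (twoColouring s t T.flatten)).sum) := by
    intro Xs
    induction Xs with
    | nil =>
      intro es u _
      simpa using (agree_conv b u _).trans ((Agree.refl b _).mul (agree_setVec b s t es []))
    | cons X Xs ih =>
      intro es u h
      obtain ⟨h1, h2⟩ := List.pairwise_cons.1 h
      rw [List.foldl_cons, dpStep]
      refine (ih _ _ (h2.imp fun h e he => h e (List.mem_of_mem_filter he))).trans ?_
      refine (((agree_conv b _ _).trans ((Agree.refl b _).mul ((Agree.of_eq (series_append _ _)).trans
        ((agree_setVec b s t _ _).add (agree_setVec b s t _ _))))).mul (.refl b _)).trans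
        (.of_eq ?_)
      rw [mul_assoc]
      congr 1
      rw [List.sublists'_cons, List.map_append, List.sum_append, List.map_map, add_mul, add_comm,
        ← List.sum_map_mul_left, ← List.sum_map_mul_left]
      have hT : ∀ T ∈ Xs.sublists', ∀ e ∈ es, meets X e.1 = true → ∀ v ∈ e.1,
          v ∉ T.flatten := by
        intro T hT e he hX v hv hvT
        obtain ⟨Y, hY, hvY⟩ := List.mem_flatten.1 hvT
        exact h1 Y ((List.mem_sublists'.1 hT).subset hY) e he ⟨hX, meets_iff.2 ⟨v, hvY, hv⟩⟩
      congr 2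
      · refine List.map_congr_left fun T hTX => ?_
        rw [← totalSeries_filter (fun e => meets X e.1) es]
        congr 1
        refine totalSeries_congr fun e he v hv => ?_
        obtain ⟨he, hX⟩ := List.mem_filter.1 he
        simp [twoColouring, hT T hTX e he hX v hv]
      · refine List.map_congr_left fun T hTX => ?_
        rw [Function.comp_apply, ← totalSeries_filter (fun e => meets X e.1) es]
        congr 1
        · refine totalSeries_congr fun e he v hv => ?_
          obtain ⟨he, hX⟩ := List.mem_filter.1 he
          have := hT T hTX e he hX v hv
          simp only [twoColouring, List.flatten_cons, List.mem_append, this, or_false]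
        · refine totalSeries_congr fun e he v hv => ?_
          obtain ⟨he, hX⟩ := List.mem_filter.1 he
          have : v ∉ X := fun hvX => by simp [meets_iff.2 ⟨v, hvX, hv⟩] at hX
          simp only [twoColouring, List.flatten_cons, List.mem_append, this, false_or]
  refine (key Xs es [(0, 0)] h).trans (.of_eq ?_)
  rw [series_unit, one_mul]

theorem untrop_coeff_sum_le {ι : Type} (l : List ι) (f : ι → Series) (μ : ℕ) {i : ι} (hi : i ∈ l) :
    untrop ((l.map f).sum.coeff μ) ≤ untrop ((f i).coeff μ) := by
  induction l with
  | nil => simp at hi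
  | cons a l ih =>
    rw [List.map_cons, List.sum_cons, map_add, untrop_add]
    rcases List.mem_cons.1 hi with rfl | hi
    · exact min_le_left _ _
    · exact (min_le_right _ _).trans (ih hi)

theorem exists_untrop_coeff_sum {ι : Type} (l : List ι) (f : ι → Series) (μ : ℕ) (hl : l ≠ []) :
    ∃ i ∈ l, untrop ((l.map f).sum.coeff μ) = untrop ((f i).coeff μ) := by
  induction l with
  | nil => exact absurd rfl hl
  | cons a l ih =>
    rw [List.map_cons, List.sum_cons, map_add, untrop_add]
    rcases eq_or_ne l [] with rfl | h
    · exact ⟨a, by simp, by simp⟩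
    · obtain ⟨i, hi, h⟩ := ih h
      rcases min_choice (untrop ((f a).coeff μ)) (untrop ((l.map f).sum.coeff μ)) with h' | h'
      · exact ⟨a, by simp, h'⟩
      · exact ⟨i, by simp [hi], h'.trans h⟩

/-- The cost of a colouring at argument `μ`. -/
def costAt (es : List HEdge) (col : ℕ → Colour) (μ : ℕ) : ℕ∞ :=
  untrop ((totalSeries es col).coeff μ)

/-- Soundness: the minimum is attained, as the family of choices contains the empty sublist. -/
theorem exists_costAt_eq_dp {b : ℕ} (s t : Colour) {Xs : List (List ℕ)} {es : List HEdge}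
    (h : Separated Xs es) {μ : ℕ} (hμ : μ ≤ b) :
    ∃ col, val (dp (List.range (b + 1)) s t Xs es) μ = costAt es col μ := by
  obtain ⟨T, -, hT⟩ := exists_untrop_coeff_sum Xs.sublists'
    (fun T => totalSeries es (twoColouring s t T.flatten)) μ
    (List.ne_nil_of_mem (List.mem_sublists'.2 (List.nil_sublist _)))
  exact ⟨_, by rw [val_eq, agree_dp b s t Xs es h μ hμ, hT]; rfl⟩

/-- Completeness: the minimum is at most each of its terms. -/
theorem dp_le_costAt {b : ℕ} (s t : Colour) {Xs T : List (List ℕ)} {es : List HEdge}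
    (h : Separated Xs es) {μ : ℕ} (hμ : μ ≤ b) (hT : T.Sublist Xs) :
    val (dp (List.range (b + 1)) s t Xs es) μ ≤ costAt es (twoColouring s t T.flatten) μ := by
  rw [val_eq, agree_dp b s t Xs es h μ hμ]
  exact untrop_coeff_sum_le Xs.sublists'
    (fun T => totalSeries es (twoColouring s t T.flatten)) μ (List.mem_sublists'.2 hT)

end

end Painting

namespace Painting

/-! ### Clusters -/

def Covers (cl : List (List ℕ)) (v : ℕ) : Prop := ∃ X ∈ cl, v ∈ X

def Monochromatic (col : ℕ → Colour) (X : List ℕ) : Prop := ∀ u ∈ X, ∀ v ∈ X, col u = col v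

theorem exists_merge_superset {cl : List (List ℕ)} (S : List ℕ) {X : List ℕ} (hX : X ∈ cl) :
    ∃ Y ∈ merge cl S, X ⊆ Y := by
  by_cases h : meets S X = true
  · exact ⟨_, List.mem_cons_self, fun v hv =>
      List.mem_flatten.2 ⟨X, List.mem_filter.2 ⟨hX, h⟩, hv⟩⟩
  · exact ⟨X, List.mem_cons_of_mem _ (List.mem_filter.2 ⟨hX, by simpa using h⟩), fun _ h => h⟩

theorem exists_merge_contains {cl : List (List ℕ)} {S : List ℕ} (hS : ∀ v ∈ S, Covers cl v) :
    ∃ Y ∈ merge cl S, S ⊆ Y := by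
  refine ⟨_, List.mem_cons_self, fun v hv => ?_⟩
  obtain ⟨X, hX, hvX⟩ := hS v hv
  exact List.mem_flatten.2 ⟨X, List.mem_filter.2 ⟨hX, meets_iff.2 ⟨v, hv, hvX⟩⟩, hvX⟩

instance : Std.Symm (List.Disjoint (α := ℕ)) := ⟨fun _ _ h => List.Disjoint.symm h⟩

theorem merge_disjoint {cl : List (List ℕ)} (h : cl.Pairwise List.Disjoint) (S : List ℕ) :
    (merge cl S).Pairwise List.Disjoint := by
  refine List.pairwise_cons.2 ⟨fun Y hY v hv hvY => ?_, h.filter _⟩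
  obtain ⟨X, hX, hvX⟩ := List.mem_flatten.1 hv
  rw [List.mem_filter] at hX hY
  have hXY : X ≠ Y := by rintro rfl; simp_all
  exact h.forall hX.1 hY.1 hXY hvX hvY

theorem merge_monochromatic {cl : List (List ℕ)} {S : List ℕ} {col : ℕ → Colour}
    (h : ∀ X ∈ cl, Monochromatic col X) (hS : Monochromatic col S) :
    ∀ X ∈ merge cl S, Monochromatic col X := by
  intro X hX
  rcases List.mem_cons.1 hX with rfl | hX
  · have key : ∀ u ∈ (cl.filter fun X => meets S X).flatten, ∃ w ∈ S, col u = col w := by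
      intro u hu
      obtain ⟨Y, hY, huY⟩ := List.mem_flatten.1 hu
      rw [List.mem_filter, meets_iff] at hY
      obtain ⟨hY, w, hw, hwY⟩ := hY
      exact ⟨w, hw, h Y hY u huY w hwY⟩
    intro u hu v hv
    obtain ⟨w, hw, e⟩ := key u hu
    obtain ⟨w', hw', e'⟩ := key v hv
    rw [e, e', hS w hw w' hw']
  · exact h X (List.mem_of_mem_filter hX)

theorem exists_foldl_merge_superset (Ss : List (List ℕ)) {cl : List (List ℕ)} {X : List ℕ}
    (hX : X ∈ cl) : ∃ Y ∈ Ss.foldl merge cl, X ⊆ Y := by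
  induction Ss generalizing cl X with
  | nil => exact ⟨X, hX, fun _ h => h⟩
  | cons S Ss ih =>
    obtain ⟨Y, hY, hXY⟩ := exists_merge_superset S hX
    obtain ⟨Z, hZ, hYZ⟩ := ih hY
    exact ⟨Z, hZ, fun v hv => hYZ (hXY hv)⟩

theorem Covers.merge {cl : List (List ℕ)} {v : ℕ} (h : Covers cl v) (S : List ℕ) :
    Covers (Painting.merge cl S) v := by
  obtain ⟨X, hX, hv⟩ := h
  obtain ⟨Y, hY, hXY⟩ := exists_merge_superset S hX
  exact ⟨Y, hY, hXY hv⟩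

theorem Covers.foldl_merge {cl : List (List ℕ)} {v : ℕ} (h : Covers cl v) (Ss : List (List ℕ)) :
    Covers (Ss.foldl Painting.merge cl) v := by
  obtain ⟨X, hX, hv⟩ := h
  obtain ⟨Y, hY, hXY⟩ := exists_foldl_merge_superset Ss hX
  exact ⟨Y, hY, hXY hv⟩

theorem exists_foldl_merge_contains {Ss : List (List ℕ)} {cl : List (List ℕ)} {S : List ℕ}
    (h : S ∈ Ss) (hS : ∀ v ∈ S, Covers cl v) : ∃ Y ∈ Ss.foldl merge cl, S ⊆ Y := by
  induction Ss generalizing cl with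
  | nil => simp at h
  | cons S' Ss ih =>
    rcases List.mem_cons.1 h with rfl | h
    · obtain ⟨Y, hY, hSY⟩ := exists_merge_contains hS
      obtain ⟨Z, hZ, hYZ⟩ := exists_foldl_merge_superset Ss hY
      exact ⟨Z, hZ, fun v hv => hYZ (hSY hv)⟩
    · exact ih h fun v hv => (hS v hv).merge S'

theorem foldl_merge_disjoint (Ss : List (List ℕ)) {cl : List (List ℕ)}
    (h : cl.Pairwise List.Disjoint) : (Ss.foldl merge cl).Pairwise List.Disjoint := by
  induction Ss generalizing cl with
  | nil => exact h
  | cons S Ss ih => exact ih (merge_disjoint h S)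

theorem foldl_merge_monochromatic {Ss : List (List ℕ)} {cl : List (List ℕ)} {col : ℕ → Colour}
    (h : ∀ X ∈ cl, Monochromatic col X) (hS : ∀ S ∈ Ss, Monochromatic col S) :
    ∀ X ∈ Ss.foldl merge cl, Monochromatic col X := by
  induction Ss generalizing cl with
  | nil => exact h
  | cons S Ss ih =>
    exact ih (merge_monochromatic h (hS S (by simp))) fun S' h' => hS S' (by simp [h'])

theorem eq_of_disjoint {cl : List (List ℕ)} (h : cl.Pairwise List.Disjoint) {X Y : List ℕ}
    (hX : X ∈ cl) (hY : Y ∈ cl) {v : ℕ} (hvX : v ∈ X) (hvY : v ∈ Y) : X = Y := by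
  by_contra hne
  exact h.forall hX hY hne hvX hvY

section
variable {n : ℕ} {s t : Colour} {le : List (HEdge × List Colour)}

theorem components_disjoint (n : ℕ) (le : List (HEdge × List Colour)) :
    (components (List.range n) le).Pairwise List.Disjoint :=
  foldl_merge_disjoint _ (List.pairwise_map.2 (List.nodup_range.imp fun h => by simpa using Ne.symm h))

theorem clusters_disjoint (s : Colour) (n : ℕ) (le hard : List (HEdge × List Colour)) :
    (clusters s (components (List.range n) le) hard).Pairwise List.Disjoint :=
  foldl_merge_disjoint _ (components_disjoint n le)

theorem covers_components {v : ℕ} (hv : v < n) : Covers (components (List.range n) le) v :=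
  Covers.foldl_merge ⟨[v], by simpa using hv, by simp⟩ _

theorem exists_component {x : HEdge × List Colour} (hx : x ∈ le) (hn : ∀ v ∈ x.1.1, v < n)
    (h : x.2 = []) : ∃ X ∈ components (List.range n) le, x.1.1 ⊆ X :=
  exists_foldl_merge_contains (List.mem_map.2 ⟨x, List.mem_filter.2 ⟨hx, by simpa using h⟩, rfl⟩)
    fun v hv => ⟨[v], by simpa using hn v hv, by simp⟩

theorem exists_component_of_not_hard {x : HEdge × List Colour} (hx : x ∈ le)
    (hn : ∀ v ∈ x.1.1, v < n) (h : x ∉ hardEdges (components (List.range n) le) le) :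
    ∃ X ∈ components (List.range n) le, x.1.1 ⊆ X := by
  by_cases h0 : x.2 = []
  · exact exists_component hx hn h0
  · have h1 : ((components (List.range n) le).any fun X =>
        x.1.1.all fun v => decide (v ∈ X)) = true := by
      by_contra h1
      exact h (List.mem_filter.2 ⟨hx, by simp only [h0, h1]; rfl⟩)
    simp only [List.any_eq_true, List.all_eq_true, decide_eq_true_eq] at h1
    obtain ⟨X, hX, h⟩ := h1
    exact ⟨X, hX, fun v hv => h v hv⟩

theorem mem_inPart {x : HEdge × List Colour} {v : ℕ} (h : v ∈ inPart s x) : v ∈ x.1.1 := by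
  obtain ⟨y, hy, rfl⟩ := List.mem_map.1 h
  exact (List.of_mem_zip (List.mem_of_mem_filter hy)).1

/-- Each hyperedge is contained in a cluster, up to vertices that are not free. -/
theorem exists_cluster {x : HEdge × List Colour} (hx : x ∈ le) (hn : ∀ v ∈ x.1.1, v < n) :
    ∃ Y ∈ clusters s (components (List.range n) le) (hardEdges (components (List.range n) le) le),
      ∀ v ∈ x.1.1, v ∈ Y ∨ v ∈ (hardEdges (components (List.range n) le) le).flatMap
        fun x => outPart s x := by
  by_cases h : x ∈ hardEdges (components (List.range n) le) le
  · obtain ⟨Y, hY, hxY⟩ := exists_foldl_merge_contains (S := inPart s x)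
      (List.mem_map.2 ⟨x, h, rfl⟩) fun v hv =>
        covers_components (n := n) (le := le) (hn v (mem_inPart hv))
    refine ⟨Y, hY, fun v hv => ?_⟩
    by_cases hvs : v ∈ inPart s x
    · exact .inl (hxY hvs)
    · exact .inr (List.mem_flatMap.2 ⟨x, h, List.mem_filter.2 ⟨hv, by simpa using hvs⟩⟩)
  · obtain ⟨X, hX, hxX⟩ := exists_component_of_not_hard hx hn h
    obtain ⟨Y, hY, hXY⟩ := exists_foldl_merge_superset
      ((hardEdges (components (List.range n) le) le).map fun x => inPart s x) hX
    exact ⟨Y, hY, fun v hv => .inl (hXY (hxX hv))⟩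

/-- A hyperedge lies in one cluster `Z`, up to vertices in out-parts. Free clusters contain no such
vertices and clusters are disjoint, so `Z` is the only free cluster it can meet. Nothing is assumed
about the labels except their number, which ensures that `zip` loses no hyperedge. -/
theorem separated_freeSets {es : List HEdge} {lab : List (List Colour)}
    (hlab : lab.length = es.length) (hn : ∀ e ∈ es, ∀ v ∈ e.1, v < n) :
    Separated (freeSets s (List.range n) (es.zip lab)) es := by
  have hd := clusters_disjoint s n (es.zip lab)
    (hardEdges (components (List.range n) (es.zip lab)) (es.zip lab))
  refine (hd.filter _).imp_of_mem fun {X Y} hX hY hXY e he ⟨h1, h2⟩ => ?_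
  obtain ⟨i, hi, rfl⟩ := List.mem_iff_getElem.1 he
  have hx : (es[i], lab[i]'(by omega)) ∈ es.zip lab :=
    List.mem_iff_getElem.2 ⟨i, by simp; omega, by simp⟩
  obtain ⟨Z, hZ, h⟩ := exists_cluster (s := s) hx (hn _ he)
  have key : ∀ X, X ∈ freeSets s (List.range n) (es.zip lab) → meets X es[i].1 = true → X = Z := by
    intro X hX hm
    obtain ⟨hX, hX'⟩ := List.mem_filter.1 hX
    obtain ⟨v, hvX, hv⟩ := meets_iff.1 hm
    rcases h v hv with h | h
    · exact eq_of_disjoint hd hX hZ hvX h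
    · rw [meets_iff.2 ⟨v, h, hvX⟩] at hX'
      simp at hX'
  have e1 := key X hX h1
  have e2 := key Y hY h2
  obtain ⟨v, hv, -⟩ := meets_iff.1 h1
  subst e1
  subst e2
  exact hXY hv hv

/-- The labels `lab` describe the colouring `col`, with rare colour `s`. -/
structure Describes (s : Colour) (n : ℕ) (le : List (HEdge × List Colour)) (col : ℕ → Colour) :
    Prop where
  unlabelled : ∀ x ∈ le, x.2 = [] → Monochromatic col x.1.1
  labelled : ∀ x ∈ hardEdges (components (List.range n) le) le,
    x.2 = x.1.1.map col ∨ ∀ v ∈ x.1.1, col v ≠ s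

theorem mem_inPart_of_eq {col : ℕ → Colour} {x : HEdge × List Colour}
    (hs : x.2 = x.1.1.map col) {v : ℕ} : v ∈ inPart s x ↔ v ∈ x.1.1 ∧ col v = s := by
  rw [inPart, hs]
  generalize x.1.1 = l
  induction l with
  | nil => simp
  | cons a l ih =>
    rw [List.map_cons, List.zip_cons_cons, List.filter_cons, List.mem_cons, or_and_right, ← ih]
    by_cases h : col a = s
    · simp only [h, decide_true, if_true, List.map_cons, List.mem_cons]
      exact or_congr ⟨fun e => ⟨e, by rw [e, h]⟩, fun e => e.1⟩ Iff.rfl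
    · simp only [h, decide_false, Bool.false_eq_true, if_false]
      exact ⟨.inr, fun e => e.resolve_left fun e => h (by rw [← e.1, e.2])⟩

/-- Uniting along monochromatic sets preserves monochromaticity. The `s`-part of a hard hyperedge
has colour `s` if the label is true, and colour `t` if the hyperedge avoids `s`. -/
theorem Describes.monochromatic_clusters {col : ℕ → Colour} (h : Describes s n le col)
    (hst : ∀ c, c ≠ s ↔ c = t) : ∀ X ∈ clusters s (components (List.range n) le)
      (hardEdges (components (List.range n) le) le), Monochromatic col X := by
  refine foldl_merge_monochromatic (foldl_merge_monochromatic ?_ ?_) ?_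
  · intro X hX
    obtain ⟨w, -, rfl⟩ := List.mem_map.1 hX
    intro u hu v hv
    rw [List.mem_singleton.1 hu, List.mem_singleton.1 hv]
  · intro X hX
    obtain ⟨x, hx, rfl⟩ := List.mem_map.1 hX
    rw [List.mem_filter] at hx
    exact h.unlabelled x hx.1 (by simpa using hx.2)
  · intro X hX u hu v hv
    obtain ⟨x, hx, rfl⟩ := List.mem_map.1 hX
    rcases h.labelled x hx with h | h
    · rw [((mem_inPart_of_eq h).1 hu).2, ((mem_inPart_of_eq h).1 hv).2]
    · rw [(hst _).1 (h u (mem_inPart hu)), (hst _).1 (h v (mem_inPart hv))]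

theorem Describes.ne_of_mem_outPart {col : ℕ → Colour} (h : Describes s n le col)
    {v : ℕ} (hv : v ∈ (hardEdges (components (List.range n) le) le).flatMap
        fun x => outPart s x) : col v ≠ s := by
  obtain ⟨x, hx, hv⟩ := List.mem_flatMap.1 hv
  obtain ⟨hv, hv'⟩ := List.mem_filter.1 hv
  rcases h.labelled x hx with h | h
  · rintro e
    simp [(mem_inPart_of_eq h).2 ⟨hv, e⟩] at hv'
  · exact h v hv

/-- A colouring that is described by the labels is among those considered by the algorithm. -/
theorem Describes.exists_sublist {col : ℕ → Colour} (h : Describes s n le col)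
    (hst : ∀ c, c ≠ s ↔ c = t) :
    ∃ T : List (List ℕ), T.Sublist (freeSets s (List.range n) le) ∧
      ∀ v < n, twoColouring s t T.flatten v = col v := by
  refine ⟨(freeSets s (List.range n) le).filter fun X => X.all fun v => decide (col v = s),
    List.filter_sublist, fun v hv => ?_⟩
  have hm := h.monochromatic_clusters hst
  rw [twoColouring]
  split
  case isTrue hT =>
    obtain ⟨X, hX, hvX⟩ := List.mem_flatten.1 hT
    have := (List.mem_filter.1 hX).2
    rw [List.all_eq_true] at this
    exact (of_decide_eq_true (this v hvX)).symm
  case isFalse hT =>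
    refine ((hst _).1 fun hvs => hT ?_).symm
    obtain ⟨Y, hY, hvY⟩ := (covers_components (le := le) hv).foldl_merge
      ((hardEdges (components (List.range n) le) le).map fun x => inPart s x)
    -- A cluster with a vertex of colour `s` is entirely of colour `s`. It thus contains no vertex
    -- of an out-part and is free.
    refine List.mem_flatten.2 ⟨Y, List.mem_filter.2 ⟨List.mem_filter.2 ⟨hY, ?_⟩, ?_⟩, hvY⟩
    · rw [Bool.not_eq_true']
      by_contra hf
      obtain ⟨u, hu, huY⟩ := meets_iff.1 (by simpa using hf)
      exact h.ne_of_mem_outPart hu ((hm Y hY u huY v hvY).trans hvs)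
    · rw [List.all_eq_true]
      intro u hu
      simpa using (hm Y hY u hu v hvY).trans hvs

end

/-! ### Spanning subfamilies -/

/-- Linear algebra replaces spanning forests. Let `U i` be spanned by the differences of basis
vectors belonging to vertices of `vs i`; a function is constant on `vs i` exactly if the linear
functional with these values vanishes on `U i`. Pick members of `M` greedily, only if they enlarge
the span: each raises the dimension, which is at most the size of `B`. -/
theorem exists_spanning_subset {ι : Type} [DecidableEq ι] (M : Finset ι) (vs : ι → List ℕ)
    (B : Finset ℕ) (hB : ∀ i ∈ M, ∀ v ∈ vs i, v ∈ B) :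
    ∃ S ⊆ M, S.card ≤ B.card ∧ ∀ f : ℕ → ℕ, (∀ i ∈ S, ∀ u ∈ vs i, ∀ v ∈ vs i, f u = f v) →
      ∀ i ∈ M, ∀ u ∈ vs i, ∀ v ∈ vs i, f u = f v := by
  let U : ι → Submodule ℚ (ℕ →₀ ℚ) := fun i => Submodule.span ℚ
    {x | ∃ u ∈ vs i, ∃ v ∈ vs i, x = Finsupp.single u 1 - Finsupp.single v 1}
  let W : Submodule ℚ (ℕ →₀ ℚ) := Submodule.span ℚ
    (B.image fun v => (Finsupp.single v 1 : ℕ →₀ ℚ))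
  have hW : Module.finrank ℚ W ≤ B.card :=
    (finrank_span_finset_le_card _).trans Finset.card_image_le
  have hUW : ∀ i ∈ M, U i ≤ W := by
    intro i hi
    refine Submodule.span_le.2 ?_
    rintro x ⟨u, hu, v, hv, rfl⟩
    exact W.sub_mem (Submodule.subset_span (by simpa using ⟨u, hB i hi u hu, rfl⟩))
      (Submodule.subset_span (by simpa using ⟨v, hB i hi v hv, rfl⟩))
  have key : ∀ M' ⊆ M, ∃ S ⊆ M', S.card ≤ Module.finrank ℚ (S.sup U : Submodule ℚ (ℕ →₀ ℚ)) ∧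
      ∀ i ∈ M', U i ≤ S.sup U := by
    intro M'
    induction M' using Finset.induction_on with
    | empty => exact fun _ => ⟨∅, by simp, by simp, by simp⟩
    | insert a M' ha ih =>
      intro hM
      obtain ⟨S, hS, h1, h2⟩ := ih ((Finset.subset_insert _ _).trans hM)
      by_cases h : U a ≤ S.sup U
      · refine ⟨S, hS.trans (Finset.subset_insert _ _), h1, fun i hi => ?_⟩
        rcases Finset.mem_insert.1 hi with rfl | hi
        · exact h
        · exact h2 i hi
      · have hle : (insert a S).sup U ≤ W := Finset.sup_le fun i hi =>
          hUW i (hM (Finset.insert_subset_insert a hS hi))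
        have : FiniteDimensional ℚ ((insert a S).sup U : Submodule ℚ (ℕ →₀ ℚ)) :=
          Submodule.finiteDimensional_of_le hle
        refine ⟨insert a S, Finset.insert_subset_insert a hS, ?_, fun i hi => ?_⟩
        · have hlt : S.sup U < (insert a S).sup U := by
            rw [Finset.sup_insert]
            exact right_lt_sup.2 h
          have := Submodule.finrank_lt_finrank_of_lt hlt
          have := Finset.card_insert_le a S
          omega
        · rw [Finset.sup_insert]
          rcases Finset.mem_insert.1 hi with rfl | hi
          · exact le_sup_left
          · exact (h2 i hi).trans le_sup_right
  obtain ⟨S, hS, h1, h2⟩ := key M subset_rfl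
  refine ⟨S, hS, h1.trans ((Submodule.finrank_mono (Finset.sup_le fun i hi =>
    hUW i (hS hi))).trans hW), fun f hf i hi u hu v hv => ?_⟩
  let φ : (ℕ →₀ ℚ) →ₗ[ℚ] ℚ := Finsupp.linearCombination ℚ fun v => (f v : ℚ)
  have hk : S.sup U ≤ LinearMap.ker φ := Finset.sup_le fun i hi => Submodule.span_le.2 (by
    rintro x ⟨u, hu, v, hv, rfl⟩
    simp [φ, hf i hi u hu v hv])
  have := hk (h2 i hi (Submodule.subset_span ⟨u, hu, v, hv, rfl⟩))
  simpa [φ, sub_eq_zero] using this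

end Painting

/-! ### Separating moduli -/

theorem two_pow_le_centralBinom {t : ℕ} (ht : 0 < t) : 2 ^ t ≤ t.centralBinom := by
  have h1 := Nat.four_pow_le_two_mul_self_mul_centralBinom t ht
  have h2 : 2 * t ≤ 2 ^ t := by
    obtain ⟨s, rfl⟩ : ∃ s, t = s + 1 := ⟨t - 1, by omega⟩
    have := Nat.lt_two_pow_self (n := s)
    rw [pow_succ]; omega
  have h3 : (4 : ℕ) ^ t = 2 ^ t * 2 ^ t := by rw [← mul_pow]; norm_num
  rw [h3] at h1
  exact Nat.le_of_mul_le_mul_left (h1.trans (Nat.mul_le_mul_right _ h2)) (by positivity)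

/-- Otherwise each number up to `2 * t` divides some `δ`. The prime powers in the factorization of
the central binomial coefficient are at most `2 * t`, so this coefficient divides the product of
`D`. But it is at least `2 ^ t`, while the product is at most `2 ^ (D.card * L)`. -/
theorem exists_modulus {D : Finset ℕ} {L t : ℕ} (hD : ∀ δ ∈ D, 0 < δ ∧ δ < 2 ^ L)
    (ht : D.card * L < t) : ∃ p, 1 ≤ p ∧ p ≤ 2 * t ∧ ∀ δ ∈ D, ¬p ∣ δ := by
  by_contra! h
  have hpos : 0 < t := by omega
  have h0 : ∏ δ ∈ D, δ ≠ 0 := Finset.prod_ne_zero_iff.2 fun δ hδ => (hD δ hδ).1.ne'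
  have hdvd : t.centralBinom ∣ ∏ δ ∈ D, δ := by
    rw [← Nat.factorization_prime_le_iff_dvd (Nat.centralBinom_ne_zero t) h0]
    intro p hp
    obtain ⟨δ, hδ, hpδ⟩ := h (p ^ t.centralBinom.factorization p) (Nat.pow_pos hp.pos) (by
      rw [Nat.centralBinom_eq_two_mul_choose]
      exact Nat.pow_factorization_choose_le (by omega))
    exact (hp.pow_dvd_iff_le_factorization h0).1 (hpδ.trans (Finset.dvd_prod_of_mem _ hδ))
  have h1 : ∏ δ ∈ D, δ ≤ ∏ δ ∈ D, 2 ^ L := Finset.prod_le_prod' fun δ hδ => (hD δ hδ).2.le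
  rw [Finset.prod_const, ← pow_mul, mul_comm] at h1
  have h2 := (two_pow_le_centralBinom hpos).trans (Nat.le_of_dvd (Nat.pos_of_ne_zero h0) hdvd)
  have h3 := (Nat.pow_le_pow_iff_right (by norm_num : 1 < 2)).1 (h2.trans h1)
  have h4 := mul_comm L D.card
  omega

namespace Painting

/-! ### Labellings -/

theorem mem_progression {p r x : ℕ} {l : List (List (List Colour))} :
    x ∈ progression p r l ↔ ∃ i < l.length, x = r + i * p := by
  have : ∀ (l : List (List (List Colour))) (c : ℕ) (acc : List ℕ),
      x ∈ (l.foldl (fun (c : ℕ × List ℕ) _ => (c.1 + p, c.1 :: c.2)) (c, acc)).2 ↔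
        x ∈ acc ∨ ∃ i < l.length, x = c + i * p := by
    intro l
    induction l with
    | nil => simp
    | cons a l ih =>
      intro c acc
      rw [List.foldl_cons, ih, List.mem_cons, List.length_cons, or_comm (a := x = c), or_assoc]
      refine or_congr Iff.rfl ⟨?_, ?_⟩
      · rintro (rfl | ⟨i, hi, rfl⟩)
        · exact ⟨0, by omega, by omega⟩
        · exact ⟨i + 1, by omega, by ring⟩
      · rintro ⟨_ | i, hi, rfl⟩
        · exact .inl (by omega)
        · exact .inr ⟨i, by omega, by ring⟩
  exact (this l r []).trans (by simp)

theorem nthLabel_eq (l : List (List Colour)) (j : ℕ) : nthLabel l j = l.getD j [] := by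
  have : ∀ (l : List (List Colour)) (a : ℕ), (((l.zip (List.range' a l.length)).filter
      fun x => decide (x.2 = j)).map fun x => x.1).flatten =
        if a ≤ j then l.getD (j - a) [] else [] := by
    intro l
    induction l with
    | nil => simp
    | cons c l ih =>
      intro a
      rw [List.length_cons, List.range'_succ, List.zip_cons_cons, List.filter_cons]
      rcases lt_trichotomy a j with h | rfl | h
      · have e : j - a = (j - (a + 1)) + 1 := by omega
        rw [if_neg (by simpa using h.ne), ih, if_pos (by omega), if_pos (by omega), e,
          List.getD_cons_succ]
      · rw [if_pos (by simp), List.map_cons, List.flatten_cons, ih, if_neg (by omega),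
          if_pos le_rfl]
        simp
      · rw [if_neg (by simpa using h.ne'), ih, if_neg (by omega), if_neg (by omega)]
  rw [nthLabel, List.range_eq_range', this]
  simp

theorem length_residueMask (l : List (List (List Colour))) (p r j : ℕ) :
    (residueMask l p r j).length = l.length := by simp [residueMask]

theorem residueMask_getD {l : List (List (List Colour))} {p r j x : ℕ} (hx : x < l.length) :
    (residueMask l p r j).getD x [] =
      if x ∈ progression p r l then (l.getD x []).getD j [] else [] := by
  rw [List.getD_eq_getElem _ _ (by rwa [length_residueMask])]
  simp only [residueMask, List.getElem_map, List.getElem_zip, List.getElem_range, nthLabel_eq,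
    List.getD_eq_getElem l [] hx]

theorem length_overlay {a b : List (List Colour)} (h : a.length = b.length) :
    (overlay a b).length = b.length := by simp [overlay, h]

theorem overlay_getD {a b : List (List Colour)} (h : a.length = b.length) (x : ℕ) :
    (overlay a b).getD x [] = if a.getD x [] = [] then b.getD x [] else a.getD x [] := by
  by_cases hx : x < b.length
  · rw [List.getD_eq_getElem _ _ (by rwa [length_overlay h]), List.getD_eq_getElem _ _ hx,
      List.getD_eq_getElem _ _ (h ▸ hx)]
    simp [overlay]
  · rw [List.getD_eq_default _ _ (by rw [length_overlay h]; omega),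
      List.getD_eq_default _ _ (by omega), List.getD_eq_default _ _ (by omega)]
    simp

theorem mem_candidates {e : HEdge} {c : List Colour} :
    c ∈ candidates e ↔ bichromatic c = true ∧ ∃ r ∈ e.2.1, r.1 = c := by
  have : ∀ (tab : List Row) (acc : List (List Colour)), c ∈ tab.foldl (fun acc r =>
      if (bichromatic r.1 && !decide (r.1 ∈ acc)) = true then r.1 :: acc else acc) acc ↔
        c ∈ acc ∨ bichromatic c = true ∧ ∃ r ∈ tab, r.1 = c := by
    intro tab
    induction tab with
    | nil => simp
    | cons r tab ih =>
      intro acc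
      rw [List.foldl_cons, ih]
      by_cases hb : bichromatic r.1 = true
      · by_cases hr : r.1 ∈ acc
        · simp only [hb, hr, decide_true, Bool.not_true, Bool.and_false, Bool.false_eq_true,
            if_false, List.mem_cons, exists_eq_or_imp]
          constructor
          · tauto
          · rintro (h | ⟨h, rfl | h'⟩)
            · exact .inl h
            · exact .inl hr
            · exact .inr ⟨h, h'⟩
        · simp only [hb, hr, decide_false, Bool.not_false, Bool.and_true,
            if_true, List.mem_cons, exists_eq_or_imp]
          constructor
          · rintro ((rfl | h) | h)
            · exact .inr ⟨hb, .inl rfl⟩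
            · exact .inl h
            · exact .inr ⟨h.1, .inr h.2⟩
          · rintro (h | ⟨h, rfl | h'⟩)
            · exact .inl (.inr h)
            · exact .inl (.inl rfl)
            · exact .inr ⟨h, h'⟩
      · simp only [hb, Bool.false_and, Bool.false_eq_true, if_false, List.mem_cons,
          exists_eq_or_imp]
        refine or_congr Iff.rfl (and_congr_right fun h => ⟨.inr, ?_⟩)
        rintro (rfl | h')
        · exact absurd h hb
        · exact h'
  exact (this e.2.1 []).trans (by simp)

theorem nodup_candidates (e : HEdge) : (candidates e).Nodup := by
  have : ∀ (tab : List Row) (acc : List (List Colour)), acc.Nodup → (tab.foldl (fun acc r =>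
      if (bichromatic r.1 && !decide (r.1 ∈ acc)) = true then r.1 :: acc else acc) acc).Nodup := by
    intro tab
    induction tab with
    | nil => exact fun _ h => h
    | cons r tab ih =>
      intro acc h
      refine ih _ ?_
      dsimp only
      split
      case isTrue h' => exact List.nodup_cons.2 ⟨by simp_all, h⟩
      case isFalse => exact h
  exact this _ _ List.nodup_nil

theorem longest_spec (ls : List (List (List Colour))) :
    (∀ l ∈ ls, l.length ≤ (longest ls).length) ∧ (longest ls = [] ∨ longest ls ∈ ls) := by
  have : ∀ (ls : List (List (List Colour))) a, (∀ l ∈ a :: ls, l.length ≤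
      (ls.foldl (fun acc l => if acc.length ≤ l.length then l else acc) a).length) ∧
      ls.foldl (fun acc l => if acc.length ≤ l.length then l else acc) a ∈ a :: ls := by
    intro ls
    induction ls with
    | nil => simp
    | cons b ls ih =>
      intro a
      obtain ⟨h1, h2⟩ := ih (if a.length ≤ b.length then b else a)
      rw [List.foldl_cons]
      refine ⟨fun l hl => ?_, ?_⟩
      · have h3 := h1 _ List.mem_cons_self
        rcases List.mem_cons.1 hl with rfl | hl
        · refine le_trans ?_ h3
          split <;> omega
        · rcases List.mem_cons.1 hl with rfl | hl
          · refine le_trans ?_ h3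
            split <;> omega
          · exact h1 l (by simp [hl])
      · rcases List.mem_cons.1 h2 with h2 | h2
        · rw [h2]
          split <;> simp
        · simp [h2]
  obtain ⟨h1, h2⟩ := this ls []
  exact ⟨fun l hl => h1 l (by simp [hl]), (List.mem_cons.1 h2)⟩

/-- A power of two is doubled until it reaches the length `N`; one round per list element suffices
because it exceeds the number of rounds made. The last doubling starts below `N`, whence the upper
bound. -/
theorem logList_spec (l : List (List (List Colour))) :
    l.length ≤ 2 ^ (logList l).length ∧ 2 ^ (logList l).length ≤ 2 * l.length + 1 := by
  have : ∀ (N : ℕ) (l : List (List (List Colour))),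
      let r := (l.foldl (fun (c : ℕ × List ℕ) _ =>
        if N ≤ c.1 then c else (c.1 + c.1, 0 :: c.2)) (1, ([] : List ℕ)))
      r.1 = 2 ^ r.2.length ∧ r.1 ≤ 2 * N + 1 ∧ (l.length < r.1 ∨ N ≤ r.1) := by
    intro N l
    induction l using List.reverseRecOn with
    | nil => simp
    | append_singleton l b ih =>
      simp only [List.foldl_append, List.foldl_cons, List.foldl_nil, List.length_append,
        List.length_singleton] at ih ⊢
      set c := l.foldl (fun (c : ℕ × List ℕ) _ =>
        if N ≤ c.1 then c else (c.1 + c.1, 0 :: c.2)) (1, [])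
      obtain ⟨h1, h2, h3⟩ := ih
      have h4 : 1 ≤ c.1 := by rw [h1]; exact Nat.one_le_two_pow
      split
      · exact ⟨h1, h2, by omega⟩
      · refine ⟨?_, ?_, ?_⟩
        · rw [List.length_cons, pow_succ, ← h1]
          dsimp only
          omega
        · dsimp only; omega
        · dsimp only; omega
  obtain ⟨h1, h2, h3⟩ := this l.length l
  rw [logList]
  omega

theorem length_modulusList (K Q : List ℕ) (l : List (List (List Colour))) :
    (modulusList K Q l).length = 2 * ((K.length + Q.length + 1) * ((logList l).length + 1)) + 1 := by
  simp only [modulusList, List.length_cons, List.length_append, List.length_flatMap,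
    List.map_const', List.sum_replicate, smul_eq_mul]
  ring

/-- If `p` divides no distance from `a` to another point of `Z`, the residue class of `a` meets `Z`
only in `a`. -/
theorem exists_mem_residueMasks {l : List (List (List Colour))} {K Q : List ℕ} {Z : Finset ℕ}
    (hZ : ∀ z ∈ Z, z < l.length) (hcard : Z.card ≤ K.length + Q.length) {a : ℕ} (ha : a ∈ Z)
    {c : List Colour} (hc : c ∈ l.getD a []) :
    ∃ o ∈ residueMasks l (modulusList K Q l), o.length = l.length ∧ o.getD a [] = c ∧
      ∀ z ∈ Z, z ≠ a → o.getD z [] = [] := by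
  obtain ⟨j, hj, rfl⟩ := List.mem_iff_getElem.1 hc
  set L := (logList l).length
  -- One of the truncated differences is zero, so their sum is the distance, which is below `2 ^ L`.
  -- The value of `t` exceeds the number of distances times `L`, and `modulusList` has length `2 * t
  -- + 1`, so its range contains `p` and all residues.
  obtain ⟨p, hp1, hp2, hp⟩ := exists_modulus (D := (Z.erase a).image fun z => (z - a) + (a - z))
    (L := L) (t := (K.length + Q.length + 1) * (L + 1)) (by
      intro δ hδ
      obtain ⟨z, hz, rfl⟩ := Finset.mem_image.1 hδ
      rw [Finset.mem_erase] at hz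
      have h1 := hZ z hz.2
      have h2 := hZ a ha
      have h3 := (logList_spec l).1
      change _ ≤ 2 ^ L at h3
      omega) (by
      have h1 : ((Z.erase a).image fun z => (z - a) + (a - z)).card ≤ K.length + Q.length :=
        Finset.card_image_le.trans (Finset.card_erase_le.trans hcard)
      have h2 := Nat.mul_le_mul_right L h1
      have h3 : (K.length + Q.length + 1) * (L + 1) = (K.length + Q.length) * L +
        (K.length + Q.length) + L + 1 := by ring
      omega)
  have hal := hZ a ha
  have hlen : _ = 2 * ((K.length + Q.length + 1) * (L + 1)) + 1 := length_modulusList K Q l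
  refine ⟨residueMask l p (a % p) j, ?_, length_residueMask _ _ _ _, ?_, fun z hz hza => ?_⟩
  · have h1 := Nat.mod_lt a (show 0 < p by omega)
    refine List.mem_flatMap.2 ⟨p, List.mem_range.2 (by omega), List.mem_flatMap.2 ⟨a % p,
      List.mem_range.2 (by omega), List.mem_map.2 ⟨j, List.mem_range.2 ?_, rfl⟩⟩⟩
    rw [List.getD_eq_getElem _ _ hal] at hj
    exact hj.trans_le ((longest_spec l).1 _ (List.getElem_mem _))
  · rw [residueMask_getD hal, if_pos, List.getD_eq_getElem _ _ hj]
    -- The progression has as many terms as there are positions, which suffices since `a / p ≤ a`.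
    refine mem_progression.2 ⟨a / p, (Nat.div_le_self _ _).trans_lt hal, ?_⟩
    rw [mul_comm, Nat.mod_add_div]
  · rw [residueMask_getD (hZ z hz), if_neg]
    intro h
    obtain ⟨i, hi, h⟩ := mem_progression.1 h
    refine hp _ (Finset.mem_image.2 ⟨z, Finset.mem_erase.2 ⟨hza, hz⟩, rfl⟩) ?_
    have h1 : z ≡ a [MOD p] := by
      rw [h, Nat.ModEq, Nat.add_mul_mod_self_right, Nat.mod_mod]
    rcases le_total a z with h2 | h2
    · rw [show z - a + (a - z) = z - a by omega]
      exact (Nat.modEq_iff_dvd' h2).1 h1.symm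
    · rw [show z - a + (a - z) = a - z by omega]
      exact (Nat.modEq_iff_dvd' h2).1 h1

theorem length_of_mem_extendMasks {O : List (List (List Colour))} {m : ℕ}
    (hO : ∀ o ∈ O, o.length = m) (K : List ℕ) {ms : List (List (List Colour))}
    (hms : ∀ a ∈ ms, a.length = m) : ∀ a ∈ K.foldl (extendMasks O) ms, a.length = m := by
  induction K generalizing ms with
  | nil => exact hms
  | cons b K ih =>
    refine ih fun a ha => ?_
    rcases List.mem_append.1 ha with ha | ha
    · exact hms a ha
    · obtain ⟨o, ho, ha⟩ := List.mem_flatMap.1 ha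
      obtain ⟨a', ha', rfl⟩ := List.mem_map.1 ha
      rw [length_overlay (by rw [hO o ho, hms a' ha']), hms a' ha']

/-- Here `A` is the set of positions still to be corrected. Overlaying the mask that belongs to `a`
corrects position `a` and changes nothing else on `Z`. -/
theorem exists_mem_foldl_extendMasks {O : List (List (List Colour))} {m : ℕ} {Z : Finset ℕ}
    {g : ℕ → List Colour} (K : List ℕ) {A : Finset ℕ} (hA : A.card ≤ K.length)
    (hO : ∀ a ∈ A, g a ≠ [] ∧ ∃ o ∈ O, o.length = m ∧ o.getD a [] = g a ∧
      ∀ z ∈ Z, z ≠ a → o.getD z [] = [])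
    {ms : List (List (List Colour))} {lab : List (List Colour)} (hlab : lab ∈ ms)
    (hm : lab.length = m) (hg : ∀ z ∈ Z, z ∉ A → lab.getD z [] = g z) :
    ∃ lab' ∈ K.foldl (extendMasks O) ms, ∀ z ∈ Z, lab'.getD z [] = g z := by
  induction K generalizing A ms lab with
  | nil =>
    rw [List.length_nil, Nat.le_zero, Finset.card_eq_zero] at hA
    subst hA
    exact ⟨lab, hlab, fun z hz => hg z hz (by simp)⟩
  | cons b K ih =>
    rw [List.foldl_cons]
    rcases A.eq_empty_or_nonempty with rfl | ⟨a, ha⟩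
    · exact ih (by simp) hO (List.mem_append_left _ hlab) hm hg
    · obtain ⟨hga, o, ho, hom, hoa, hoz⟩ := hO a ha
      refine ih (A := A.erase a) ?_ (fun a' ha' => hO a' (Finset.mem_of_mem_erase ha'))
        (lab := overlay o lab) (List.mem_append_right _ (List.mem_flatMap.2
          ⟨o, ho, List.mem_map.2 ⟨lab, hlab, rfl⟩⟩)) ?_ fun z hz hzA => ?_
      · rw [Finset.card_erase_of_mem ha]
        simp only [List.length_cons] at hA
        omega
      · rw [length_overlay (by rw [hom, hm]), hm]
      · rw [overlay_getD (by rw [hom, hm])]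
        by_cases hza : z = a
        · subst hza
          rw [hoa, if_neg hga]
        · rw [hoz z hz hza, if_pos rfl]
          exact hg z hz fun h => hzA (Finset.mem_erase.2 ⟨hza, h⟩)

theorem length_of_mem_masks {x : Input} {lab : List (List Colour)} (h : lab ∈ masks x) :
    lab.length = (allEdges x).length := by
  refine length_of_mem_extendMasks (fun o ho => ?_) _ (fun a ha => ?_) lab h
  · obtain ⟨p, -, ho⟩ := List.mem_flatMap.1 ho
    obtain ⟨r, -, ho⟩ := List.mem_flatMap.1 ho
    obtain ⟨j, -, rfl⟩ := List.mem_map.1 ho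
    rw [length_residueMask, cands, List.length_map]
  · rw [List.mem_singleton.1 ha, List.length_map, cands, List.length_map]

/-- Every labelling of few hyperedges is realized by a mask. -/
theorem exists_mem_masks {x : Input} {A S : Finset ℕ} {g : ℕ → List Colour}
    (hAm : ∀ a ∈ A, a < (allEdges x).length) (hSm : ∀ a ∈ S, a < (allEdges x).length)
    (hA : A.card ≤ x.1) (hS : S.card ≤ x.2.2.2.1)
    (hg : ∀ a ∈ A, g a ∈ (cands x).getD a []) (hgA : ∀ a ∈ A, g a ≠ [])
    (hgS : ∀ a ∈ S, a ∉ A → g a = []) :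
    ∃ lab ∈ masks x, ∀ z ∈ A ∪ S, lab.getD z [] = g z := by
  have hlen : (cands x).length = (allEdges x).length := by rw [cands, List.length_map]
  have hdepth : A.card ≤ depth x := by
    rw [depth]
    split
    -- Without candidates nothing can be labelled, so `A` is empty and depth 0 is enough.
    case isTrue h =>
      rw [Nat.le_zero, Finset.card_eq_zero, Finset.eq_empty_iff_forall_notMem]
      intro a ha
      have h1 := hg a ha
      have h2 := hAm a ha
      rw [List.getD_eq_getElem _ _ (by omega)] at h1
      have h3 := (longest_spec (cands x)).1 _ (List.getElem_mem (by omega : a < (cands x).length))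
      rw [h, List.length_nil, Nat.le_zero, List.length_eq_zero_iff] at h3
      rw [h3] at h1
      simp at h1
    case isFalse => exact hA
  refine exists_mem_foldl_extendMasks (m := (allEdges x).length) _ (A := A) (by simpa using hdepth)
    (fun a ha => ⟨hgA a ha, ?_⟩) (List.mem_singleton_self _) (by simp [hlen]) fun z hz hzA => ?_
  · rw [← hlen]
    refine exists_mem_residueMasks (fun z hz => ?_) ?_ (Finset.mem_union_left _ ha) (hg a ha)
    · rw [hlen]
      rcases Finset.mem_union.1 hz with hz | hz
      · exact hAm z hz
      · exact hSm z hz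
    · rw [List.length_range, List.length_range]
      exact (Finset.card_union_le _ _).trans (Nat.add_le_add hdepth hS)
  · have hzS := (Finset.mem_union.1 hz).resolve_left hzA
    rw [hgS z hzS hzA, List.getD_eq_getElem _ _ (by simpa [hlen] using hSm z hzS)]
    simp

end Painting

/-! ### The stored instance and the costs of its colourings. -/

namespace Painting

theorem val_le {u : Vec} {x : ℕ × ℕ∞} (hx : x ∈ u) : val u x.1 ≤ x.2 := by
  induction u with
  | nil => simp at hx
  | cons y u ih =>
    rw [val_cons]
    rcases List.mem_cons.1 hx with rfl | hx
    · simp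
    · exact (min_le_right _ _).trans (ih hx)

theorem exists_of_val_ne_top {u : Vec} {μ : ℕ} (h : val u μ ≠ ⊤) :
    ∃ x ∈ u, x.1 = μ ∧ x.2 = val u μ := by
  induction u with
  | nil => simp [val] at h
  | cons y u ih =>
    rw [val_cons] at h ⊢
    rcases min_choice (if y.1 = μ then y.2 else ⊤) (val u μ) with h' | h' <;> rw [h'] at h ⊢
    · split at h
      case isTrue hy => exact ⟨y, by simp, hy, by rw [if_pos hy]⟩
      case isFalse => simp at h
    · obtain ⟨x, hx, h⟩ := ih h
      exact ⟨x, by simp [hx], h⟩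

theorem val_flatMap_le {α : Type} {l : List α} (f : α → Vec) (μ : ℕ) {a : α} (ha : a ∈ l) :
    val (l.flatMap f) μ ≤ val (f a) μ := by
  induction l with
  | nil => simp at ha
  | cons b l ih =>
    rw [List.flatMap_cons, val_append]
    rcases List.mem_cons.1 ha with rfl | ha
    · exact min_le_left _ _
    · exact (min_le_right _ _).trans (ih ha)

theorem exists_val_flatMap {α : Type} {l : List α} (f : α → Vec) {μ : ℕ}
    (h : val (l.flatMap f) μ ≠ ⊤) : ∃ a ∈ l, val (l.flatMap f) μ = val (f a) μ := by
  induction l with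
  | nil => simp [val] at h
  | cons b l ih =>
    rw [List.flatMap_cons, val_append] at h ⊢
    rcases min_choice (val (f b) μ) (val (l.flatMap f) μ) with h' | h' <;> rw [h'] at h ⊢
    · exact ⟨b, by simp, rfl⟩
    · obtain ⟨a, ha, h⟩ := ih h
      exact ⟨a, by simp [ha], h⟩

section Product
variable {m : ℕ} (f : Fin m → Series)

/-- A coefficient of a tropical product is the minimum over all ways to distribute the index among
the factors. -/
theorem untrop_coeff_prod_le {a : Fin m → ℕ} {μ : ℕ} (ha : ∑ e, a e = μ) :
    untrop ((∏ e, f e).coeff μ) ≤ ∑ e, untrop ((f e).coeff (a e)) := by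
  rw [PowerSeries.coeff_prod, Finset.untrop_sum']
  refine (Finset.inf_le (b := Finsupp.equivFunOnFinite.symm a) (by
    simp [ha])).trans ?_
  simp [untrop_prod]

theorem exists_untrop_coeff_prod {μ : ℕ} (h : untrop ((∏ e, f e).coeff μ) ≠ ⊤) :
    ∃ a : Fin m → ℕ, ∑ e, a e = μ ∧
      untrop ((∏ e, f e).coeff μ) = ∑ e, untrop ((f e).coeff (a e)) := by
  rw [PowerSeries.coeff_prod, Finset.untrop_sum'] at h ⊢
  rcases Finset.eq_empty_or_nonempty (Finset.finsuppAntidiag (Finset.univ : Finset (Fin m)) μ)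
    with he | hne
  · rw [he] at h
    simp at h
  · obtain ⟨l, hl, h⟩ := Finset.exists_mem_eq_inf _ hne
      (untrop ∘ fun l : Fin m →₀ ℕ => ∏ i, (f i).coeff (l i))
    refine ⟨l, by simpa using hl, ?_⟩
    rw [h]
    simp [untrop_prod]

end Product

section
variable {I : HPInstance} (P : I.Presentation)

/-- A hyperedge as it is stored in memory. -/
def edgeData (e : Fin I.m) : HEdge :=
  (List.ofFn fun i => (P.order e i).1.1,
    (P.table e).map fun r => (List.ofFn fun i => r.1 (P.order e i), r.2.1.1, r.2.2, ()), ())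

/-- The instance as it is stored in memory. -/
def inputData : Input :=
  (I.k, I.b, I.d, I.q, I.n, I.m, List.ofFn I.col₀, List.ofFn (edgeData P), ())

theorem code_inputData : code (inputData P) = I.input P := by
  have h1 : ∀ (l : List (Option Colour)),
      code l = Data.ofList (l.map HPInstance.codeOptColour) := fun _ => rfl
  have h2 : ∀ e, code (edgeData P e) = HPInstance.codeEdge P e := by
    intro e
    simp only [edgeData, HPInstance.codeEdge, code, Data.ofList, List.map_ofFn, List.map_map]
    congr 3
    refine List.map_congr_left fun r _ => ?_
    simp only [Function.comp_apply, HPInstance.codeEntry, Data.ofList, List.map_ofFn]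
    rfl
  have h3 : code (List.ofFn (edgeData P)) =
      Data.ofList (List.ofFn fun e => HPInstance.codeEdge P e) := by
    rw [show code (List.ofFn (edgeData P)) =
      Data.ofList ((List.ofFn (edgeData P)).map code) from rfl, List.map_ofFn]
    congr 2
    funext e
    exact h2 e
  have h4 : code (List.ofFn I.col₀) =
      Data.ofList (List.ofFn fun v => HPInstance.codeOptColour (I.col₀ v)) := by
    rw [h1, List.map_ofFn]
    rfl
  rw [HPInstance.input, ← h3, ← h4]
  rfl

theorem map_edgeData (e : Fin I.m) (col : ℕ → Colour) :
    (edgeData P e).1.map col = List.ofFn fun i => col (P.order e i).1.1 := by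
  rw [edgeData, List.map_ofFn]
  rfl

/-- The coefficient is a minimum over matching rows. Each of them carries the true cost, every
finite cost has a row, and no row has an argument above `b`. -/
theorem coeff_edgeSeries (e : Fin I.m) (col : ℕ → Colour) (a : ℕ) :
    untrop ((edgeSeries (edgeData P e) ((edgeData P e).1.map col)).coeff a) =
      if h : a < I.b + 1 then I.cost e (fun v => col v.1.1) ⟨a, h⟩ else ⊤ := by
  rw [edgeSeries, ← val_eq, map_edgeData]
  have hrow : ∀ x ∈ edgeVec (edgeData P e).2.1 (List.ofFn fun i => col (P.order e i).1.1),
      ∃ h : x.1 < I.b + 1, I.cost e (fun v => col v.1.1) ⟨x.1, h⟩ = x.2 := by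
    intro x hx
    obtain ⟨r, hr, rfl⟩ := List.mem_map.1 hx
    rw [List.mem_filter] at hr
    obtain ⟨r', hr', rfl⟩ := List.mem_map.1 hr.1
    refine ⟨r'.2.1.2, ?_⟩
    have h1 : r'.1 = fun v => col v.1.1 := by
      have := List.ofFn_injective (of_decide_eq_true hr.2)
      funext v
      obtain ⟨i, rfl⟩ := (P.order e).surjective v
      exact congrFun this i
    rw [← h1]
    exact (P.mem_table e r'.1 r'.2.1 r'.2.2).1 hr'
  by_cases htop : val (edgeVec (edgeData P e).2.1 (List.ofFn fun i => col (P.order e i).1.1)) a = ⊤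
  · rw [htop]
    split
    case isTrue h =>
      by_contra hne
      obtain ⟨c, hc⟩ := ENat.ne_top_iff_exists.1 (Ne.symm hne)
      have hc' := (P.mem_table e _ _ _).2 hc.symm
      have h2 : (a, (c : ℕ∞)) ∈ edgeVec (edgeData P e).2.1
          (List.ofFn fun i => col (P.order e i).1.1) :=
        List.mem_map.2 ⟨_, List.mem_filter.2 ⟨List.mem_map.2 ⟨_, hc', rfl⟩, by simp⟩, rfl⟩
      have := val_le h2
      rw [htop] at this
      simp at this
    case isFalse => rfl
  · obtain ⟨x, hx, rfl, hv⟩ := exists_of_val_ne_top htop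
    obtain ⟨h, hc⟩ := hrow x hx
    rw [dif_pos h, hc, hv]

theorem allEdges_inputData :
    allEdges (inputData P) = List.ofFn (edgeData P) ++ precolourEdges (List.ofFn I.col₀) := rfl

theorem mem_precolourEdges {l : List (Option Colour)} {e : HEdge} :
    e ∈ precolourEdges l ↔ ∃ (v : ℕ) (c : Colour), l[v]? = some (some c) ∧
      e = ([v], [([c], 0, 0, ())], ()) := by
  rw [precolourEdges, List.mem_flatMap]
  constructor
  · rintro ⟨x, hx, hj⟩
    obtain ⟨i, hx⟩ := List.mem_iff_getElem?.1 hx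
    rw [List.getElem?_zip_eq_some] at hx
    obtain ⟨h1, h2⟩ := hx
    have h3 : x.2 = i := by
      rw [List.getElem?_eq_some_iff] at h2
      obtain ⟨h, h2⟩ := h2
      rw [← h2, List.getElem_range]
    rcases hx1 : x.1 with _ | c
    · simp [hx1] at hj
    · rw [hx1, if_neg (by simp), List.mem_singleton] at hj
      exact ⟨i, c, by rw [h1, hx1], by rw [hj, h3]; rfl⟩
  · rintro ⟨v, c, h, rfl⟩
    have hv : v < l.length := by
      by_contra hv
      rw [List.getElem?_eq_none (by omega)] at h
      simp at h
    refine ⟨(some c, v), List.mem_iff_getElem?.2 ⟨v, ?_⟩, by simp⟩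
    rw [List.getElem?_zip_eq_some]
    exact ⟨h, by simp [hv]⟩

theorem totalSeries_append (es es' : List HEdge) (col : ℕ → Colour) :
    totalSeries (es ++ es') col = totalSeries es col * totalSeries es' col := by
  simp [totalSeries]

/-- In the min-plus semiring `1` means cost 0 at argument 0 and `0` means `∞` everywhere: the
additional hyperedge is free of charge or forbids the colouring. -/
theorem edgeSeries_precolour (v : ℕ) (c c' : Colour) :
    edgeSeries ([v], [([c], 0, 0, ())], ()) [c'] = if c' = c then 1 else 0 := by
  unfold edgeSeries edgeVec
  by_cases h : c' = c
  · subst h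
    simpa using series_unit
  · simp [h, Ne.symm h, series]

/-- The costs of a colouring are those of the instance if it extends the partial colouring. -/
theorem totalSeries_eq (col : ℕ → Colour) [Decidable (I.Extends fun v => col v)] :
    totalSeries (allEdges (inputData P)) col = if I.Extends fun v => col v then
      ∏ e, edgeSeries (edgeData P e) ((edgeData P e).1.map col) else 0 := by
  rw [allEdges_inputData, totalSeries_append]
  have h1 : totalSeries (List.ofFn (edgeData P)) col =
      ∏ e, edgeSeries (edgeData P e) ((edgeData P e).1.map col) := by
    rw [totalSeries, List.map_ofFn, List.prod_ofFn]
    rfl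
  have hext : (I.Extends fun v => col v) ↔
      ∀ (v : ℕ) (c : Colour), (List.ofFn I.col₀)[v]? = some (some c) → col v = c := by
    constructor
    · intro h v c hv
      rw [List.getElem?_eq_some_iff] at hv
      obtain ⟨hv, hc⟩ := hv
      rw [List.length_ofFn] at hv
      rw [List.getElem_ofFn] at hc
      exact h ⟨v, hv⟩ c hc
    · intro h v c hv
      exact h v c (by simp [hv])
  rw [h1]
  split
  case isTrue h =>
    rw [hext] at h
    rw [totalSeries, List.prod_eq_one, mul_one]
    intro x hx
    obtain ⟨e, he, rfl⟩ := List.mem_map.1 hx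
    obtain ⟨v, c, hv, rfl⟩ := mem_precolourEdges.1 he
    rw [List.map_singleton, edgeSeries_precolour, if_pos (h v c hv)]
  case isFalse h =>
    rw [hext] at h
    push Not at h
    obtain ⟨v, c, hv, hc⟩ := h
    rw [totalSeries, List.prod_eq_zero, mul_zero]
    refine List.mem_map.2 ⟨_, mem_precolourEdges.2 ⟨v, c, hv, rfl⟩, ?_⟩
    rw [List.map_singleton, edgeSeries_precolour, if_neg hc]

theorem costAt_le {col : ℕ → Colour} (hcol : I.Extends fun v => col v)
    {a : Fin I.m → Fin (I.b + 1)} {μ : ℕ} (ha : ∑ e, (a e : ℕ) = μ) :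
    costAt (allEdges (inputData P)) col μ ≤ ∑ e, I.cost e (fun v => col v.1.1) (a e) := by
  classical
  rw [costAt, totalSeries_eq, if_pos hcol]
  refine (untrop_coeff_prod_le _ ha).trans (Finset.sum_le_sum fun e _ => ?_)
  rw [coeff_edgeSeries, dif_pos (a e).2]

theorem exists_of_costAt_ne_top {col : ℕ → Colour} {μ : ℕ}
    (h : costAt (allEdges (inputData P)) col μ ≠ ⊤) :
    (I.Extends fun v => col v) ∧ ∃ a : Fin I.m → Fin (I.b + 1), ∑ e, (a e : ℕ) = μ ∧
      costAt (allEdges (inputData P)) col μ = ∑ e, I.cost e (fun v => col v.1.1) (a e) := by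
  classical
  rw [costAt, totalSeries_eq] at h ⊢
  split at h
  case isFalse => simp at h
  case isTrue hcol =>
    refine ⟨hcol, ?_⟩
    rw [if_pos hcol]
    obtain ⟨a, ha, hs⟩ := exists_untrop_coeff_prod _ h
    -- The sum is finite, whereas the series of a hyperedge is `∞` beyond `b`.
    have hb : ∀ e, a e < I.b + 1 := by
      intro e
      by_contra hb
      rw [hs] at h
      refine h (WithTop.sum_eq_top.2 ⟨e, Finset.mem_univ _, ?_⟩)
      rw [coeff_edgeSeries, dif_neg hb]
      rfl
    refine ⟨fun e => ⟨a e, hb e⟩, ha, hs.trans (Finset.sum_congr rfl fun e _ => ?_)⟩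
    rw [coeff_edgeSeries, dif_pos (hb e)]

theorem lt_of_mem_allEdges {e : HEdge} (he : e ∈ allEdges (inputData P)) {v : ℕ} (hv : v ∈ e.1) :
    v < I.n := by
  rw [allEdges_inputData, List.mem_append] at he
  rcases he with he | he
  · obtain ⟨e, rfl⟩ := (List.mem_ofFn' _ _).1 he
    obtain ⟨i, rfl⟩ := (List.mem_ofFn' _ _).1 hv
    exact (P.order e i).1.2
  · obtain ⟨w, c, hw, rfl⟩ := mem_precolourEdges.1 he
    rw [List.mem_singleton.1 hv]
    rw [List.getElem?_eq_some_iff] at hw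
    obtain ⟨hw, -⟩ := hw
    simpa using hw

end

theorem monochromatic_of_not_bichromatic {col : ℕ → Colour} {l : List ℕ}
    (h : bichromatic (l.map col) ≠ true) : Monochromatic col l := by
  simp only [bichromatic, Bool.and_eq_true, List.any_eq_true, List.mem_map, decide_eq_true_eq,
    exists_exists_and_eq_and, not_and, not_exists, ne_eq] at h
  intro u hu v hv
  rcases hcu : col u with _ | _ <;> rcases hcv : col v with _ | _
  · rfl
  · exact absurd hcv (h ⟨u, hu, hcu⟩ v hv)
  · exact absurd hcu (h ⟨v, hv, hcv⟩ u hu)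
  · rfl

section
variable {s t : Colour} {n q : ℕ} {x : Input} {col : ℕ → Colour}

/-- A colouring in which `s` is rare and which has few bichromatic hyperedges is described by some
mask. -/
theorem exists_describes (hn : ∀ e ∈ allEdges x, ∀ v ∈ e.1, v < n)
    (hA : ((Finset.range (allEdges x).length).filter fun i =>
      bichromatic (((allEdges x).getD i ([], [], ())).1.map col) = true).card ≤ x.1)
    (hB : ((Finset.range n).filter fun v => col v = s).card ≤ x.2.2.2.1)
    (hc : ∀ e ∈ allEdges x, bichromatic (e.1.map col) = true → e.1.map col ∈ candidates e) :
    ∃ lab ∈ masks x, Describes s n ((allEdges x).zip lab) col := by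
  set es := allEdges x with hes
  set vs : ℕ → List ℕ := fun i => (es.getD i ([], [], ())).1 with hvs
  set A := (Finset.range es.length).filter fun i => bichromatic ((vs i).map col) = true with hAdef
  set M := (Finset.range es.length).filter fun i => ∀ v ∈ vs i, col v = s with hM
  have hvs' : ∀ i (hi : i < es.length), vs i = es[i].1 := fun i hi => by
    simp only [hvs, List.getD_eq_getElem _ _ hi]
  -- All vertices of members of `M` have colour `s`, so `S` need not be larger than the number of
  -- such vertices.
  obtain ⟨S, hSM, hScard, hS⟩ := exists_spanning_subset M vs
    ((Finset.range n).filter fun v => col v = s) (by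
      intro i hi v hv
      rw [hM, Finset.mem_filter, Finset.mem_range] at hi
      refine Finset.mem_filter.2 ⟨Finset.mem_range.2 (hn _ (List.getElem_mem hi.1) v ?_), hi.2 v hv⟩
      rwa [← hvs' i hi.1])
  have hMA : ∀ i ∈ M, i ∉ A := by
    intro i hi hiA
    have h1 := (Finset.mem_filter.1 hi).2
    have h2 := (Finset.mem_filter.1 hiA).2
    simp only [bichromatic, Bool.and_eq_true, List.any_eq_true, List.mem_map, decide_eq_true_eq,
      exists_exists_and_eq_and] at h2
    obtain ⟨⟨u, hu, hu'⟩, v, hv, hv'⟩ := h2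
    rw [h1 u hu] at hu'
    rw [h1 v hv, hu'] at hv'
    simp at hv'
  have hlt : ∀ i ∈ A, i < es.length := fun i hi => by
    simpa using (Finset.mem_filter.1 hi).1
  have hltM : ∀ i ∈ M, i < es.length := fun i hi => by
    simpa using (Finset.mem_filter.1 hi).1
  obtain ⟨lab, hlab, hg⟩ := exists_mem_masks (x := x) (A := A) (S := S)
    (g := fun i => if i ∈ A then (vs i).map col else []) hlt
    (fun i hi => hltM i (hSM hi)) hA (hScard.trans hB) (by
      intro i hi
      have h1 := hlt i hi
      simp only [hi, if_true]
      rw [List.getD_eq_getElem _ _ (by simpa [cands] using h1), hvs' i h1]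
      simp only [cands, List.getElem_map]
      refine hc _ (List.getElem_mem h1) ?_
      rw [← hvs' i h1]
      exact (Finset.mem_filter.1 hi).2) (by
      intro i hi h0
      simp only [hi, if_true, List.map_eq_nil_iff] at h0
      have := (Finset.mem_filter.1 hi).2
      rw [h0] at this
      simp [bichromatic] at this) (fun i _ hi => by simp [hi])
  have hlen : lab.length = es.length := length_of_mem_masks hlab
  refine ⟨lab, hlab, ?_⟩
  have hidx : ∀ y ∈ es.zip lab, ∃ i, ∃ hi : i < es.length, y = (es[i], lab.getD i []) := by
    intro y hy
    obtain ⟨i, hi, rfl⟩ := List.mem_iff_getElem.1 hy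
    rw [List.length_zip] at hi
    exact ⟨i, by omega, by rw [List.getElem_zip, List.getD_eq_getElem]⟩
  have hunl : ∀ y ∈ es.zip lab, y.2 = [] → Monochromatic col y.1.1 := by
    intro y hy h0
    obtain ⟨i, hi, rfl⟩ := hidx y hy
    refine monochromatic_of_not_bichromatic fun hb => ?_
    have hiA : i ∈ A := by
      rw [hAdef, Finset.mem_filter, Finset.mem_range, hvs' i hi]
      exact ⟨hi, hb⟩
    have := hg i (Finset.mem_union_left _ hiA)
    simp only [hiA, if_true] at this
    dsimp only at h0
    rw [h0, hvs' i hi] at this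
    rw [← this] at hb
    simp [bichromatic] at hb
  refine ⟨hunl, fun y hy => ?_⟩
  obtain ⟨hy, hhard⟩ := List.mem_filter.1 hy
  obtain ⟨i, hi, rfl⟩ := hidx y hy
  by_cases hiA : i ∈ A
  · left
    have := hg i (Finset.mem_union_left _ hiA)
    simp only [hiA, if_true] at this
    rw [this, hvs' i hi]
  right
  intro v hv hvs0
  have hmono : Monochromatic col es[i].1 := by
    refine monochromatic_of_not_bichromatic fun hb => hiA ?_
    rw [hAdef, Finset.mem_filter, Finset.mem_range, hvs' i hi]
    exact ⟨hi, hb⟩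
  have hiM : i ∈ M := by
    rw [hM, Finset.mem_filter, Finset.mem_range, hvs' i hi]
    exact ⟨hi, fun u hu => (hmono u hu v hv).trans hvs0⟩
  obtain ⟨X, hX, hvX⟩ := covers_components (le := es.zip lab) (hn _ (List.getElem_mem hi) v hv)
  have hd := components_disjoint n (es.zip lab)
  -- Members of `S` are blank, so each lies in one component and the indicator of `X` is constant on
  -- it. It is then constant on hyperedge `i` of `M`, which therefore lies inside `X` and is not
  -- hard.
  have hf := hS (fun u => if u ∈ X then 1 else 0) (by
    intro j hj u hu w hw
    have hj' := hltM j (hSM hj)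
    have h0 : lab.getD j [] = [] := by
      rw [hg j (Finset.mem_union_right _ hj), if_neg (hMA j (hSM hj))]
    have hmem : (es[j], lab.getD j []) ∈ es.zip lab := by
      refine List.mem_iff_getElem.2 ⟨j, by rw [List.length_zip]; omega, ?_⟩
      rw [List.getElem_zip, List.getD_eq_getElem _ _ (by omega)]
    obtain ⟨Y, hY, hjY⟩ := exists_component hmem (hn _ (List.getElem_mem hj')) h0
    rw [hvs' j hj'] at hu hw
    have key : ∀ u ∈ es[j].1, (u ∈ X ↔ X = Y) := fun u hu =>
      ⟨fun h => eq_of_disjoint hd hX hY h (hjY hu), fun h => h ▸ hjY hu⟩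
    simp only [key u hu, key w hw]) i hiM
  rw [hvs' i hi] at hf
  have hsub : ∀ u ∈ es[i].1, u ∈ X := by
    intro u hu
    by_contra hne
    have := hf u hu v hv
    simp [hne, hvX] at this
  have : ((components (List.range n) (es.zip lab)).any fun X =>
      es[i].1.all fun v => decide (v ∈ X)) = true := by
    simp only [List.any_eq_true, List.all_eq_true, decide_eq_true_eq]
    exact ⟨X, hX, hsub⟩
  rw [this] at hhard
  simp at hhard

end

end Painting

/-! ### Correctness of the algorithm. -/

namespace Painting

section
variable {I : HPInstance} (P : I.Presentation)

/-- Soundness, for good and bad masks alike. -/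
theorem exists_costAt_of_bestVec {μ : ℕ} (hμ : μ ≤ I.b)
    (h : val (bestVec (List.range (I.b + 1)) (List.range I.n) (allEdges (inputData P))
      (masks (inputData P))) μ ≠ ⊤) :
    ∃ col, val (bestVec (List.range (I.b + 1)) (List.range I.n) (allEdges (inputData P))
      (masks (inputData P))) μ = costAt (allEdges (inputData P)) col μ := by
  obtain ⟨lab, hlab, h1⟩ := exists_val_flatMap _ h
  have hsep (s : Colour) := separated_freeSets (s := s) (length_of_mem_masks hlab)
    (fun e he v hv => lt_of_mem_allEdges P he hv)
  have h2 : val (bestVec (List.range (I.b + 1)) (List.range I.n) (allEdges (inputData P))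
      (masks (inputData P))) μ = _ := h1
  rw [val_append] at h2
  rw [h2]
  rcases min_choice (val (solve (List.range (I.b + 1)) .black .white (List.range I.n)
    (allEdges (inputData P)) lab) μ) (val (solve (List.range (I.b + 1)) .white .black
    (List.range I.n) (allEdges (inputData P)) lab) μ) with h3 | h3 <;> rw [h3]
  · exact exists_costAt_eq_dp _ _ (hsep _) hμ
  · exact exists_costAt_eq_dp _ _ (hsep _) hμ

theorem bestVec_le_of_describes {s t : Colour} (hst : ∀ c, c ≠ s ↔ c = t) {μ : ℕ} (hμ : μ ≤ I.b)
    {lab : List (List Colour)} (hlab : lab ∈ masks (inputData P)) {col : ℕ → Colour}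
    (h : Describes s I.n ((allEdges (inputData P)).zip lab) col) :
    val (bestVec (List.range (I.b + 1)) (List.range I.n) (allEdges (inputData P))
      (masks (inputData P))) μ ≤ costAt (allEdges (inputData P)) col μ := by
  refine (val_flatMap_le _ μ hlab).trans ?_
  obtain ⟨T, hT, hcol⟩ := h.exists_sublist hst
  have h1 := dp_le_costAt s t (separated_freeSets (length_of_mem_masks hlab)
    (fun e he v hv => lt_of_mem_allEdges P he hv)) hμ hT
  have h2 : costAt (allEdges (inputData P)) (twoColouring s t T.flatten) μ =
      costAt (allEdges (inputData P)) col μ := by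
    rw [costAt, costAt, totalSeries_congr fun e he v hv => hcol v (lt_of_mem_allEdges P he hv)]
  rw [h2] at h1
  refine le_trans ?_ h1
  rw [val_append]
  cases s
  · obtain rfl : Colour.white = t := (hst _).1 (by simp)
    exact min_le_left _ _
  · obtain rfl : Colour.black = t := (hst _).1 (by simp)
    exact min_le_right _ _

theorem exists_of_bichromatic {e : Fin I.m} {col : ℕ → Colour}
    (h : bichromatic ((edgeData P e).1.map col) = true) (c : Colour) :
    0 < HPInstance.colourCount (fun v : {v // v ∈ I.edge e} => col v.1.1) c := by
  rw [map_edgeData] at h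
  simp only [bichromatic, Bool.and_eq_true, List.any_eq_true, decide_eq_true_eq,
    List.mem_ofFn', Set.mem_range, exists_exists_eq_and] at h
  have key : ∃ i, col (P.order e i).1.1 = c := by
    cases c
    · exact h.1
    · exact h.2
  obtain ⟨i, hi⟩ := key
  exact Finset.card_pos.2 ⟨P.order e i, by simpa using hi⟩

/-- The hyperedges added for precoloured vertices have a single vertex, so they are never
bichromatic. -/
theorem edge_of_bichromatic {col : ℕ → Colour} {i : ℕ} (hi : i < (allEdges (inputData P)).length)
    (h : bichromatic (((allEdges (inputData P))[i]).1.map col) = true) :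
    ∃ e : Fin I.m, e.1 = i ∧ (allEdges (inputData P))[i] = edgeData P e := by
  by_cases him : i < I.m
  · refine ⟨⟨i, him⟩, rfl, ?_⟩
    simp only [allEdges_inputData]
    rw [List.getElem_append_left (by simpa using him), List.getElem_ofFn]
  · exfalso
    have h1 : (allEdges (inputData P))[i] ∈ precolourEdges (List.ofFn I.col₀) := by
      simp only [allEdges_inputData]
      rw [List.getElem_append_right (by simpa using him)]
      exact List.getElem_mem _
    obtain ⟨v, c, -, hv⟩ := mem_precolourEdges.1 h1
    rw [hv] at h
    cases hc : col v <;> simp [bichromatic, hc] at h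

theorem mem_candidates_of_ne_top {e : Fin I.m} {col : ℕ → Colour} {a : Fin (I.b + 1)}
    (hc : I.cost e (fun v => col v.1.1) a ≠ ⊤)
    (h : bichromatic ((edgeData P e).1.map col) = true) :
    (edgeData P e).1.map col ∈ candidates (edgeData P e) := by
  obtain ⟨c, hc⟩ := ENat.ne_top_iff_exists.1 hc
  refine mem_candidates.2 ⟨h, _, List.mem_map.2 ⟨_, (P.mem_table e _ _ _).2 hc.symm, rfl⟩, ?_⟩
  rw [map_edgeData]

/-- The main step of the proof of correctness: no colouring of cost at most `k` with few vertices in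
one of the colours is missed. -/
theorem bestVec_le (hI : I.ConnectedCosts) {col : Fin I.n → Colour} (hcol : I.Extends col)
    (hq : min (HPInstance.colourCount col .black) (HPInstance.colourCount col .white) ≤ I.q)
    {a : Fin I.m → Fin (I.b + 1)} {μ : ℕ} (hμ : μ ≤ I.b) (ha : ∑ e, (a e : ℕ) = μ)
    (hk : ∑ e, I.cost e (fun v => col v) (a e) ≤ (I.k : ℕ∞)) :
    val (bestVec (List.range (I.b + 1)) (List.range I.n) (allEdges (inputData P))
      (masks (inputData P))) μ ≤ ∑ e, I.cost e (fun v => col v) (a e) := by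
  -- The value beyond the vertices is arbitrary, as no hyperedge sees it.
  let col' : ℕ → Colour := fun v => if h : v < I.n then col ⟨v, h⟩ else .white
  have hcol' : ∀ v : Fin I.n, col' v = col v := fun v => by simp [col']
  have hcost : ∀ e, I.cost e (fun v => col v) (a e) = I.cost e (fun v => col' v.1.1) (a e) :=
    fun e => by simp only [hcol']
  simp only [hcost] at hk ⊢
  obtain ⟨s, t, hst, hs⟩ : ∃ s t : Colour, (∀ c, c ≠ s ↔ c = t) ∧
      HPInstance.colourCount col s ≤ I.q := by
    rcases min_le_iff.1 hq with h | h
    · exact ⟨.black, .white, fun c => by cases c <;> simp, h⟩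
    · exact ⟨.white, .black, fun c => by cases c <;> simp, h⟩
  have hne : ∀ e, I.cost e (fun v => col' v.1.1) (a e) ≠ ⊤ := fun e h =>
    (ENat.natCast_lt_top I.k).not_ge (hk.trans' (h ▸ Finset.single_le_sum
      (f := fun e => I.cost e (fun v => col' v.1.1) (a e)) (fun _ _ => zero_le)
      (Finset.mem_univ e)))
  obtain ⟨lab, hlab, hd⟩ := exists_describes (s := s) (n := I.n) (x := inputData P) (col := col')
    (fun e he v hv => lt_of_mem_allEdges P he hv) (by
      -- By connectivity every bichromatic hyperedge costs at least 1, and the total is at most `k`.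
      let A' := Finset.univ.filter fun e => 1 ≤ I.cost e (fun v => col' v.1.1) (a e)
      have h1 : ((A'.card : ℕ) : ℕ∞) ≤ I.k := by
        refine le_trans ?_ hk
        rw [Finset.cast_card]
        exact (Finset.sum_le_sum fun e he => (Finset.mem_filter.1 he).2).trans
          (Finset.sum_le_sum_of_subset (Finset.subset_univ _))
      refine le_trans ?_ (Nat.cast_le.1 h1 : A'.card ≤ I.k)
      refine (Finset.card_le_card (t := A'.image Fin.val) fun i hi => ?_).trans
        Finset.card_image_le
      rw [Finset.mem_filter, Finset.mem_range] at hi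
      obtain ⟨hi, hb⟩ := hi
      rw [List.getD_eq_getElem _ _ hi] at hb
      obtain ⟨e, rfl, he⟩ := edge_of_bichromatic P hi hb
      rw [he] at hb
      refine Finset.mem_image.2 ⟨e, Finset.mem_filter.2 ⟨Finset.mem_univ _, ?_⟩, rfl⟩
      exact Order.one_le_iff_ne_zero.2 (hI e _ (exists_of_bichromatic P hb _)
        (exists_of_bichromatic P hb _) _)) (by
      refine le_trans ?_ hs
      refine (Finset.card_le_card (t := (Finset.univ.filter fun v => col v = s).image Fin.val)
        fun v hv => ?_).trans Finset.card_image_le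
      rw [Finset.mem_filter, Finset.mem_range] at hv
      refine Finset.mem_image.2 ⟨⟨v, hv.1⟩, Finset.mem_filter.2 ⟨Finset.mem_univ _, ?_⟩, rfl⟩
      rw [← hcol']
      exact hv.2) (by
      intro e he hb
      obtain ⟨i, hi, rfl⟩ := List.mem_iff_getElem.1 he
      obtain ⟨e, rfl, he⟩ := edge_of_bichromatic P hi hb
      rw [he] at hb ⊢
      exact mem_candidates_of_ne_top P (hne e) hb)
  refine (bestVec_le_of_describes P hst hμ hlab hd).trans (costAt_le P ?_ ha)
  simpa only [hcol'] using hcol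

/-- For `≤`, global unbreakability supplies an optimal colouring with a rare colour, and no such
colouring is missed. For `≥`, every value up to `k` that is found is the cost of an admissible
colouring. -/
theorem w_eq (hI : I.IsProper) (μ : Fin (I.b + 1)) :
    (if val (bestVec (List.range (I.b + 1)) (List.range I.n) (allEdges (inputData P))
      (masks (inputData P))) μ ≤ I.k then val (bestVec (List.range (I.b + 1)) (List.range I.n)
      (allEdges (inputData P)) (masks (inputData P))) μ else ⊤) = I.w μ := by
  have hμ : μ.1 ≤ I.b := by omega
  apply le_antisymm
  · rcases eq_or_ne (I.w μ) ⊤ with h | h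
    · rw [h]
      exact le_top
    · obtain ⟨col, ⟨hcol, a, ha, hw⟩, hq⟩ := hI.2.2 μ h.lt_top
      rw [HPInstance.totalCost] at hw
      split at hw
      case isTrue hk =>
        have h1 := bestVec_le P hI.2.1 hcol hq hμ ha hk
        rw [if_pos (h1.trans hk), ← hw]
        exact h1
      case isFalse => exact absurd hw.symm h
  · split
    case isTrue hk =>
      obtain ⟨col, hc⟩ := exists_costAt_of_bestVec P hμ (hk.trans_lt (ENat.natCast_lt_top _)).ne
      rw [hc] at hk ⊢
      obtain ⟨hcol, a, ha, hs⟩ := exists_of_costAt_ne_top P (hk.trans_lt (ENat.natCast_lt_top _)).ne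
      rw [hs] at hk ⊢
      refine (iInf₂_le (fun v => col v.1) hcol).trans ((iInf₂_le a ha).trans ?_)
      rw [HPInstance.totalCost, if_pos hk]
    case isFalse => exact le_top

theorem code_algorithm (hI : I.IsProper) : code (algorithm (inputData P)) = I.solution := by
  have h : algorithm (inputData P) = List.ofFn fun μ => I.w μ := by
    refine List.ext_getElem (by simp [algorithm, finish, inputData]) fun i h1 h2 => ?_
    rw [List.length_ofFn] at h2
    rw [List.getElem_ofFn, ← w_eq P hI]
    simp only [algorithm, finish, List.getElem_map, List.getElem_range]
    simp only [inputData, List.length_ofFn]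
    congr
  rw [h, HPInstance.solution]
  change Data.ofList _ = _
  rw [List.map_ofFn]
  rfl

end

end Painting

/-! ### Estimates -/

/-- A colouring is determined by a list of its vertices of colour `x`; `none` pads this list to
length `s`. -/
theorem card_colourings_le {F : Type} [Fintype F] [DecidableEq F] (x : Colour) (s : ℕ) :
    (Finset.univ.filter fun c : F → Colour => HPInstance.colourCount c x ≤ s).card ≤
      (Fintype.card F + 1) ^ s := by
  have hxy : ∃ y : Colour, ∀ c, c ≠ x ↔ c = y := by
    cases x
    · exact ⟨.white, fun c => by cases c <;> simp⟩
    · exact ⟨.black, fun c => by cases c <;> simp⟩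
  obtain ⟨y, hy⟩ := hxy
  classical
  have h := Finset.card_le_card_of_surjOn (s := (Finset.univ : Finset (Fin s → Option F)))
    (t := Finset.univ.filter fun c : F → Colour => HPInstance.colourCount c x ≤ s)
    (fun g v => if ∃ i, g i = some v then x else y) (by
      intro c hc
      have hc : HPInstance.colourCount c x ≤ s := by simpa using hc
      have hlen : (Finset.univ.filter fun v => c v = x).toList.length ≤ s := by
        simpa [HPInstance.colourCount] using hc
      refine ⟨fun i => (Finset.univ.filter fun v => c v = x).toList[i.1]?, by simp, ?_⟩
      funext v
      by_cases hv : c v = x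
      · have hm : v ∈ (Finset.univ.filter fun v => c v = x).toList := by simpa using hv
        obtain ⟨i, hi⟩ := List.mem_iff_getElem?.1 hm
        have his : i < (Finset.univ.filter fun v => c v = x).toList.length := by
          by_contra h
          rw [List.getElem?_eq_none (by omega)] at hi
          simp at hi
        dsimp only
        rw [if_pos ⟨⟨i, by omega⟩, hi⟩, hv]
      · dsimp only
        rw [if_neg, (hy _).1 hv]
        rintro ⟨i, hi⟩
        have := List.mem_of_getElem? hi
        exact hv (by simpa using this))
  simpa using h

/-- The rising factorial is `j !` times a binomial coefficient. With `L` logarithmic and `j = 2 * k`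
this trades a power of the logarithm for `(2 * k)!`, a power of two and a polynomial factor. -/
theorem pow_le_factorial_mul (L j : ℕ) : (L + 1) ^ j ≤ j.factorial * 2 ^ (L + j) := by
  refine (Nat.pow_succ_le_ascFactorial (L + 1) j).trans ?_
  rw [Nat.ascFactorial_eq_factorial_mul_choose]
  exact Nat.mul_le_mul_left _ (Nat.choose_le_two_pow _ _)

/-! ### The main term, the size of the input and the number of labellings. -/

namespace Painting

/-- A proper instance in a given presentation. -/
abbrev ProperInput := (I : {I : HPInstance // I.IsProper}) × I.1.Presentation

/-- The main term of the running time. -/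
def mainTerm (I : HPInstance) : ℕ := I.q ^ I.k * I.d ^ I.k ^ 2 * (I.n + I.m + I.b)

/-- A power of the main term has the form of the required time bound, so polynomial bounds in it are
enough. -/
def Small (g : ProperInput → ℕ) : Prop :=
  ∃ Q : Polynomial ℕ, ∀ x, g x ≤ Q.eval (mainTerm x.1.1)

namespace Small
variable {f g : ProperInput → ℕ}

theorem mono (hg : Small g) (h : ∀ x, f x ≤ g x) : Small f := by
  obtain ⟨Q, hQ⟩ := hg
  exact ⟨Q, fun x => (h x).trans (hQ x)⟩

theorem add (hf : Small f) (hg : Small g) : Small fun x => f x + g x := by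
  obtain ⟨P, hP⟩ := hf
  obtain ⟨Q, hQ⟩ := hg
  exact ⟨P + Q, fun x => by rw [Polynomial.eval_add]; exact Nat.add_le_add (hP x) (hQ x)⟩

theorem mul (hf : Small f) (hg : Small g) : Small fun x => f x * g x := by
  obtain ⟨P, hP⟩ := hf
  obtain ⟨Q, hQ⟩ := hg
  exact ⟨P * Q, fun x => by rw [Polynomial.eval_mul]; exact Nat.mul_le_mul (hP x) (hQ x)⟩

theorem const (c : ℕ) : Small fun _ => c := ⟨.C c, fun x => by simp⟩

theorem pow_mainTerm (c : ℕ) : Small fun x => mainTerm x.1.1 ^ c := ⟨.X ^ c, fun x => by simp⟩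

end Small

section
variable (I : HPInstance)

theorem size_le_mainTerm : I.n + I.m + I.b ≤ mainTerm I :=
  Nat.le_mul_of_pos_left _ (Nat.mul_pos (Nat.pow_pos I.q_pos) (Nat.pow_pos I.d_pos))

theorem mainTerm_pos : 0 < mainTerm I := by
  have := size_le_mainTerm I
  have := I.b_pos
  omega

theorem d_pow_le_mainTerm : I.d ^ I.k ^ 2 ≤ mainTerm I := by
  have := I.b_pos
  rw [mainTerm, mul_right_comm]
  exact Nat.le_mul_of_pos_left _ (Nat.mul_pos (Nat.pow_pos I.q_pos) (by omega))

theorem q_pow_le_mainTerm : I.q ^ I.k ≤ mainTerm I := by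
  have := I.b_pos
  rw [mainTerm, mul_assoc]
  exact Nat.le_mul_of_pos_right _ (Nat.mul_pos (Nat.pow_pos I.d_pos) (by omega))

theorem q_le_mainTerm : I.q ≤ mainTerm I :=
  (Nat.le_self_pow I.k_pos.ne' _).trans (q_pow_le_mainTerm I)

theorem two_pow_le_mainTerm (hd : 2 ≤ I.d) : 2 ^ I.k ^ 2 ≤ mainTerm I :=
  (Nat.pow_le_pow_left hd _).trans (d_pow_le_mainTerm I)

theorem k_le_mainTerm (hd : 2 ≤ I.d) : I.k ≤ mainTerm I :=
  (Nat.lt_two_pow_self.le.trans (Nat.pow_le_pow_right (by omega)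
    (Nat.le_self_pow (by norm_num) _))).trans (two_pow_le_mainTerm I hd)

/-- A bound for the number of colourings of a hyperedge of finite cost. -/
def colouringBound : ℕ := 2 * I.d ^ (6 * I.k)

theorem colouringBound_le : colouringBound I ≤ 2 * mainTerm I ^ 6 := by
  refine Nat.mul_le_mul_left _ (le_trans ?_ (Nat.pow_le_pow_left (d_pow_le_mainTerm I) 6))
  rw [← pow_mul]
  refine Nat.pow_le_pow_right I.d_pos ?_
  have : I.k ≤ I.k ^ 2 := Nat.le_self_pow (by norm_num) _
  omega

open Classical in
-- Finite cost forces one of the colours to occur at most `3 * k` times. For `d ≥ 2` each colour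
-- contributes at most `(d + 1) ^ (3 * k) ≤ d ^ (6 * k)`; for `d = 1` there are at most two
-- colourings in all.
theorem card_finite_le (hI : I.LocallyUnbreakable) (e : Fin I.m) :
    (Finset.univ.filter fun c : {v // v ∈ I.edge e} → Colour => ∃ μ, I.cost e c μ ≠ ⊤).card ≤
      colouringBound I := by
  have hF : Fintype.card {v // v ∈ I.edge e} ≤ I.d := by
    rw [Fintype.card_coe]
    exact I.edge_card_le e
  by_cases hd : 2 ≤ I.d
  · have h1 (x : Colour) : (Finset.univ.filter fun c : {v // v ∈ I.edge e} → Colour =>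
        HPInstance.colourCount c x ≤ 3 * I.k).card ≤ I.d ^ (6 * I.k) := by
      refine (card_colourings_le x _).trans ?_
      rw [show I.d ^ (6 * I.k) = (I.d ^ 2) ^ (3 * I.k) by rw [← pow_mul]; ring_nf]
      refine Nat.pow_le_pow_left ?_ _
      nlinarith
    refine (Finset.card_le_card (t := (Finset.univ.filter fun c : {v // v ∈ I.edge e} → Colour =>
        HPInstance.colourCount c .black ≤ 3 * I.k) ∪ Finset.univ.filter fun c =>
        HPInstance.colourCount c .white ≤ 3 * I.k) fun c hc => ?_).trans
      ((Finset.card_union_le _ _).trans ?_)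
    · obtain ⟨μ, hμ⟩ := (Finset.mem_filter.1 hc).2
      by_contra h
      simp only [Finset.mem_union, Finset.mem_filter, Finset.mem_univ, true_and, not_or,
        not_le] at h
      exact hμ (hI e c h.1 h.2 μ)
    · have := h1 .black
      have := h1 .white
      rw [colouringBound]
      omega
  · refine (Finset.card_le_univ _).trans ?_
    rw [Fintype.card_fun, colouringBound]
    have h2 : Fintype.card Colour = 2 := rfl
    rw [h2]
    have h3 : 1 ≤ I.d ^ (6 * I.k) := Nat.pow_pos I.d_pos
    have h4 := Nat.pow_le_pow_right (n := 2) (by omega)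
      (show Fintype.card {v // v ∈ I.edge e} ≤ 1 by omega)
    omega

end

section
variable {I : HPInstance} (P : I.Presentation)

/-- The value in a row is determined by the colouring and the argument, so distinct rows differ in
one of these. -/
theorem length_table_le (hI : I.LocallyUnbreakable) (e : Fin I.m) :
    (P.table e).length ≤ colouringBound I * (I.b + 1) := by
  classical
  rw [← List.toFinset_card_of_nodup (P.table_nodup e)]
  refine (Finset.card_le_card_of_injOn (t := (Finset.univ.filter fun c :
    {v // v ∈ I.edge e} → Colour => ∃ μ, I.cost e c μ ≠ ⊤) ×ˢ Finset.univ)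
    (fun r => (r.1, r.2.1)) (fun r hr => ?_) fun r hr r' hr' h => ?_).trans ?_
  · have hr := (P.mem_table e r.1 r.2.1 r.2.2).1 (List.mem_toFinset.1 hr)
    simp only [Finset.coe_product, Set.mem_prod, Finset.mem_coe, Finset.mem_filter,
      Finset.mem_univ, true_and, and_true]
    exact ⟨r.2.1, by simp [hr]⟩
  · have hr := (P.mem_table e r.1 r.2.1 r.2.2).1 (List.mem_toFinset.1 hr)
    have hr' := (P.mem_table e r'.1 r'.2.1 r'.2.2).1 (List.mem_toFinset.1 hr')
    obtain ⟨c, μ, a⟩ := r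
    obtain ⟨c', μ', a'⟩ := r'
    simp only [Prod.mk.injEq] at h
    obtain ⟨rfl, rfl⟩ := h
    rw [hr] at hr'
    have : a = a' := by exact_mod_cast hr'
    rw [this]
  · rw [Finset.card_product, Finset.card_univ, Fintype.card_fin]
    exact Nat.mul_le_mul_right _ (card_finite_le I hI e)

theorem card_edge_le (e : Fin I.m) : (I.edge e).card ≤ I.n := by
  simpa using Finset.card_le_univ (I.edge e)

theorem sz_edgeData_le (hI : I.LocallyUnbreakable) (e : Fin I.m) :
    sz (edgeData P e) ≤ colouringBound I * (I.b + 1) * (2 * I.n + 8) + 2 * I.n + 5 := by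
  have h1 : sz (edgeData P e).1 ≤ 2 * I.n + 1 := by
    have h := sz_list_le (l := (edgeData P e).1) (c := 1) fun a _ => le_rfl
    have h2 := card_edge_le e
    simp only [edgeData, List.length_ofFn] at h ⊢
    omega
  have h2 : sz (edgeData P e).2.1 ≤ (P.table e).length * (2 * I.n + 8) + 1 := by
    refine (sz_list_le (c := 2 * I.n + 7) fun r hr => ?_).trans (by simp [edgeData])
    obtain ⟨r, -, rfl⟩ := List.mem_map.1 hr
    have h := sz_list_le (l := List.ofFn fun i => r.1 (P.order e i)) (c := 1)
      fun a _ => (sz_colour a).le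
    have h2 := card_edge_le e
    rw [List.length_ofFn] at h
    simp only [sz_pair, sz_nat, sz_unit]
    omega
  have h3 := Nat.mul_le_mul_right (2 * I.n + 8) (length_table_le P hI e)
  have h4 : sz (edgeData P e) = sz (edgeData P e).1 + (sz (edgeData P e).2.1 + 1 + 1) + 1 := rfl
  omega

theorem sz_inputData_le (hI : I.LocallyUnbreakable) : sz (inputData P) ≤
    I.m * (colouringBound I * (I.b + 1) * (2 * I.n + 8) + 2 * I.n + 6) + 2 * I.n + 17 := by
  have h1 := sz_list_le (l := List.ofFn I.col₀) (c := 1) fun a _ => (sz_optColour a).le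
  have h2 := sz_list_le (l := List.ofFn (edgeData P)) fun e he => by
    obtain ⟨e, rfl⟩ := (List.mem_ofFn' _ _).1 he
    exact sz_edgeData_le P hI e
  simp only [inputData, sz_pair, sz_nat, sz_unit, List.length_ofFn] at h1 h2 ⊢
  rw [add_assoc _ 5 1, show 5 + 1 = 6 from rfl] at h2
  omega

theorem length_allEdges_le : (allEdges (inputData P)).length ≤ I.m + I.n := by
  rw [allEdges_inputData, List.length_append, List.length_ofFn]
  refine Nat.add_le_add_left ?_ _
  rw [precolourEdges, List.length_flatMap]
  refine (List.sum_le_card_nsmul _ 1 fun x hx => ?_).trans (by simp)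
  obtain ⟨y, -, rfl⟩ := List.mem_map.1 hx
  split <;> simp

/-- The candidates of a hyperedge come from its colourings of finite cost. -/
theorem exists_of_mem_candidates {e : HEdge} (he : e ∈ allEdges (inputData P)) {c : List Colour}
    (hc : c ∈ candidates e) : ∃ e', e = edgeData P e' ∧
      ∃ f : {v // v ∈ I.edge e'} → Colour, (∃ μ, I.cost e' f μ ≠ ⊤) ∧
        c = List.ofFn fun i => f (P.order e' i) := by
  obtain ⟨hb, r, hr, rfl⟩ := mem_candidates.1 hc
  rw [allEdges_inputData, List.mem_append] at he
  rcases he with he | he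
  · obtain ⟨e', rfl⟩ := (List.mem_ofFn' _ _).1 he
    obtain ⟨s, hs, rfl⟩ := List.mem_map.1 hr
    exact ⟨e', rfl, s.1, ⟨s.2.1, by
      rw [(P.mem_table e' s.1 s.2.1 s.2.2).1 hs]; simp⟩, rfl⟩
  · obtain ⟨v, c, -, rfl⟩ := mem_precolourEdges.1 he
    rw [List.mem_singleton] at hr
    rw [hr] at hb
    cases c <;> simp [bichromatic] at hb

theorem length_candidates_le (hI : I.LocallyUnbreakable) {e : HEdge}
    (he : e ∈ allEdges (inputData P)) : (candidates e).length ≤ colouringBound I := by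
  classical
  rcases List.eq_nil_or_concat (candidates e) with h | ⟨l, c, h⟩
  · simp [h]
  · obtain ⟨e', rfl, -⟩ := exists_of_mem_candidates P he (c := c) (by simp [h])
    rw [← List.toFinset_card_of_nodup (nodup_candidates _)]
    refine le_trans ?_ (card_finite_le I hI e')
    refine (Finset.card_le_card (t := (Finset.univ.filter fun c : {v // v ∈ I.edge e'} → Colour =>
      ∃ μ, I.cost e' c μ ≠ ⊤).image fun f => List.ofFn fun i => f (P.order e' i))
      fun c hc => ?_).trans Finset.card_image_le
    obtain ⟨e'', h1, f, hf, h2⟩ := exists_of_mem_candidates P he (List.mem_toFinset.1 hc)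
    obtain ⟨hb, r, hr, rfl⟩ := mem_candidates.1 (List.mem_toFinset.1 hc)
    obtain ⟨s, hs, rfl⟩ := List.mem_map.1 hr
    refine Finset.mem_image.2 ⟨s.1, Finset.mem_filter.2 ⟨Finset.mem_univ _, s.2.1, ?_⟩, rfl⟩
    rw [(P.mem_table e' s.1 s.2.1 s.2.2).1 hs]
    simp

theorem length_label_le {e : HEdge} (he : e ∈ allEdges (inputData P)) {c : List Colour}
    (hc : c ∈ candidates e) : c.length ≤ I.n := by
  obtain ⟨e', -, f, -, rfl⟩ := exists_of_mem_candidates P he hc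
  rw [List.length_ofFn]
  exact card_edge_le e'

theorem length_longest_le (hI : I.LocallyUnbreakable) :
    (longest (cands (inputData P))).length ≤ colouringBound I := by
  rcases (longest_spec (cands (inputData P))).2 with h | h
  · simp [h]
  · obtain ⟨e, he, h⟩ := List.mem_map.1 h
    rw [← h]
    exact length_candidates_le P hI he

/-- A bichromatic colouring needs two vertices. Hence whenever labels are used at all, `k` and `k ^
k` are bounded by the main term. -/
theorem two_le_d (h : longest (cands (inputData P)) ≠ []) : 2 ≤ I.d := by
  obtain ⟨e, he, h1⟩ := List.mem_map.1 ((longest_spec (cands (inputData P))).2.resolve_left h)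
  rw [← h1] at h
  obtain ⟨c, hc⟩ := List.exists_mem_of_ne_nil _ h
  obtain ⟨e', rfl, f, -, rfl⟩ := exists_of_mem_candidates P he hc
  have hb := (mem_candidates.1 hc).1
  refine le_trans ?_ (I.edge_card_le e')
  by_contra! hlt
  simp only [bichromatic, Bool.and_eq_true, List.any_eq_true, decide_eq_true_eq,
    List.mem_ofFn', Set.mem_range, exists_exists_eq_and] at hb
  obtain ⟨⟨i, hi⟩, j, hj⟩ := hb
  have : i = j := Fin.ext (by omega)
  rw [this, hj] at hi
  simp at hi

end

theorem length_foldl_extendMasks (O : List (List (List Colour))) (K : List ℕ)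
    (ms : List (List (List Colour))) :
    (K.foldl (extendMasks O) ms).length = ms.length * (1 + O.length) ^ K.length := by
  induction K generalizing ms with
  | nil => simp
  | cons a K ih =>
    rw [List.foldl_cons, ih, extendMasks]
    simp only [List.length_append, List.length_flatMap, List.length_map, List.map_const',
      List.sum_replicate, smul_eq_mul, List.length_cons, pow_succ]
    ring

theorem mem_overlay {a b : List (List Colour)} {c : List Colour} (h : c ∈ overlay a b) :
    c ∈ a ∨ c ∈ b := by
  obtain ⟨x, hx, rfl⟩ := List.mem_map.1 h
  have := List.of_mem_zip (show (x.1, x.2) ∈ a.zip b from hx)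
  split
  · exact .inr this.2
  · exact .inl this.1

theorem forall_mem_foldl_extendMasks {p : List Colour → Prop} {O : List (List (List Colour))}
    (hO : ∀ o ∈ O, ∀ c ∈ o, p c) (K : List ℕ) {ms : List (List (List Colour))}
    (hms : ∀ o ∈ ms, ∀ c ∈ o, p c) : ∀ o ∈ K.foldl (extendMasks O) ms, ∀ c ∈ o, p c := by
  induction K generalizing ms with
  | nil => exact hms
  | cons a K ih =>
    refine ih fun o ho c hc => ?_
    rcases List.mem_append.1 ho with ho | ho
    · exact hms o ho c hc
    · obtain ⟨o', ho', ho⟩ := List.mem_flatMap.1 ho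
      obtain ⟨o'', ho'', rfl⟩ := List.mem_map.1 ho
      rcases mem_overlay hc with hc | hc
      · exact hO o' ho' c hc
      · exact hms o'' ho'' c hc

theorem length_residueMasks (l : List (List (List Colour))) (U : List ℕ) :
    (residueMasks l U).length = U.length * (U.length * (longest l).length) := by
  simp [residueMasks, List.length_flatMap]

section
variable {I : HPInstance} (P : I.Presentation)

theorem length_le_of_mem_masks {lab : List (List Colour)} (h : lab ∈ masks (inputData P))
    {c : List Colour} (hc : c ∈ lab) : c.length ≤ I.n := by
  refine forall_mem_foldl_extendMasks (p := fun c => c.length ≤ I.n) ?_ _ ?_ lab h c hc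
  · intro o ho c hc
    obtain ⟨p, -, ho⟩ := List.mem_flatMap.1 ho
    obtain ⟨r, -, ho⟩ := List.mem_flatMap.1 ho
    obtain ⟨j, -, rfl⟩ := List.mem_map.1 ho
    obtain ⟨x, hx, rfl⟩ := List.mem_map.1 hc
    split
    · rw [nthLabel_eq]
      by_cases hj : j < x.1.length
      · rw [List.getD_eq_getElem _ _ hj]
        obtain ⟨e, he, hx⟩ := List.mem_map.1
          (List.of_mem_zip (show (x.1, x.2) ∈ _ from hx)).1
        refine length_label_le P he ?_
        rw [hx]
        exact List.getElem_mem _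
      · rw [List.getD_eq_default _ _ (by omega)]
        simp
    · simp
  · intro o ho c hc
    rw [List.mem_singleton.1 ho] at hc
    obtain ⟨x, -, rfl⟩ := List.mem_map.1 hc
    simp

theorem sz_masks_le : sz (masks (inputData P)) ≤
    (1 + (basicMasks (inputData P)).length) ^ depth (inputData P) *
      ((I.m + I.n) * (2 * I.n + 2) + 2) + 1 := by
  have h1 : (masks (inputData P)).length =
      (1 + (basicMasks (inputData P)).length) ^ depth (inputData P) := by
    rw [masks, length_foldl_extendMasks]
    simp
  rw [← h1]
  refine sz_list_le fun lab hlab => ?_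
  refine (sz_list_le (c := 2 * I.n + 1) fun c hc => ?_).trans (Nat.add_le_add_right
    (Nat.mul_le_mul_right _ ((length_of_mem_masks hlab).trans_le (length_allEdges_le P))) 1)
  have h2 := sz_list_le (l := c) (c := 1) fun a _ => (sz_colour a).le
  have h3 := length_le_of_mem_masks P hlab hc
  omega

theorem depth_le_mainTerm : depth (inputData P) ≤ mainTerm I := by
  rw [depth]
  split
  · omega
  case isFalse h => exact k_le_mainTerm I (two_le_d P h)

/-- From `k ≤ 2 ^ k` follows `k ^ k ≤ 2 ^ (k ^ 2) ≤ d ^ (k ^ 2)`. -/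
theorem k_pow_le_mainTerm (hd : 2 ≤ I.d) : I.k ^ I.k ≤ mainTerm I := by
  refine le_trans ?_ (two_pow_le_mainTerm I hd)
  rw [sq, pow_mul]
  exact Nat.pow_le_pow_left Nat.lt_two_pow_self.le _

/-- The number of basic masks is quadratic in the number of moduli and linear in the number of
candidates. Its power with exponent `k` splits into powers of `2 ^ k`, `k ^ k`, `q ^ k`, `d ^ (k ^
2)` and `(L + 1) ^ (2 * k)`, each polynomial in the main term. The final `+ 1` covers depth 0. -/
theorem masks_count_le (hI : I.LocallyUnbreakable) :
    (1 + (basicMasks (inputData P)).length) ^ depth (inputData P) ≤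
      mainTerm I ^ 25 * (2 * mainTerm I + 1) + 1 := by
  by_cases h : longest (cands (inputData P)) = []
  · simp [depth, h]
  have hd := two_le_d P h
  have hdepth : depth (inputData P) = I.k := by rw [depth, if_neg h]; rfl
  have hX := mainTerm_pos I
  set X := mainTerm I with hXdef
  set L := (logList (cands (inputData P))).length with hL
  set J := (longest (cands (inputData P))).length with hJdef
  have hJ : J ≤ 2 * I.d ^ (6 * I.k) := length_longest_le P hI
  have hJ1 : 1 ≤ J := List.length_pos_iff.2 h
  have hk := I.k_pos
  have hq := I.q_pos
  have hU : (modulusList (List.range I.k) (List.range I.q) (cands (inputData P))).length ≤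
      9 * I.k * I.q * (L + 1) := by
    rw [length_modulusList, List.length_range, List.length_range, ← hL]
    have h1 : I.k + I.q + 1 ≤ 3 * (I.k * I.q) := by nlinarith
    have h2 := Nat.mul_le_mul_right (L + 1) h1
    have h3 : 1 ≤ I.k * I.q * (L + 1) := Nat.mul_pos (Nat.mul_pos hk hq) (by omega)
    have h4 : 9 * I.k * I.q * (L + 1) = 3 * (3 * (I.k * I.q) * (L + 1)) := by ring
    have h5 : 3 * (I.k * I.q) * (L + 1) = 3 * (I.k * I.q * (L + 1)) := by ring
    omega
  -- The constant is `9 * 9 * 2 = 162`, and `1 + 162` is rounded up to a power of two because `2 ^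
  -- k` is under control.
  have hO : 1 + (basicMasks (inputData P)).length ≤
      2 ^ 9 * (I.k ^ 2 * (I.q ^ 2 * ((L + 1) ^ 2 * I.d ^ (6 * I.k)))) := by
    rw [basicMasks, hdepth, length_residueMasks]
    have h1 : (inputData P).2.2.2.1 = I.q := rfl
    rw [h1]
    have h2 := Nat.mul_le_mul hU (Nat.mul_le_mul hU hJ)
    have h3 : 1 ≤ I.k ^ 2 * (I.q ^ 2 * ((L + 1) ^ 2 * I.d ^ (6 * I.k))) := by
      have := I.d_pos
      exact Nat.succ_le_of_lt (by positivity)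
    have h4 : 9 * I.k * I.q * (L + 1) * (9 * I.k * I.q * (L + 1) * (2 * I.d ^ (6 * I.k))) =
      162 * (I.k ^ 2 * (I.q ^ 2 * ((L + 1) ^ 2 * I.d ^ (6 * I.k)))) := by ring
    rw [h4] at h2
    exact (Nat.add_le_add_left h2 1).trans (by omega)
  have p2 : 2 ^ I.k ≤ X := le_trans (Nat.pow_le_pow_right (by omega)
    (Nat.le_self_pow (by norm_num) _)) (two_pow_le_mainTerm I hd)
  have pk : I.k ^ I.k ≤ X := k_pow_le_mainTerm hd
  have pq : I.q ^ I.k ≤ X := q_pow_le_mainTerm I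
  have pd : I.d ^ I.k ^ 2 ≤ X := d_pow_le_mainTerm I
  have pL : 2 ^ L ≤ 2 * X + 1 := by
    have h1 := (logList_spec (cands (inputData P))).2
    have h2 := length_allEdges_le P
    have h3 := size_le_mainTerm I
    have h4 : (cands (inputData P)).length = (allEdges (inputData P)).length := by
      rw [cands, List.length_map]
    rw [← hL] at h1
    omega
  have pL2 : (L + 1) ^ (2 * I.k) ≤ X ^ 6 * (2 * X + 1) := by
    refine (pow_le_factorial_mul L (2 * I.k)).trans ?_
    have h1 : (2 * I.k).factorial ≤ (2 ^ I.k) ^ 2 * (I.k ^ I.k) ^ 2 := by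
      refine (Nat.factorial_le_pow _).trans (le_of_eq ?_)
      rw [mul_pow, ← pow_mul, ← pow_mul, mul_comm 2 I.k]
    have h2 : 2 ^ (L + 2 * I.k) = 2 ^ L * (2 ^ I.k) ^ 2 := by
      rw [pow_add, ← pow_mul, mul_comm 2 I.k]
    rw [h2]
    calc (2 * I.k).factorial * (2 ^ L * (2 ^ I.k) ^ 2)
        ≤ (X ^ 2 * X ^ 2) * ((2 * X + 1) * X ^ 2) := by
          refine Nat.mul_le_mul (h1.trans ?_) ?_ <;> gcongr
      _ = X ^ 6 * (2 * X + 1) := by ring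
  rw [hdepth]
  refine le_trans ?_ (Nat.le_succ _)
  calc (1 + (basicMasks (inputData P)).length) ^ I.k
      ≤ (2 ^ 9 * (I.k ^ 2 * (I.q ^ 2 * ((L + 1) ^ 2 * I.d ^ (6 * I.k))))) ^ I.k :=
        Nat.pow_le_pow_left hO _
    _ = (2 ^ I.k) ^ 9 * ((I.k ^ I.k) ^ 2 * ((I.q ^ I.k) ^ 2 * ((L + 1) ^ (2 * I.k) *
        (I.d ^ I.k ^ 2) ^ 6))) := by
        simp only [mul_pow, ← pow_mul]
        ring_nf
    _ ≤ X ^ 9 * (X ^ 2 * (X ^ 2 * (X ^ 6 * (2 * X + 1) * X ^ 6))) := by gcongr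
    _ = X ^ 25 * (2 * X + 1) := by ring

end

theorem small_cost : Small fun x => cost (inputData x.2) := by
  have hX : Small fun x => mainTerm x.1.1 := (Small.pow_mainTerm 1).mono fun x => by simp
  have hn : Small fun x => x.1.1.n := hX.mono fun x => by
    have := size_le_mainTerm x.1.1; omega
  have hm : Small fun x => x.1.1.m := hX.mono fun x => by
    have := size_le_mainTerm x.1.1; omega
  have hb : Small fun x => x.1.1.b := hX.mono fun x => by
    have := size_le_mainTerm x.1.1; omega
  have hq : Small fun x => x.1.1.q := hX.mono fun x => q_le_mainTerm _
  have hT : Small fun x => colouringBound x.1.1 :=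
    ((Small.const 2).mul (Small.pow_mainTerm 6)).mono fun x => colouringBound_le _
  have h2n (c : ℕ) : Small fun x => 2 * x.1.1.n + c := ((Small.const 2).mul hn).add (.const c)
  have hsz : Small fun x => sz (inputData x.2) := Small.mono
    (((hm.mul ((((hT.mul (hb.add (.const 1))).mul (h2n 8)).add
      ((Small.const 2).mul hn)).add (.const 6))).add ((Small.const 2).mul hn)).add (.const 17))
    fun x => sz_inputData_le x.2 x.1.2.1
  have hmasks : Small fun x => sz (masks (inputData x.2)) := by
    refine Small.mono ((((Small.pow_mainTerm 25).mul (((Small.const 2).mul hX).add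
      (.const 1))).add (.const 1)).mul (((hm.add hn).mul (h2n 2)).add (.const 2)) |>.add (.const 1))
      fun x => (sz_masks_le x.2).trans ?_
    exact Nat.add_le_add_right (Nat.mul_le_mul_right _ (masks_count_le x.2 x.1.2.1)) 1
  have hdepth : Small fun x => depth (inputData x.2) := hX.mono fun x => depth_le_mainTerm x.2
  exact (((hsz.add (hb.add (.const 1))).add hdepth).add hq).add hmasks

/-- For positive `x` all exponents may be raised to a common one. -/
theorem exists_eval_le_mul_pow (Q : Polynomial ℕ) : ∃ C, ∀ x, 0 < x → Q.eval x ≤ C * x ^ C := by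
  induction Q using Polynomial.induction_on' with
  | add p q hp hq =>
    obtain ⟨C, hC⟩ := hp
    obtain ⟨D, hD⟩ := hq
    refine ⟨C + D, fun x hx => ?_⟩
    rw [Polynomial.eval_add, add_mul]
    exact Nat.add_le_add ((hC x hx).trans (Nat.mul_le_mul_left _ (Nat.pow_le_pow_right hx (by omega))))
      ((hD x hx).trans (Nat.mul_le_mul_left _ (Nat.pow_le_pow_right hx (by omega))))
  | monomial n c =>
    refine ⟨n + c, fun x hx => ?_⟩
    rw [Polynomial.eval_monomial]
    exact Nat.mul_le_mul (by omega) (Nat.pow_le_pow_right hx (by omega))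

end Painting

open Painting in
theorem lemma4p3 :
    ∃ (p : Program) (C : ℕ), ∀ I : HPInstance, I.IsProper → ∀ P : I.Presentation,
      ∃ t : ℕ, p.Runs (I.input P) I.solution t ∧
        t ≤ C * I.q ^ (C * I.k) * I.d ^ (C * I.k ^ 2) * (I.n + I.m + I.b) ^ C := by
  obtain ⟨p, R, hp⟩ := within_algorithm
  obtain ⟨Q, hQ⟩ := small_cost
  obtain ⟨C, hC⟩ := exists_eval_le_mul_pow (R.comp Q)
  refine ⟨p, C, fun I hI P => ?_⟩
  obtain ⟨t, h1, h2, -⟩ := hp (inputData P)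
  rw [code_inputData, code_algorithm P hI] at h1
  refine ⟨t, h1, ?_⟩
  have h3 := h2.trans ((eval_mono R (hQ ⟨⟨I, hI⟩, P⟩)).trans
    ((Polynomial.eval_comp (R := ℕ)).symm.trans_le (hC _ (mainTerm_pos I))))
  -- Expanding `C` times the main term to the power `C` gives exactly the claimed bound.
  refine h3.trans (le_of_eq ?_)
  simp only [mainTerm, mul_pow, ← pow_mul]
  ring_nf
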